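/- **Setting.** Let $w_e,w_r,w_{\min}>0$, $w_{er}=w_e+w_r$, $w_{\max}=\sqrt{w_{\min}^2+2w_{er}w_{\min}}$, $0<h_1<h_2$, $0<\phi<\pi/2$. Let $R\in\mathbb R^3$ be a point at distance $w_{er}$ from the centre of the Earth. The satellite $S$ is uniformly distributed on the part of the sphere of radius $w_{er}+w_{\min}$ about the centre of the Earth lying above the horizontal plane through $R$. The aerial receiver $T$ is uniformly distributed in the truncated cone with apex $R$, downward vertical axis and half-angle $\phi$, between the horizontal planes at distances $h_1$ and $h_2$ below $R$. Put $w_{sr}=|S-R|$, $w_{rt}=|T-R|$. The satellite link has shadowed-Rician fading with parameters $m_{sr}\in\mathbb N_{\ge1}$, $\flat_{sr}>0$, $\Omega_{sr}\ge0$: $X=|g_{sr}|^2$ has density $\alpha_{sr}\sum_{k=0}^{m_{sr}-1}\zeta(k)x^ke^{-\bar\beta_{sr}x}$ on $x\ge0$, where $\alpha_{sr}=\frac1{2\flat_{sr}}\bigl(\frac{2\flat_{sr}m_{sr}}{2\flat_{sr}m_{sr}+\Omega_{sr}}\bigr)^{m_{sr}}$, $\delta_{sr}=\frac{\Omega_{sr}}{2\flat_{sr}(2\flat_{sr}m_{sr}+\Omega_{sr})}$,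 $\bar\beta_{sr}=\frac1{2\flat_{sr}}-\delta_{sr}$, $\zeta(k)=(-1)^k(1-m_{sr})_k\delta_{sr}^k/(k!)^2$. The air-to-air link has Rician fading with factor $K\ge0$: $Z=|g_{rt}|^2$ has density $(1+K)e^{-K-(1+K)x}I_0\bigl(2\sqrt{K(1+K)x}\bigr)$ on $x\ge0$. The variables $X,Z,w_{sr},w_{rt}$ are independent. Let $\nu>0$ (path-loss exponent), $\chi,\mu\in(0,1)$, $\rho,\varepsilon\in[0,1)$ not both $0$, $\eta_s,\sigma_r^2,\sigma_{rb}^2,\sigma_t^2>0$, $P_{th}>0$, $\gamma_A>0$, and $$\chi_{\rho,\varepsilon}=\chi\Bigl(\frac{2\rho}{1-\rho}+\varepsilon\Bigr),\quad \mu_\varepsilon=\mu\Bigl(\sigma_r^2+\frac{\sigma_{rb}^2}{1-\varepsilon}\Bigr),\quad \mathcal D=\mu_\varepsilon\chi_{\rho,\varepsilon}\gamma_A,\quad \mathcal E=\chi_{\rho,\varepsilon}\eta_s(1-\mu),$$ $$\mathcal P_{\mathcal E,\mathcal D}=\frac{P_{th}\mathcal E}{\eta_s}-\mathcal D,\quad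 \theta=\frac{\eta_s(1+K)\sigma_t^2\gamma_A}{P_{th}}.$$ With perfect interference cancellation and a saturated energy harvester the SNR at $T$ is $$\Lambda_{T,2}=\frac{(1-\mu)\chi_{\rho,\varepsilon}P_{th}\,\eta_sXw_{sr}^{-2}\,Zw_{rt}^{-\nu}}{\mu_\varepsilon\chi_{\rho,\varepsilon}P_{th}Zw_{rt}^{-\nu}+\eta_sXw_{sr}^{-2}\sigma_t^2},$$ and the saturation-regime probability is $P_6(\gamma_A)=\Pr[\Lambda_{T,2}>\gamma_A,\ \eta_sXw_{sr}^{-2}>P_{th}]$. **Theorem.** $$P_6(\gamma_A)=\begin{cases}\overline\Psi_2(\gamma_A),&P_{th}\ge(\mathcal D/\mathcal E)\eta_s,\\ \overline\Psi_3(\gamma_A),&P_{th}<(\mathcal D/\mathcal E)\eta_s,\end{cases}$$ where at $P_{th}=(\mathcal D/\mathcal E)\eta_s$ (where single terms of $\overline\Psi_2$ are singular) $\overline\Psi_2$ denotes the limit of its values as $P_{th}$ decreases to $(\mathcal D/\mathcal E)\eta_s$; this limit exists, and $P_6=\overline\Psi_3$ there as well. Here, with $\Delta_\Gamma(a,b,c)=\Gamma(a,b)-\Gamma(a,c)$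 (upper incomplete Gamma functions), $\mathbb W$ the Whittaker function, $G$ the Meijer function and $B=\dfrac{6\,\alpha_{sr}}{\tan^2\!\phi\;w_{er}w_{\min}\,\nu\,(h_2^3-h_1^3)}$, $$\overline\Psi_2=B\sum_{k=0}^{m_{sr}-1}\zeta(k)\sum_{m=0}^\infty\sum_{n=0}^m\frac{K^me^{-K}}{m!\,n!}\sum_{k_1=0}^{n+k}\binom{n+k}{k_1}\sum_{k_2=0}^\infty\frac{(-1)^{k_2}}{k_2!}\Bigl(\frac\theta{\mathcal E}\Bigr)^{-\frac2\nu}\bar\beta_{sr}^{\frac{n-k_1+k_2}2-1}\mathcal P_{\mathcal E,\mathcal D}^{\frac{-n+k_1-k_2}2}\frac{\mathcal D^{k+n-k_1+k_2}}{\mathcal E^{k+\frac{n-k_1+k_2}2}}\,Q\,\mathbb I_1,$$ $$\mathbb I_1=\int_{w_{\min}}^{w_{\max}}w^{2k+n-k_1+k_2+1}\exp\Bigl(-\tfrac{\bar\beta_{sr}w^2}{\mathcal E}\bigl(\mathcal D+\tfrac{\mathcal P_{\mathcal E,\mathcal D}}2\bigr)\Bigr)\mathbb W_{\frac{-n+k_1-k_2}2,\frac{n-k_1+k_2-1}2}\Bigl(\tfrac{\bar\beta_{sr}w^2\mathcal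 P_{\mathcal E,\mathcal D}}{\mathcal E}\Bigr)dw,$$ and, with $a(h)=\theta h^\nu/\mathcal E$, $$\begin{aligned}Q={}&\Bigl(\frac\theta{\mathcal E}\Bigr)^{-\frac1\nu}\Delta_\Gamma\bigl(n+k_2+\tfrac3\nu,a(h_1),a(h_2)\bigr)-h_1\Delta_\Gamma\bigl(n+k_2+\tfrac2\nu,a(h_1),a(\tfrac{h_1}{\cos\phi})\bigr)\\&+h_2\Delta_\Gamma\bigl(n+k_2+\tfrac2\nu,a(h_2),a(\tfrac{h_2}{\cos\phi})\bigr)-\Bigl(\frac\theta{\mathcal E}\Bigr)^{-\frac1\nu}\cos\phi\,\Delta_\Gamma\bigl(n+k_2+\tfrac3\nu,a(\tfrac{h_1}{\cos\phi}),a(\tfrac{h_2}{\cos\phi})\bigr).\end{aligned}$$ Further, with $\varsigma_2=\frac{n+k_1+2k_2+1}2$ and $\varsigma_3=\frac{-n+k_1+1}2$, $$\overline\Psi_3=B\sum_{k=0}^{m_{sr}-1}\zeta(k)\sum_{m=0}^\infty\sum_{n=0}^m\frac{K^me^{-K}}{m!\,n!}\sum_{k_1=0}^{n+k}\binom{n+k}{k_1}\sum_{k_2=0}^\infty\frac{(-1)^{k_2}}{k_2!}\frac{\mathcal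 D^{\frac{2k+n-k_1+1}2}}{\bar\beta_{sr}^{\varsigma_3}\mathcal E^{k+n+k_2+1}}\,\theta^{n+k_2+\varsigma_3}\,[\mathbb I_2-\mathbb I_3-\mathbb I_4+\mathbb I_5],$$ where, with $H_s(h,w)=h^{\nu\varsigma_2+s}\,G^{2,1}_{1,3}\Bigl[\frac{\theta h^\nu\mathcal D\bar\beta_{sr}w^2}{\mathcal E^2}\Big|{1-\varsigma_2-\frac s\nu\atop\varsigma_3,-\varsigma_3,-\varsigma_2-\frac s\nu}\Bigr]$ and $M_s(a,b)=\int_{w_{\min}}^{w_{\max}}[H_s(b,w)-H_s(a,w)]\,w^{2k+n-k_1+2}e^{-\mathcal D\bar\beta_{sr}w^2/\mathcal E}dw$, $$\mathbb I_2=M_3(h_1,h_2),\quad\mathbb I_3=h_1M_2\bigl(h_1,\tfrac{h_1}{\cos\phi}\bigr),\quad\mathbb I_4=\cos\phi\,M_3\bigl(\tfrac{h_1}{\cos\phi},\tfrac{h_2}{\cos\phi}\bigr),\quad\mathbb I_5=h_2M_2\bigl(h_2,\tfrac{h_2}{\cos\phi}\bigr).$$ All the series converge: in each case the inner series over $k_2$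 and then the series over $m$ (in $\overline\Psi_2$ for $P_{th}>(\mathcal D/\mathcal E)\eta_s$, in $\overline\Psi_3$ for $P_{th}\le(\mathcal D/\mathcal E)\eta_s$). -/

import Mathlib

open MeasureTheory ProbabilityTheory Set Filter Topology

noncomputable section

namespace Osagin

/-! ### Special functions -/

/-- Modified Bessel function of the first kind of order zero. -/
def besselI0 (z : ℝ) : ℝ := ∑' j : ℕ, (1 / ((j.factorial : ℝ) ^ 2)) * (z / 2) ^ (2 * j)

/-- Upper incomplete Gamma function `Γ(a, x)`, for `x > 0`. -/
def upperGamma (a x : ℝ) : ℝ := ∫ t in Ioi x, t ^ (a - 1) * Real.exp (-t)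

/-- `Δ_Γ(a, b, c) = Γ(a, b) - Γ(a, c)`. -/
def deltaGamma (a b c : ℝ) : ℝ := upperGamma a b - upperGamma a c

/-- Confluent hypergeometric function of the second kind `U(a, b, z)`, for `a > 0` and `z > 0`. -/
def tricomiU (a b z : ℝ) : ℝ :=
  (Real.Gamma a)⁻¹ * ∫ t in Ioi (0 : ℝ), Real.exp (-z * t) * t ^ (a - 1) * (1 + t) ^ (b - a - 1)

/-- Whittaker function `W_{κ, μ}(z)` for real `κ, μ` and `z > 0`, through
`W_{κ, μ}(z) = e^{-z/2} z^{μ + 1/2} U(1/2 + μ - κ, 1 + 2μ, z)`. As `W_{κ, μ} = W_{κ, -μ}`, the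
sign of the second index is taken so that the integral for `U` is available: this is possible
whenever `1/2 + |μ| - κ > 0`. -/
def whittakerW (κ μ z : ℝ) : ℝ :=
  let μ' := if 0 < 1 / 2 - μ - κ then -μ else μ
  Real.exp (-z / 2) * z ^ (μ' + 1 / 2) * tricomiU (1 / 2 + μ' - κ) (1 + 2 * μ') z

/-- Abscissa half way between the poles of `∏ Γ(1 - a_j + s)` (to its left) and those of
`∏ Γ(b_j - s)` (to its right). -/
def meijerAbscissa (a₁ b₁ : List ℝ) : ℝ := (sSup {x | x ∈ a₁} - 1 + sInf {x | x ∈ b₁}) / 2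

/-- The integrand of the Mellin-Barnes integral of the Meijer G-function. -/
def meijerIntegrand (a₁ a₂ b₁ b₂ : List ℝ) (z : ℝ) (s : ℂ) : ℂ :=
  (b₁.map fun b => Complex.Gamma (b - s)).prod * (a₁.map fun a => Complex.Gamma (1 - a + s)).prod /
    ((b₂.map fun b => Complex.Gamma (1 - b + s)).prod *
      (a₂.map fun a => Complex.Gamma (a - s)).prod) * (z : ℂ) ^ s

/-- Meijer G-function `G^{m,n}_{p,q}[z | a₁, a₂; b₁, b₂]` where `a₁` lists the first `n` upper
parameters, `a₂` the other `p - n` ones, `b₁` the first `m` lower parameters and `b₂` the other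
`q - m` ones, all real, for `z > 0`: the Mellin-Barnes integral
`(1 / 2πi) ∫ ∏ Γ(b_j - s) ∏ Γ(1 - a_j + s) / (∏ Γ(1 - b_j + s) ∏ Γ(a_j - s)) z^s ds` along an
upward vertical line that separates the two families of poles. Such a line exists if `m, n ≥ 1` and
`max a₁ - 1 < min b₁`, and the integral converges absolutely if `2 (m + n) > p + q`. -/
def meijerG (a₁ a₂ b₁ b₂ : List ℝ) (z : ℝ) : ℂ :=
  (1 / (2 * Real.pi) : ℂ) * ∫ t : ℝ,
    meijerIntegrand a₁ a₂ b₁ b₂ z ((meijerAbscissa a₁ b₁ : ℂ) + t * Complex.I)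

/-- `G^{2,1}_{1,3}[z | a; b₁, b₂, b₃]`, which is real for real parameters and `z > 0`. -/
def meijerG2113 (a b₁ b₂ b₃ z : ℝ) : ℝ := (meijerG [a] [] [b₁, b₂] [b₃] z).re

/-! ### The network -/

/-- Parameters of the network. -/
structure Params where
  /-- fading severity of the satellite link -/
  msr : ℕ
  /-- half of the average power of the multipath component of the satellite link -/
  flat : ℝ
  /-- average power of the line-of-sight component of the satellite link -/
  Ωsr : ℝ
  /-- Rician factor of the air-to-air link -/
  K : ℝ
  /-- path loss exponent of the air-to-air link -/
  ν : ℝ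
  /-- radius of the Earth -/
  we : ℝ
  /-- altitude of the aerial transmitter -/
  wr : ℝ
  /-- minimal distance from the satellite to the aerial transmitter -/
  wmin : ℝ
  /-- vertical distance from the aerial transmitter to the upper end of the receiver region -/
  h₁ : ℝ
  /-- vertical distance from the aerial transmitter to the lower end of the receiver region -/
  h₂ : ℝ
  /-- half-beamwidth angle -/
  φ : ℝ
  /-- energy conversion efficiency -/
  χ : ℝ
  /-- time splitting factor -/
  ρ : ℝ
  /-- power splitting factor -/
  ε : ℝ
  /-- spectrum sharing factor -/
  μ : ℝ
  /-- effective transmit power of the satellite -/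
  ηs : ℝ
  /-- variance of the receiver noise at the aerial transmitter -/
  σr2 : ℝ
  /-- variance of the RF-to-baseband conversion noise at the aerial transmitter -/
  σrb2 : ℝ
  /-- variance of the noise at the aerial receiver -/
  σt2 : ℝ
  msr_pos : 1 ≤ msr
  flat_pos : 0 < flat
  Ωsr_nonneg : 0 ≤ Ωsr
  K_nonneg : 0 ≤ K
  ν_pos : 0 < ν
  we_pos : 0 < we
  wr_pos : 0 < wr
  wmin_pos : 0 < wmin
  h₁_pos : 0 < h₁
  h₁_lt_h₂ : h₁ < h₂
  φ_pos : 0 < φ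
  φ_lt : φ < Real.pi / 2
  χ_pos : 0 < χ
  χ_lt : χ < 1
  ρ_nonneg : 0 ≤ ρ
  ρ_lt : ρ < 1
  ε_nonneg : 0 ≤ ε
  ε_lt : ε < 1
  harvests : 0 < ρ ∨ 0 < ε
  μ_pos : 0 < μ
  μ_lt : μ < 1
  ηs_pos : 0 < ηs
  σr2_pos : 0 < σr2
  σrb2_pos : 0 < σrb2
  σt2_pos : 0 < σt2

namespace Params

variable (p : Params)

/-- `w_er = w_e + w_r` -/
def wer : ℝ := p.we + p.wr

/-- `w_max = √(w_min² + 2 w_er w_min)` -/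
def wmax : ℝ := Real.sqrt (p.wmin ^ 2 + 2 * p.wer * p.wmin)

/-- `α_sr` -/
def α : ℝ :=
  (2 * p.flat * p.msr / (2 * p.flat * p.msr + p.Ωsr)) ^ p.msr / (2 * p.flat)

/-- `β_sr` -/
def β : ℝ := 1 / (2 * p.flat)

/-- `δ_sr` -/
def δ : ℝ := p.Ωsr / ((2 * p.flat) * (2 * p.flat * p.msr + p.Ωsr))

/-- `β̄_sr = β_sr - δ_sr` -/
def βbar : ℝ := p.β - p.δ

/-- `ζ(k) = (-1)^k (1 - m_sr)_k δ_sr^k / (k!)²` -/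
def ζ (k : ℕ) : ℝ :=
  (-1) ^ k * (ascPochhammer ℝ k).eval (1 - (p.msr : ℝ)) * p.δ ^ k / (k.factorial : ℝ) ^ 2

/-- Density of the power gain of the satellite link under shadowed-Rician fading. -/
def srPdf (x : ℝ) : ℝ :=
  if 0 ≤ x then
    p.α * ∑ k ∈ Finset.range p.msr, p.ζ k * x ^ k * Real.exp (-(p.β - p.δ) * x)
  else 0

/-- Density of the power gain of the air-to-air link under Rician fading. -/
def ricianPdf (x : ℝ) : ℝ :=
  if 0 ≤ x then
    (1 + p.K) * Real.exp (-p.K - (1 + p.K) * x) * besselI0 (2 * Real.sqrt (p.K * (1 + p.K) * x))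
  else 0

/-- `χ_{ρ,ε} = χ (2ρ / (1 - ρ) + ε)` -/
def χρε : ℝ := p.χ * (2 * p.ρ / (1 - p.ρ) + p.ε)

/-- `μ_ε = μ (σ_r² + σ_rb² / (1 - ε))` -/
def με : ℝ := p.μ * (p.σr2 + p.σrb2 / (1 - p.ε))

/-- `𝒟 = μ_ε χ_{ρ,ε} γ_A` -/
def D (γA : ℝ) : ℝ := p.με * p.χρε * γA

/-- `ℰ = χ_{ρ,ε} η_s (1 - μ)` -/
def E : ℝ := p.χρε * p.ηs * (1 - p.μ)

/-- `𝒫_{ℰ,𝒟} = P_th ℰ / η_s - 𝒟` -/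
def PED (Pth γA : ℝ) : ℝ := Pth * p.E / p.ηs - p.D γA

/-- `Θ(γ_A) = (1 + K_rt) σ_t² γ_A` -/
def Θ (γA : ℝ) : ℝ := (1 + p.K) * p.σt2 * γA

/-- `η_s Θ(γ_A) / P_th` -/
def θ (Pth γA : ℝ) : ℝ := p.ηs * p.Θ γA / Pth

/-- Position of the aerial transmitter, the centre of the Earth being the origin and the last
coordinate axis being the vertical through the transmitter. -/
def posR : EuclideanSpace ℝ (Fin 3) := EuclideanSpace.single 2 p.wer

/-- Directions, seen from the centre of the Earth, of the satellite positions that lie above the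
horizontal plane through the aerial transmitter. -/
def capDirections : Set (Metric.sphere (0 : EuclideanSpace ℝ (Fin 3)) 1) :=
  {d | p.wer ≤ (p.wer + p.wmin) * (d : EuclideanSpace ℝ (Fin 3)) 2}

/-- Uniform distribution on the part above the horizontal plane through the aerial transmitter of
the orbital sphere of radius `w_er + w_min` around the centre of the Earth. -/
def satelliteLaw : Measure (EuclideanSpace ℝ (Fin 3)) :=
  (cond (volume : Measure (EuclideanSpace ℝ (Fin 3))).toSphere p.capDirections).map
    fun d : Metric.sphere (0 : EuclideanSpace ℝ (Fin 3)) 1 =>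
      (p.wer + p.wmin) • (d : EuclideanSpace ℝ (Fin 3))

/-- The truncated cone with apex at the aerial transmitter, vertical axis and half-angle `φ`, between
the horizontal planes at distances `h₁` and `h₂` below the transmitter. -/
def receiverRegion : Set (EuclideanSpace ℝ (Fin 3)) :=
  {x | p.h₁ ≤ (p.posR - x) 2 ∧ (p.posR - x) 2 ≤ p.h₂ ∧
    ‖p.posR - x‖ * Real.cos p.φ ≤ (p.posR - x) 2}

/-- SNR at the aerial receiver under perfect interference cancellation when the energy harvester is
saturated, in terms of `x = |g_sr|²`, `w = w_sr`, `z = |g_rt|²`, `u = w_rt`. -/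
def snrPICSat (Pth x w z u : ℝ) : ℝ :=
  (1 - p.μ) * p.χρε * Pth * p.ηs * x * w ^ (-2 : ℝ) * z * u ^ (-p.ν) /
    (p.με * p.χρε * Pth * z * u ^ (-p.ν) + p.ηs * x * w ^ (-2 : ℝ) * p.σt2)

end Params

/-- The random network: channel coefficients `gsr`, `grt` of the links from the satellite to the
aerial transmitter and from there to the aerial receiver, and positions `S`, `T` of the satellite
and the aerial receiver. -/
structure IsNetwork (p : Params) {Ω : Type*} [MeasurableSpace Ω] (Pr : Measure Ω)
    (gsr grt : Ω → ℂ) (S T : Ω → EuclideanSpace ℝ (Fin 3)) : Prop where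
  measurable_gsr : Measurable gsr
  measurable_grt : Measurable grt
  measurable_S : Measurable S
  measurable_T : Measurable T
  law_gsr : Pr.map (fun ω => ‖gsr ω‖ ^ 2) = volume.withDensity fun x => ENNReal.ofReal (p.srPdf x)
  law_grt : Pr.map (fun ω => ‖grt ω‖ ^ 2) =
    volume.withDensity fun x => ENNReal.ofReal (p.ricianPdf x)
  law_S : Pr.map S = p.satelliteLaw
  law_T : Pr.map T = cond volume p.receiverRegion
  indep : iIndepFun
    ![fun ω => ‖gsr ω‖ ^ 2, fun ω => ‖grt ω‖ ^ 2, fun ω => dist (S ω) p.posR,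
      fun ω => dist (T ω) p.posR] Pr

/-- `𝒫₆(γ_A) = Pr[Λ^{p-IC}_{T,2} > γ_A, η_s |g_sr|² w_sr⁻² > P_th]`. -/
def P6 (p : Params) {Ω : Type*} [MeasurableSpace Ω] (Pr : Measure Ω) (gsr grt : Ω → ℂ)
    (S T : Ω → EuclideanSpace ℝ (Fin 3)) (Pth γA : ℝ) : ℝ :=
  Pr.real {ω |
    γA < p.snrPICSat Pth (‖gsr ω‖ ^ 2) (dist (S ω) p.posR) (‖grt ω‖ ^ 2) (dist (T ω) p.posR) ∧
    Pth < p.ηs * ‖gsr ω‖ ^ 2 * (dist (S ω) p.posR) ^ (-2 : ℝ)}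

/-! ### The expressions `Ψ̄₂` and `Ψ̄₃` -/

namespace Params

variable (p : Params) (Pth γA : ℝ)

/-- Common prefactor
`6 α_sr / (tan² φ · w_er w_min ν_rt (h₂³ - h₁³))`. -/
def pref : ℝ :=
  6 * p.α / (Real.tan p.φ ^ 2 * p.wer * p.wmin * p.ν * (p.h₂ ^ 3 - p.h₁ ^ 3))

/-- The integral over `w` in `Ψ̄₂`. -/
def I₁ (k n k₁ k₂ : ℕ) : ℝ :=
  ∫ w in p.wmin..p.wmax,
    w ^ (2 * (k : ℝ) + n - k₁ + k₂ + 1) *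
      Real.exp (-(p.βbar * w ^ 2 / p.E) * (p.D γA + p.PED Pth γA / 2)) *
      whittakerW ((-(n : ℝ) + k₁ - k₂) / 2) (((n : ℝ) - k₁ + k₂ - 1) / 2)
        (p.βbar * w ^ 2 * p.PED Pth γA / p.E)

/-- The combination of incomplete Gamma functions in `Ψ̄₂`, with `r = n + k₂`. -/
def gammaBracket (r : ℝ) : ℝ :=
  let a : ℝ → ℝ := fun h => p.θ Pth γA * h ^ p.ν / p.E
  let c := Real.cos p.φ
  (p.θ Pth γA / p.E) ^ (-1 / p.ν) * deltaGamma (r + 3 / p.ν) (a p.h₁) (a p.h₂)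
    - p.h₁ * deltaGamma (r + 2 / p.ν) (a p.h₁) (a (p.h₁ / c))
    + p.h₂ * deltaGamma (r + 2 / p.ν) (a p.h₂) (a (p.h₂ / c))
    - (p.θ Pth γA / p.E) ^ (-1 / p.ν) * c *
        deltaGamma (r + 3 / p.ν) (a (p.h₁ / c)) (a (p.h₂ / c))

/-- General term of the series over `k₂` in `Ψ̄₂`. -/
def psi2Term (k n k₁ k₂ : ℕ) : ℝ :=
  (-1) ^ k₂ / (k₂.factorial : ℝ) * (p.θ Pth γA / p.E) ^ (-2 / p.ν) *
    p.βbar ^ (((n : ℝ) - k₁ + k₂) / 2 - 1) *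
    p.PED Pth γA ^ ((-(n : ℝ) + k₁ - k₂) / 2) *
    (p.D γA ^ ((k : ℝ) + n - k₁ + k₂) / p.E ^ ((k : ℝ) + ((n : ℝ) - k₁ + k₂) / 2)) *
    p.gammaBracket Pth γA ((n : ℝ) + k₂) * p.I₁ Pth γA k n k₁ k₂

/-- General term of the series over `m` in `Ψ̄₂`. -/
def psi2Outer (k m : ℕ) : ℝ :=
  ∑ n ∈ Finset.range (m + 1),
    p.K ^ m * Real.exp (-p.K) / ((m.factorial : ℝ) * (n.factorial : ℝ)) *
      ∑ k₁ ∈ Finset.range (n + k + 1), ((n + k).choose k₁ : ℝ) *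
        ∑' k₂ : ℕ, p.psi2Term Pth γA k n k₁ k₂

/-- `Ψ̄₂(γ_A)` -/
def psi2 : ℝ :=
  p.pref * ∑ k ∈ Finset.range p.msr, p.ζ k * ∑' m : ℕ, p.psi2Outer Pth γA k m

/-- `ς₂ = (n + k₁ + 2 k₂ + 1) / 2` -/
def ς₂ (n k₁ k₂ : ℕ) : ℝ := ((n : ℝ) + k₁ + 2 * k₂ + 1) / 2

/-- `ς₃ = (-n + k₁ + 1) / 2` -/
def ς₃ (n k₁ : ℕ) : ℝ := (-(n : ℝ) + k₁ + 1) / 2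

/-- `h^{ν ς₂ + s} G^{2,1}_{1,3}[(η_s Θ / P_th) h^ν 𝒟 β̄ w² / ℰ² | 1 - ς₂ - s/ν; ς₃, -ς₃, -ς₂ - s/ν]` -/
def meijerPart (n k₁ k₂ : ℕ) (s h w : ℝ) : ℝ :=
  h ^ (p.ν * ς₂ n k₁ k₂ + s) *
    meijerG2113 (1 - ς₂ n k₁ k₂ - s / p.ν) (ς₃ n k₁) (-ς₃ n k₁) (-ς₂ n k₁ k₂ - s / p.ν)
      (p.θ Pth γA * h ^ p.ν * p.D γA * p.βbar * w ^ 2 / p.E ^ 2)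

/-- `∫ [H(b, w) - H(a, w)] w^{2k+n-k₁+2} exp(-𝒟 β̄ w² / ℰ) dw` with `H = meijerPart`. -/
def meijerIntegral (k n k₁ k₂ : ℕ) (s a b : ℝ) : ℝ :=
  ∫ w in p.wmin..p.wmax,
    (p.meijerPart Pth γA n k₁ k₂ s b w - p.meijerPart Pth γA n k₁ k₂ s a w) *
      w ^ (2 * (k : ℝ) + n - k₁ + 2) * Real.exp (-(p.D γA * p.βbar * w ^ 2 / p.E))

/-- `Ī₂`, over the part of the distance density with factor `u²` on `[h₁, h₂]`. -/
def I₂ (k n k₁ k₂ : ℕ) : ℝ := p.meijerIntegral Pth γA k n k₁ k₂ 3 p.h₁ p.h₂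

/-- `Ī₃`, for the factor `h₁ u` on `[h₁, h₁ / cos φ]`. -/
def I₃ (k n k₁ k₂ : ℕ) : ℝ :=
  p.h₁ * p.meijerIntegral Pth γA k n k₁ k₂ 2 p.h₁ (p.h₁ / Real.cos p.φ)

/-- `Ī₄`, for the factor `u² cos φ` on `[h₁ / cos φ, h₂ / cos φ]`. -/
def I₄ (k n k₁ k₂ : ℕ) : ℝ :=
  Real.cos p.φ *
    p.meijerIntegral Pth γA k n k₁ k₂ 3 (p.h₁ / Real.cos p.φ) (p.h₂ / Real.cos p.φ)

/-- `Ī₅`, for the factor `h₂ u` on `[h₂, h₂ / cos φ]`. -/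
def I₅ (k n k₁ k₂ : ℕ) : ℝ :=
  p.h₂ * p.meijerIntegral Pth γA k n k₁ k₂ 2 p.h₂ (p.h₂ / Real.cos p.φ)

/-- General term of the series over `k₂` in `Ψ̄₃`. -/
def psi3Term (k n k₁ k₂ : ℕ) : ℝ :=
  (-1) ^ k₂ / (k₂.factorial : ℝ) *
    (p.D γA ^ ((2 * (k : ℝ) + n - k₁ + 1) / 2) /
      (p.βbar ^ ς₃ n k₁ * p.E ^ ((k : ℝ) + n + k₂ + 1))) *
    p.θ Pth γA ^ ((n : ℝ) + k₂ + ς₃ n k₁) *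
    (p.I₂ Pth γA k n k₁ k₂ - p.I₃ Pth γA k n k₁ k₂ - p.I₄ Pth γA k n k₁ k₂
      + p.I₅ Pth γA k n k₁ k₂)

/-- General term of the series over `m` in `Ψ̄₃`. -/
def psi3Outer (k m : ℕ) : ℝ :=
  ∑ n ∈ Finset.range (m + 1),
    p.K ^ m * Real.exp (-p.K) / ((m.factorial : ℝ) * (n.factorial : ℝ)) *
      ∑ k₁ ∈ Finset.range (n + k + 1), ((n + k).choose k₁ : ℝ) *
        ∑' k₂ : ℕ, p.psi3Term Pth γA k n k₁ k₂

/-- `Ψ̄₃(γ_A)` -/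
def psi3 : ℝ :=
  p.pref * ∑ k ∈ Finset.range p.msr, p.ζ k * ∑' m : ℕ, p.psi3Outer Pth γA k m

/-- All series in `Ψ̄₂(γ_A)` converge. -/
def Psi2Converges : Prop :=
  ∀ k < p.msr,
    (∀ n k₁ : ℕ, k₁ ≤ n + k → Summable fun k₂ => p.psi2Term Pth γA k n k₁ k₂) ∧
      Summable fun m => p.psi2Outer Pth γA k m

/-- All series in `Ψ̄₃(γ_A)` converge. -/
def Psi3Converges : Prop :=
  ∀ k < p.msr,
    (∀ n k₁ : ℕ, k₁ ≤ n + k → Summable fun k₂ => p.psi3Term Pth γA k n k₁ k₂) ∧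
      Summable fun m => p.psi3Outer Pth γA k m

end Params

end Osagin

end

noncomputable section

namespace Osagin

/-! Both expressions are expansions of one and the same triple integral.

Let w and u be the distances of S and T from R. By Archimedes' hat-box theorem the height of a
uniform direction is uniform, and w² is affine in that height, so w has density w / (w_er w_min) on
[w_min, w_max] (`map_dist_satelliteLaw`). Slicing the truncated cone by spheres about its apex gives
u a density proportional to u (min(u, h₂) - max(h₁, u cos φ)) (`map_dist_receiver`). Expanding I₀
shows that (1 + K) Z is a Poisson(K) mixture of Erlang variables, so its tail is a mixture of
Poisson distribution functions (`lintegral_ricianPdf`).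

The substitution X = w² (t + 𝒟) / ℰ makes the event explicit: it says that t > max(𝒫, 0), with 𝒫 =
`PED`, and (1 + K) Z > A, where A = r (1 + 𝒟 / t) and r = θ u^ν / ℰ (`lt_snrPICSat_iff`). Hence P₆
is an integral over w, u and t > max(𝒫, 0) (`P6_eq_integral`).

In this integral m indexes the Poisson mixture, n the sum in the Poisson distribution function and
k₁ the binomial expansion of (t + 𝒟)^(n+k). What remains is e^(-A) = e^(-r) e^(-r𝒟/t), and the
series over k₂ expands one of the two factors, namely one with bounded exponent. If 𝒫 > 0, then t
stays away from 0 and e^(-r𝒟/t) is expanded. The variables u and t separate: the u-integral consists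
of incomplete Gamma functions, the t-integral is a Whittaker function (`psi2Term_eq`). If 𝒫 ≤ 0,
then t comes down to 0, and e^(-r𝒟/t) has to be kept, as it compensates t^(-n). The factor e^(-r) is
expanded instead. The t-integral is a Bessel function K, and its weighted integral over u is a
difference of Meijer functions, by Mellin inversion (`meijerG2113_eq_integratedKernel`,
`psi3Term_eq`).

A bound C for the expanded exponent justifies the interchange in k₂, with majorant C^j / j!
(`hasSum_integral_mul_exp_neg`). For the series over m the finite sums are first put together again;
its terms are then dominated by Poisson weights. At 𝒫 = 0 the integral is continuous from the right
in P_th by dominated convergence, so the values of Ψ̄₂ converge although its single terms are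
singular. -/

/-! ### Integration on ℝ³ by norm and height; the hat-box theorem -/

/-- Polar coordinates in the plane at height z, where the angle contributes 2π, and then r = √(ρ² +
z²): since ρ dρ = r dr, the weight stays linear. -/
theorem lintegral_polar_norm (z : ℝ) {f : ℝ → ENNReal} (hf : Measurable f) :
    ∫⁻ v : ℝ × ℝ, f (Real.sqrt (v.1 ^ 2 + v.2 ^ 2 + z ^ 2)) =
      ENNReal.ofReal (2 * Real.pi) * ∫⁻ r in Ioi |z|, ENNReal.ofReal r * f r := by
  rw [← lintegral_comp_polarCoord_symm]
  have h1 : ∀ q ∈ polarCoord.target, ENNReal.ofReal q.1 •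
      f (Real.sqrt ((polarCoord.symm q).1 ^ 2 + (polarCoord.symm q).2 ^ 2 + z ^ 2)) =
      ENNReal.ofReal q.1 * f (Real.sqrt (q.1 ^ 2 + z ^ 2)) := by
    intro q hq
    simp only [polarCoord_symm_apply, smul_eq_mul]
    congr 3
    have := Real.sin_sq_add_cos_sq q.2
    linear_combination q.1 ^ 2 * this
  rw [setLIntegral_congr_fun polarCoord.open_target.measurableSet h1, polarCoord_target,
    Measure.volume_eq_prod, ← Measure.prod_restrict, lintegral_prod _ (by fun_prop)]
  simp only [lintegral_const, Measure.restrict_apply MeasurableSet.univ, univ_inter,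
    Real.volume_Ioo]
  rw [lintegral_mul_const _ (by fun_prop), mul_comm]
  congr 1
  · congr 1; ring
  · have himg : (fun ρ : ℝ => Real.sqrt (ρ ^ 2 + z ^ 2)) '' Ioi 0 = Ioi |z| := by
      ext r
      simp only [mem_image, mem_Ioi]
      constructor
      · rintro ⟨ρ, hρ, rfl⟩
        apply Real.lt_sqrt_of_sq_lt
        rw [sq_abs]; nlinarith [pow_pos hρ 2]
      · intro hr
        have hr0 : 0 < r := (abs_nonneg z).trans_lt hr
        have : z ^ 2 < r ^ 2 := sq_lt_sq.2 (by rwa [abs_of_pos hr0])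
        refine ⟨Real.sqrt (r ^ 2 - z ^ 2), Real.sqrt_pos.2 (by linarith), ?_⟩
        rw [Real.sq_sqrt (by linarith), sub_add_cancel, Real.sqrt_sq hr0.le]
    have hder : ∀ ρ ∈ Ioi (0 : ℝ), HasDerivWithinAt (fun ρ : ℝ => Real.sqrt (ρ ^ 2 + z ^ 2))
        (ρ / Real.sqrt (ρ ^ 2 + z ^ 2)) (Ioi 0) ρ := by
      intro ρ hρ
      have hpos : 0 < ρ ^ 2 + z ^ 2 := by have := pow_pos (mem_Ioi.1 hρ) 2; positivity
      have h := (((hasDerivAt_pow 2 ρ).add_const (z ^ 2)).sqrt hpos.ne').hasDerivWithinAt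
        (s := Ioi 0)
      refine h.congr_deriv ?_
      have h2 : ((2 : ℕ) : ℝ) * ρ ^ (2 - 1) = 2 * ρ := by norm_num
      rw [h2, mul_div_mul_left _ _ two_ne_zero]
    have hinj : InjOn (fun ρ : ℝ => Real.sqrt (ρ ^ 2 + z ^ 2)) (Ioi 0) := by
      intro a ha b hb hab
      have := (Real.sqrt_inj (by positivity) (by positivity)).1 hab
      exact (pow_left_inj₀ (le_of_lt ha) (le_of_lt hb) two_ne_zero).1 (by linarith)
    rw [← himg, lintegral_image_eq_lintegral_abs_deriv_mul measurableSet_Ioi hder hinj]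
    refine setLIntegral_congr_fun measurableSet_Ioi fun ρ hρ => ?_
    have hpos : 0 < ρ ^ 2 + z ^ 2 := by have := pow_pos (mem_Ioi.1 hρ) 2; positivity
    have hs := Real.sqrt_pos.2 hpos
    rw [← mul_assoc, ← ENNReal.ofReal_mul (abs_nonneg _),
      abs_of_pos (div_pos hρ hs), div_mul_cancel₀ _ hs.ne']

/-- Integration of a function of the norm and of the last coordinate on `ℝ³`. -/
theorem lintegral_norm_coord {f : ℝ × ℝ → ENNReal} (hf : Measurable f) :
    ∫⁻ x : EuclideanSpace ℝ (Fin 3), f (‖x‖, x 2) =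
      ENNReal.ofReal (2 * Real.pi) *
        ∫⁻ r in Ioi (0 : ℝ), ENNReal.ofReal r * ∫⁻ z in Ioo (-r) r, f (r, z) := by
  have e1 := (EuclideanSpace.volume_preserving_symm_measurableEquiv_toLp (Fin 3)).symm
  have e2 := (volume_preserving_piFinSuccAbove (fun _ : Fin 3 => ℝ) 2).symm
  have e3 := (MeasurePreserving.id (volume : Measure ℝ)).prod
    (volume_preserving_finTwoArrow ℝ).symm
  have e := (e1.comp e2).comp e3
  have hmeas : Measurable fun x : EuclideanSpace ℝ (Fin 3) => f (‖x‖, x 2) := by fun_prop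
  rw [← e.lintegral_comp hmeas, MeasureTheory.lintegral_prod
    (fun a => f (‖_‖, _)) (hmeas.comp e.measurable).aemeasurable]
  have key : ∀ (z : ℝ) (v : ℝ × ℝ),
      f (‖((MeasurableEquiv.toLp 2 (Fin 3 → ℝ)).symm.symm ∘
            (MeasurableEquiv.piFinSuccAbove (fun _ : Fin 3 => ℝ) 2).symm) (Prod.map id
            MeasurableEquiv.finTwoArrow.symm (z, v))‖,
          ((MeasurableEquiv.toLp 2 (Fin 3 → ℝ)).symm.symm ∘
            (MeasurableEquiv.piFinSuccAbove (fun _ : Fin 3 => ℝ) 2).symm) (Prod.map id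
            MeasurableEquiv.finTwoArrow.symm (z, v)) 2) =
        f (Real.sqrt (v.1 ^ 2 + v.2 ^ 2 + z ^ 2), z) := by
    intro z v
    have h2 : ((MeasurableEquiv.toLp 2 (Fin 3 → ℝ)).symm.symm ∘
            (MeasurableEquiv.piFinSuccAbove (fun _ : Fin 3 => ℝ) 2).symm) (Prod.map id
            MeasurableEquiv.finTwoArrow.symm (z, v)) = !₂[v.1, v.2, z] := by
      ext i
      fin_cases i <;> rfl
    rw [h2, EuclideanSpace.norm_eq]
    simp [Fin.sum_univ_three]
  have : ∀ z : ℝ, ∫⁻ v : ℝ × ℝ, f (Real.sqrt (v.1 ^ 2 + v.2 ^ 2 + z ^ 2), z) =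
      ENNReal.ofReal (2 * Real.pi) * ∫⁻ r in Ioi |z|, ENNReal.ofReal r * f (r, z) := fun z =>
    lintegral_polar_norm z (f := fun r => f (r, z)) (by fun_prop)
  calc _ = ∫⁻ z : ℝ, ∫⁻ v : ℝ × ℝ, f (Real.sqrt (v.1 ^ 2 + v.2 ^ 2 + z ^ 2), z) := by
        refine lintegral_congr fun z => lintegral_congr fun v => ?_
        exact key z v
    -- The constraint |z| < r is moved into an indicator on the plane so that Tonelli applies; for
    -- fixed r it reads z ∈ (-r, r).
    _ = ∫⁻ z : ℝ, ENNReal.ofReal (2 * Real.pi) *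
          ∫⁻ r : ℝ, {q : ℝ × ℝ | |q.1| < q.2}.indicator
            (fun q => ENNReal.ofReal q.2 * f (q.2, q.1)) (z, r) := by
        refine lintegral_congr fun z => ?_
        rw [this, ← lintegral_indicator measurableSet_Ioi]
        rfl
    _ = ENNReal.ofReal (2 * Real.pi) * ∫⁻ r : ℝ, ∫⁻ z : ℝ,
          {q : ℝ × ℝ | |q.1| < q.2}.indicator
            (fun q => ENNReal.ofReal q.2 * f (q.2, q.1)) (z, r) := by
        have hm : Measurable ({q : ℝ × ℝ | |q.1| < q.2}.indicator
            (fun q => ENNReal.ofReal q.2 * f (q.2, q.1))) :=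
          Measurable.indicator (by fun_prop)
            (measurableSet_lt (by fun_prop) (by fun_prop))
        rw [lintegral_const_mul _ (Measurable.lintegral_prod_right' hm),
          lintegral_lintegral_swap (f := fun z r =>
          {q : ℝ × ℝ | |q.1| < q.2}.indicator
            (fun q => ENNReal.ofReal q.2 * f (q.2, q.1)) (z, r)) hm.aemeasurable]
    _ = _ := by
        congr 1
        rw [← lintegral_indicator measurableSet_Ioi]
        refine lintegral_congr fun r => ?_
        by_cases hr : 0 < r
        · rw [indicator_of_mem (mem_Ioi.2 hr), ← lintegral_const_mul _ (by fun_prop),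
            ← lintegral_indicator measurableSet_Ioo]
          refine lintegral_congr fun z => ?_
          simp only [indicator, mem_ofPred_eq, mem_Ioo, abs_lt]
        · rw [indicator_of_notMem (by simpa using hr)]
          simp only [indicator, mem_ofPred_eq]
          have : ∀ z, ¬ |z| < r := fun z hz => hr ((abs_nonneg z).trans_lt hz)
          simp [this]

theorem indicator_one_congr {α β : Type*} {s : Set α} {t : Set β} {a : α} {b : β}
    (h : a ∈ s ↔ b ∈ t) : s.indicator (1 : α → ENNReal) a = t.indicator (1 : β → ENNReal) b := by
  by_cases ha : a ∈ s
  · rw [indicator_of_mem ha, indicator_of_mem (h.1 ha), Pi.one_apply, Pi.one_apply]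
  · rw [indicator_of_notMem ha, indicator_of_notMem fun hb => ha (h.2 hb)]

/-- At norm r the admissible heights form the set A ∩ (-1, 1) scaled by r. Together with the weight
r this gives r², and ∫₀¹ r² dr = 1/3. The measure `toSphere` of a set is defined by the volume of
the cone over it, which is a set of this form when the set is given by heights. -/
theorem volume_cone_shell {A : Set ℝ} (hA : MeasurableSet A) :
    volume {x : EuclideanSpace ℝ (Fin 3) | 0 < ‖x‖ ∧ ‖x‖ < 1 ∧ x 2 / ‖x‖ ∈ A} =
      ENNReal.ofReal (2 * Real.pi / 3) * volume (A ∩ Ioo (-1) 1) := by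
  set V : Set (ℝ × ℝ) := {q | 0 < q.1 ∧ q.1 < 1 ∧ q.2 / q.1 ∈ A} with hV
  have hVm : MeasurableSet V :=
    (measurableSet_lt measurable_const measurable_fst).inter
      ((measurableSet_lt measurable_fst measurable_const).inter
        ((measurable_snd.div measurable_fst) hA))
  have hf : Measurable (V.indicator (1 : ℝ × ℝ → ENNReal)) := measurable_one.indicator hVm
  have h := lintegral_norm_coord hf
  have hpre : MeasurableSet {x : EuclideanSpace ℝ (Fin 3) | 0 < ‖x‖ ∧ ‖x‖ < 1 ∧ x 2 / ‖x‖ ∈ A} := by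
    have : Measurable fun x : EuclideanSpace ℝ (Fin 3) => (‖x‖, x 2) := by fun_prop
    exact this hVm
  rw [← lintegral_indicator_one hpre]
  refine (Eq.trans ?_ h).trans ?_
  · rfl
  have hin : ∀ r ∈ Ioi (0 : ℝ), ENNReal.ofReal r *
      ∫⁻ z in Ioo (-r) r, V.indicator (1 : ℝ × ℝ → ENNReal) (r, z) =
      (Ioo (0 : ℝ) 1).indicator (fun r => ENNReal.ofReal (r ^ 2) * volume (A ∩ Ioo (-1) 1)) r := by
    intro r hr
    have hr : 0 < r := hr
    by_cases h1 : r < 1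
    · rw [indicator_of_mem (mem_Ioo.2 ⟨hr, h1⟩)]
      have hset : (fun z => V.indicator (1 : ℝ × ℝ → ENNReal) (r, z)) =
          ((fun z => r⁻¹ * z) ⁻¹' A).indicator 1 := by
        ext z
        have : (r, z) ∈ V ↔ z ∈ (fun z => r⁻¹ * z) ⁻¹' A := by
          simp only [hV, mem_ofPred_eq, hr, h1, true_and, div_eq_inv_mul, mem_preimage]
        exact indicator_one_congr this
      have hm : MeasurableSet ((fun z => r⁻¹ * z) ⁻¹' A) := (measurable_const_mul _) hA
      rw [hset, lintegral_indicator_one hm, Measure.restrict_apply hm]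
      have hI : (fun z => r⁻¹ * z) ⁻¹' A ∩ Ioo (-r) r =
          (fun z => r⁻¹ * z) ⁻¹' (A ∩ Ioo (-1) 1) := by
        ext z
        simp only [mem_inter_iff, mem_preimage, mem_Ioo, and_congr_right_iff]
        intro _
        rw [← div_eq_inv_mul, lt_div_iff₀ hr, div_lt_one hr]
        simp
      rw [hI, Real.volume_preimage_mul_left (inv_ne_zero hr.ne'), inv_inv, abs_of_pos hr,
        ← mul_assoc, ← ENNReal.ofReal_mul hr.le, sq]
    · rw [indicator_of_notMem (fun h => h1 h.2)]
      simp [indicator, hV, h1]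
  rw [setLIntegral_congr_fun measurableSet_Ioi hin, lintegral_indicator measurableSet_Ioo,
    Measure.restrict_restrict measurableSet_Ioo, lintegral_mul_const _ (by fun_prop)]
  have : Ioo (0 : ℝ) 1 ∩ Ioi 0 = Ioo 0 1 := inter_eq_left.2 fun x hx => hx.1
  have hint : ∫⁻ r in Ioo (0 : ℝ) 1, ENNReal.ofReal (r ^ 2) = ENNReal.ofReal (1 / 3) := by
    rw [← ofReal_integral_eq_lintegral_ofReal]
    · rw [← integral_Ioc_eq_integral_Ioo, ← intervalIntegral.integral_of_le zero_le_one,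
        integral_pow]
      norm_num
    · exact ((continuous_pow 2).integrableOn_Icc (μ := volume) (a := (0 : ℝ)) (b := 1)).mono_set
        Ioo_subset_Icc_self
    · exact ae_of_all _ fun x => by positivity
  rw [this, hint, ← mul_assoc, ← ENNReal.ofReal_mul (by positivity)]
  congr 2
  ring

open scoped Pointwise in
/-- Archimedes' hat-box theorem. -/
theorem toSphere_map_coord :
    ((volume : Measure (EuclideanSpace ℝ (Fin 3))).toSphere).map
      (fun d : Metric.sphere (0 : EuclideanSpace ℝ (Fin 3)) 1 =>
        (d : EuclideanSpace ℝ (Fin 3)) 2) =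
      ENNReal.ofReal (2 * Real.pi) • volume.restrict (Ioo (-1) 1) := by
  have hm : Measurable fun d : Metric.sphere (0 : EuclideanSpace ℝ (Fin 3)) 1 =>
      (d : EuclideanSpace ℝ (Fin 3)) 2 := by fun_prop
  ext A hA
  rw [Measure.map_apply hm hA, Measure.toSphere_apply' _ (hm hA), Measure.smul_apply,
    Measure.restrict_apply hA, smul_eq_mul]
  have hset : Ioo (0 : ℝ) 1 • (((↑) : Metric.sphere (0 : EuclideanSpace ℝ (Fin 3)) 1 →
      EuclideanSpace ℝ (Fin 3)) '' ((fun d : Metric.sphere (0 : EuclideanSpace ℝ (Fin 3)) 1 =>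
        (d : EuclideanSpace ℝ (Fin 3)) 2) ⁻¹' A)) =
      {x : EuclideanSpace ℝ (Fin 3) | 0 < ‖x‖ ∧ ‖x‖ < 1 ∧ x 2 / ‖x‖ ∈ A} := by
    ext x
    rw [Set.mem_smul]
    constructor
    · rintro ⟨r, hr, _, ⟨d, hd, rfl⟩, rfl⟩
      have hn : ‖(d : EuclideanSpace ℝ (Fin 3))‖ = 1 := by simp
      have hd' : (d : EuclideanSpace ℝ (Fin 3)) 2 ∈ A := hd
      simp only [mem_ofPred_eq, norm_smul, hn, mul_one, Real.norm_eq_abs, abs_of_pos hr.1,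
        PiLp.smul_apply, smul_eq_mul]
      refine ⟨hr.1, hr.2, ?_⟩
      rwa [mul_div_cancel_left₀ _ hr.1.ne']
    · rintro ⟨h0, h1, hx⟩
      refine ⟨‖x‖, ⟨h0, h1⟩, ‖x‖⁻¹ • x, ⟨⟨‖x‖⁻¹ • x, ?_⟩, ?_, rfl⟩, ?_⟩
      · simp [norm_smul, h0.ne']
      · simpa [div_eq_inv_mul] using hx
      · rw [smul_smul, mul_inv_cancel₀ h0.ne', one_smul]
  rw [hset, volume_cone_shell hA, finrank_euclideanSpace, Fintype.card_fin, ← mul_assoc]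
  congr 1
  -- The dimension 3 in the formula for `toSphere` cancels the 1/3 from the radial integral.
  rw [← ENNReal.ofReal_natCast, ← ENNReal.ofReal_mul (by norm_num)]
  congr 1
  push_cast
  ring

/-! ### Distance from the satellite to the aerial transmitter -/

namespace Params

variable (p : Params)

theorem wer_pos : 0 < p.wer := add_pos p.we_pos p.wr_pos

theorem wmax_sq : p.wmax ^ 2 = p.wmin ^ 2 + 2 * p.wer * p.wmin :=
  Real.sq_sqrt (by have := p.wer_pos; have := p.wmin_pos; positivity)

theorem wmin_lt_wmax : p.wmin < p.wmax :=
  Real.lt_sqrt_of_sq_lt (by have := mul_pos p.wer_pos p.wmin_pos; linarith)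

theorem wmax_pos : 0 < p.wmax := p.wmin_pos.trans p.wmin_lt_wmax

/-- Density of the distance from the satellite to the aerial transmitter. -/
def distSatDensity (w : ℝ) : ENNReal :=
  (Icc p.wmin p.wmax).indicator (fun w => ENNReal.ofReal (w / (p.wer * p.wmin))) w

/-- Law of cosines in the triangle formed by the centre of the Earth, R and the satellite; the last
coordinate of d is the cosine of the angle at the centre. -/
theorem dist_orbit (d : Metric.sphere (0 : EuclideanSpace ℝ (Fin 3)) 1) :
    dist ((p.wer + p.wmin) • (d : EuclideanSpace ℝ (Fin 3))) p.posR =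
      Real.sqrt ((p.wer + p.wmin) ^ 2 + p.wer ^ 2 -
        2 * p.wer * (p.wer + p.wmin) * (d : EuclideanSpace ℝ (Fin 3)) 2) := by
  have hn : ‖(d : EuclideanSpace ℝ (Fin 3))‖ ^ 2 = 1 := by simp
  rw [EuclideanSpace.norm_sq_eq] at hn
  rw [EuclideanSpace.dist_eq]
  congr 1
  simp only [Fin.sum_univ_three, Real.norm_eq_abs, sq_abs, Real.dist_eq, posR] at *
  simp
  linear_combination (p.wer + p.wmin) ^ 2 * hn

theorem measurableSet_capDirections : MeasurableSet p.capDirections :=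
  measurableSet_le (by fun_prop) (by fun_prop)

/-- The height c of the direction is uniform by `toSphere_map_coord`, and w² = R² + w_er² - 2 w_er R
c with R = w_er + w_min, so dc is proportional to w dw and the density is linear in w. The horizon c
= w_er / R corresponds to w_max, the zenith c = 1 to w_min. -/
theorem map_dist_satelliteLaw :
    p.satelliteLaw.map (fun x => dist x p.posR) = volume.withDensity p.distSatDensity := by
  have hwer := p.wer_pos
  have hwmin := p.wmin_pos
  set R := p.wer + p.wmin with hR
  have hRpos : 0 < R := by positivity
  set g : ℝ → ℝ := fun c => Real.sqrt (R ^ 2 + p.wer ^ 2 - 2 * p.wer * R * c) with hg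
  set c : ℝ → ℝ := fun w => (R ^ 2 + p.wer ^ 2 - w ^ 2) / (2 * p.wer * R) with hc
  have hgm : Measurable g := by fun_prop
  have hcap : ∀ B : Set ℝ, MeasurableSet B → (volume : Measure (EuclideanSpace ℝ (Fin 3))).toSphere
      (p.capDirections ∩ (fun d : Metric.sphere (0 : EuclideanSpace ℝ (Fin 3)) 1 =>
        g ((d : EuclideanSpace ℝ (Fin 3)) 2)) ⁻¹' B) =
      ENNReal.ofReal (2 * Real.pi) *
        ∫⁻ w in Ioc p.wmin p.wmax, ENNReal.ofReal (w / (p.wer * R)) * B.indicator 1 w := by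
    intro B hB
    have hm : Measurable fun d : Metric.sphere (0 : EuclideanSpace ℝ (Fin 3)) 1 =>
      (d : EuclideanSpace ℝ (Fin 3)) 2 := by fun_prop
    have hA : MeasurableSet (Ici (p.wer / R) ∩ g ⁻¹' B) := measurableSet_Ici.inter (hgm hB)
    have hpre : p.capDirections ∩ (fun d : Metric.sphere (0 : EuclideanSpace ℝ (Fin 3)) 1 =>
        g ((d : EuclideanSpace ℝ (Fin 3)) 2)) ⁻¹' B =
        (fun d : Metric.sphere (0 : EuclideanSpace ℝ (Fin 3)) 1 =>
        (d : EuclideanSpace ℝ (Fin 3)) 2) ⁻¹' (Ici (p.wer / R) ∩ g ⁻¹' B) := by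
      ext d
      simp only [capDirections, mem_inter_iff, mem_ofPred_eq, mem_preimage, mem_Ici]
      rw [div_le_iff₀' hRpos]
    rw [hpre, ← Measure.map_apply hm hA, toSphere_map_coord, Measure.smul_apply,
      Measure.restrict_apply hA, smul_eq_mul]
    congr 1
    -- The interval is open at w_min, because this point is mapped to c = 1, which the `Ioo (-1) 1`
    -- of the hat-box theorem omits.
    have himg : c '' Ioc p.wmin p.wmax = Ico (p.wer / R) 1 := by
      have hw2 := p.wmax_sq
      ext x
      simp only [mem_image, mem_Ioc, mem_Ico, hc]
      constructor
      · rintro ⟨w, ⟨h1, h2⟩, rfl⟩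
        have h3 : p.wmin ^ 2 < w ^ 2 := pow_lt_pow_left₀ h1 hwmin.le two_ne_zero
        have h4 : w ^ 2 ≤ p.wmax ^ 2 := pow_le_pow_left₀ (hwmin.trans h1).le h2 2
        rw [div_le_div_iff₀ hRpos (by positivity), div_lt_one (by positivity)]
        refine ⟨?_, by rw [hR]; nlinarith⟩
        have : 0 ≤ R ^ 2 - p.wer ^ 2 - w ^ 2 := by rw [hR]; nlinarith
        nlinarith
      · rintro ⟨h1, h2⟩
        rw [div_le_iff₀ hRpos] at h1
        have h0 : p.wmin ^ 2 < R ^ 2 + p.wer ^ 2 - 2 * p.wer * R * x := by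
          have : 2 * p.wer * R * x < 2 * p.wer * R * 1 :=
            mul_lt_mul_of_pos_left h2 (by positivity)
          rw [hR] at *; nlinarith
        refine ⟨Real.sqrt (R ^ 2 + p.wer ^ 2 - 2 * p.wer * R * x), ⟨?_, ?_⟩, ?_⟩
        · exact Real.lt_sqrt_of_sq_lt h0
        · rw [wmax]
          apply Real.sqrt_le_sqrt
          have : p.wer * p.wer ≤ p.wer * (x * R) := mul_le_mul_of_nonneg_left h1 hwer.le
          rw [hR] at *; nlinarith
        · rw [Real.sq_sqrt (by nlinarith [sq_nonneg p.wmin])]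
          field_simp
          ring
    have hder : ∀ w ∈ Ioc p.wmin p.wmax, HasDerivWithinAt c (-(w / (p.wer * R)))
        (Ioc p.wmin p.wmax) w := by
      intro w _
      have h := (((hasDerivAt_pow 2 w).const_sub (R ^ 2 + p.wer ^ 2)).div_const
        (2 * p.wer * R)).hasDerivWithinAt (s := Ioc p.wmin p.wmax)
      refine h.congr_deriv ?_
      have h2 : ((2 : ℕ) : ℝ) * w ^ (2 - 1) = 2 * w := by norm_num
      rw [h2, mul_assoc 2, neg_div, mul_div_mul_left _ _ two_ne_zero]
    have hinj : InjOn c (Ioc p.wmin p.wmax) := by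
      intro a ha b hb hab
      have hab : (R ^ 2 + p.wer ^ 2 - a ^ 2) / (2 * p.wer * R) =
        (R ^ 2 + p.wer ^ 2 - b ^ 2) / (2 * p.wer * R) := hab
      rw [div_left_inj' (by positivity)] at hab
      exact (pow_left_inj₀ (hwmin.trans ha.1).le (hwmin.trans hb.1).le two_ne_zero).1 (by linarith)
    have hAI : Ici (p.wer / R) ∩ g ⁻¹' B ∩ Ioo (-1) 1 = g ⁻¹' B ∩ Ico (p.wer / R) 1 := by
      have : 0 < p.wer / R := by positivity
      ext x
      simp only [mem_inter_iff, mem_Ici, mem_Ioo, mem_Ico, mem_preimage]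
      constructor
      · rintro ⟨⟨h1, h2⟩, h3, h4⟩; exact ⟨h2, h1, h4⟩
      · rintro ⟨h1, h2, h3⟩; exact ⟨⟨h2, h1⟩, by linarith, h3⟩
    rw [hAI, ← Measure.restrict_apply (hgm hB), ← lintegral_indicator_one (hgm hB), ← himg,
      lintegral_image_eq_lintegral_abs_deriv_mul measurableSet_Ioc hder hinj]
    refine setLIntegral_congr_fun measurableSet_Ioc fun w hw => ?_
    have hw0 : 0 < w := hwmin.trans hw.1
    have hgc : g (c w) = w := by
      simp only [hg, hc]
      rw [mul_div_cancel₀ _ (by positivity), sub_sub_cancel, Real.sqrt_sq hw0.le]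
    rw [abs_neg, abs_of_pos (by positivity)]
    congr 1
    exact indicator_one_congr (by rw [mem_preimage, hgc])
  -- The area of the cap is 2π times its height 1 - w_er / R = w_min / R.
  have htot : (volume : Measure (EuclideanSpace ℝ (Fin 3))).toSphere p.capDirections =
      ENNReal.ofReal (2 * Real.pi * (p.wmin / R)) := by
    have h := hcap univ MeasurableSet.univ
    simp only [preimage_univ, inter_univ, indicator_univ, Pi.one_apply, mul_one] at h
    rw [h, ENNReal.ofReal_mul (q := p.wmin / R) (by positivity : 0 ≤ 2 * Real.pi)]
    congr 1
    rw [← ofReal_integral_eq_lintegral_ofReal]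
    · rw [← intervalIntegral.integral_of_le p.wmin_lt_wmax.le, intervalIntegral.integral_div,
        integral_id, p.wmax_sq]
      congr 1
      field_simp
      ring
    · exact (Continuous.integrableOn_Icc (by fun_prop)).mono_set Ioc_subset_Icc_self
    · filter_upwards [ae_restrict_mem measurableSet_Ioc] with w hw
      have := hwmin.trans hw.1
      positivity
  have hdm : Measurable fun d : Metric.sphere (0 : EuclideanSpace ℝ (Fin 3)) 1 =>
      R • (d : EuclideanSpace ℝ (Fin 3)) := by fun_prop
  rw [satelliteLaw, Measure.map_map (by fun_prop) hdm]
  have hcomp : ((fun x => dist x p.posR) ∘ fun d : Metric.sphere (0 : EuclideanSpace ℝ (Fin 3)) 1 =>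
      R • (d : EuclideanSpace ℝ (Fin 3))) =
      fun d : Metric.sphere (0 : EuclideanSpace ℝ (Fin 3)) 1 =>
        g ((d : EuclideanSpace ℝ (Fin 3)) 2) := by
    ext d
    exact p.dist_orbit d
  rw [hcomp]
  ext B hB
  rw [Measure.map_apply (by fun_prop) hB, cond_apply p.measurableSet_capDirections, hcap B hB,
    htot, withDensity_apply _ hB, ← lintegral_indicator hB, ← mul_assoc,
    ← ENNReal.ofReal_inv_of_pos (by positivity), ← ENNReal.ofReal_mul (by positivity),
    ← lintegral_const_mul _ (by
      exact (Measurable.ennreal_ofReal (by fun_prop)).mul (measurable_one.indicator hB)),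
    restrict_Ioc_eq_restrict_Icc, ← lintegral_indicator measurableSet_Icc]
  refine lintegral_congr fun w => ?_
  simp only [indicator, distSatDensity, Pi.one_apply]
  split_ifs with h1 h2
  · rw [mul_one, ← ENNReal.ofReal_mul (by positivity)]
    congr 1
    field_simp
  all_goals simp

end Params

/-! ### Distance from the aerial transmitter to the receiver -/

namespace Params

variable (p : Params)

theorem cos_φ_pos : 0 < Real.cos p.φ :=
  Real.cos_pos_of_mem_Ioo ⟨by linarith [p.φ_pos, Real.pi_pos], p.φ_lt⟩

theorem cos_φ_lt_one : Real.cos p.φ < 1 := by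
  rw [← Real.cos_zero]
  exact Real.cos_lt_cos_of_nonneg_of_le_pi_div_two le_rfl p.φ_lt.le p.φ_pos

theorem h₂_pos : 0 < p.h₂ := p.h₁_pos.trans p.h₁_lt_h₂

theorem lt_div_cos {h : ℝ} (hh : 0 < h) : h < h / Real.cos p.φ := by
  rw [lt_div_iff₀ p.cos_φ_pos]
  exact mul_lt_of_lt_one_right hh p.cos_φ_lt_one

theorem div_cos_lt_div_cos : p.h₁ / Real.cos p.φ < p.h₂ / Real.cos p.φ :=
  div_lt_div_of_pos_right p.h₁_lt_h₂ p.cos_φ_pos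

theorem h₁_lt_top : p.h₁ < p.h₂ / Real.cos p.φ := p.h₁_lt_h₂.trans (p.lt_div_cos p.h₂_pos)

/-- Unnormalized density of the distance from the aerial transmitter to the receiver. -/
def distRecWeight (u : ℝ) : ℝ := u * (min u p.h₂ - max p.h₁ (Real.cos p.φ * u))

theorem continuous_distRecWeight : Continuous p.distRecWeight := by
  unfold distRecWeight; fun_prop

theorem distRecWeight_nonneg {u : ℝ} (hu : u ∈ Icc p.h₁ (p.h₂ / Real.cos p.φ)) :
    0 ≤ p.distRecWeight u := by
  have hc := p.cos_φ_pos
  have hu0 : 0 < u := p.h₁_pos.trans_le hu.1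
  have h2 := (le_div_iff₀' hc).1 hu.2
  refine mul_nonneg hu0.le (sub_nonneg.2 (max_le (le_min hu.1 p.h₁_lt_h₂.le) (le_min ?_ h2)))
  exact mul_le_of_le_one_left hu0.le p.cos_φ_lt_one.le

/-- The minimum in the weight switches at h₂, the maximum at h₁ / cos φ. Splitting the two terms
separately avoids any comparison of h₂ with h₁ / cos φ; it produces the four ranges that occur in Q
and in 𝕀₂, …, 𝕀₅. -/
theorem integral_distRecWeight_mul {f : ℝ → ℝ}
    (hf : ContinuousOn f (Icc p.h₁ (p.h₂ / Real.cos p.φ))) :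
    ∫ u in p.h₁..(p.h₂ / Real.cos p.φ), p.distRecWeight u * f u =
      (∫ u in p.h₁..p.h₂, u ^ 2 * f u) - p.h₁ * (∫ u in p.h₁..(p.h₁ / Real.cos p.φ), u * f u) +
      p.h₂ * (∫ u in p.h₂..(p.h₂ / Real.cos p.φ), u * f u) -
      Real.cos p.φ * ∫ u in (p.h₁ / Real.cos p.φ)..(p.h₂ / Real.cos p.φ), u ^ 2 * f u := by
  have hc := p.cos_φ_pos
  have e1 := p.h₁_lt_h₂
  have e2 := p.lt_div_cos p.h₁_pos
  have e3 := p.lt_div_cos p.h₂_pos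
  have e4 := p.div_cos_lt_div_cos
  have hint : ∀ (g : ℝ → ℝ) (_ : Continuous g) (a b : ℝ), p.h₁ ≤ a → a ≤ b →
      b ≤ p.h₂ / Real.cos p.φ → IntervalIntegrable (fun u => g u * f u) volume a b := by
    intro g hg a b ha hab hb
    refine ContinuousOn.intervalIntegrable ?_
    rw [uIcc_of_le hab]
    exact hg.continuousOn.mul (hf.mono (Icc_subset_Icc ha hb))
  have hmin : ∫ u in p.h₁..(p.h₂ / Real.cos p.φ), (u * min u p.h₂) * f u =
      (∫ u in p.h₁..p.h₂, u ^ 2 * f u) +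
        p.h₂ * ∫ u in p.h₂..(p.h₂ / Real.cos p.φ), u * f u := by
    rw [← intervalIntegral.integral_add_adjacent_intervals
      (hint _ (by fun_prop) p.h₁ p.h₂ le_rfl e1.le e3.le)
      (hint _ (by fun_prop) p.h₂ _ e1.le e3.le le_rfl), ← intervalIntegral.integral_const_mul]
    congr 1 <;> refine intervalIntegral.integral_congr fun u hu => ?_
    · rw [uIcc_of_le e1.le] at hu
      simp only [min_eq_left hu.2, sq]
    · rw [uIcc_of_le e3.le] at hu
      simp only [min_eq_right hu.1]
      ring
  have hmax : ∫ u in p.h₁..(p.h₂ / Real.cos p.φ), (u * max p.h₁ (Real.cos p.φ * u)) * f u =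
      p.h₁ * (∫ u in p.h₁..(p.h₁ / Real.cos p.φ), u * f u) + Real.cos p.φ *
        ∫ u in (p.h₁ / Real.cos p.φ)..(p.h₂ / Real.cos p.φ), u ^ 2 * f u := by
    rw [← intervalIntegral.integral_add_adjacent_intervals
      (hint _ (by fun_prop) p.h₁ (p.h₁ / Real.cos p.φ) le_rfl e2.le e4.le)
      (hint _ (by fun_prop) (p.h₁ / Real.cos p.φ) _ e2.le e4.le le_rfl),
      ← intervalIntegral.integral_const_mul, ← intervalIntegral.integral_const_mul]
    congr 1 <;> refine intervalIntegral.integral_congr fun u hu => ?_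
    · rw [uIcc_of_le e2.le] at hu
      have := (le_div_iff₀' hc).1 hu.2
      simp only [max_eq_left this]
      ring
    · rw [uIcc_of_le e4.le] at hu
      have := (div_le_iff₀' hc).1 hu.1
      simp only [max_eq_right this]
      ring
  calc _ = ∫ u in p.h₁..(p.h₂ / Real.cos p.φ),
          ((u * min u p.h₂) * f u - (u * max p.h₁ (Real.cos p.φ * u)) * f u) := by
        refine intervalIntegral.integral_congr fun u _ => ?_
        simp only [distRecWeight]
        ring
    _ = _ := by
        rw [intervalIntegral.integral_sub (hint _ (by fun_prop) _ _ le_rfl (e1.trans e3).le le_rfl)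
          (hint _ (by fun_prop) _ _ le_rfl (e1.trans e3).le le_rfl), hmin, hmax]
        ring

theorem h_cube_pos : 0 < p.h₂ ^ 3 - p.h₁ ^ 3 :=
  sub_pos.2 (pow_lt_pow_left₀ p.h₁_lt_h₂ p.h₁_pos.le (by norm_num))

theorem tan_φ_pos : 0 < Real.tan p.φ := Real.tan_pos_of_pos_of_lt_pi_div_two p.φ_pos p.φ_lt

/-- Multiplied by 2π this is the volume of the truncated cone, so it normalizes the density of u. -/
theorem integral_distRecWeight :
    ∫ u in p.h₁..(p.h₂ / Real.cos p.φ), p.distRecWeight u =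
      Real.tan p.φ ^ 2 * (p.h₂ ^ 3 - p.h₁ ^ 3) / 6 := by
  have h := p.integral_distRecWeight_mul (f := fun _ => 1) continuousOn_const
  simp only [mul_one] at h
  rw [h]
  simp only [integral_pow, integral_id]
  have hc := p.cos_φ_pos.ne'
  have hs : Real.tan p.φ ^ 2 = (1 - Real.cos p.φ ^ 2) / Real.cos p.φ ^ 2 := by
    rw [Real.tan_eq_sin_div_cos, div_pow, Real.sin_sq]
  rw [hs]
  norm_num [div_pow]
  field_simp
  ring

/-- Density of the distance from the aerial transmitter to the receiver. -/
def distRecDensity (u : ℝ) : ENNReal :=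
  (Icc p.h₁ (p.h₂ / Real.cos p.φ)).indicator
    (fun u => ENNReal.ofReal (6 / (Real.tan p.φ ^ 2 * (p.h₂ ^ 3 - p.h₁ ^ 3)) *
      p.distRecWeight u)) u

theorem measurableSet_receiverRegion : MeasurableSet p.receiverRegion := by
  have hm : Measurable fun x : EuclideanSpace ℝ (Fin 3) => (p.posR - x) 2 := by fun_prop
  exact (measurableSet_le measurable_const hm).inter
    ((measurableSet_le hm measurable_const).inter (measurableSet_le (by fun_prop) hm))

/-- After the reflection x ↦ R - x, membership depends on norm and height only. At distance u from
the apex the heights run from max(h₁, u cos φ) to min(u, h₂), and `lintegral_norm_coord` contributes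
the weight u. -/
theorem volume_receiverRegion_inter {B : Set ℝ} (hB : MeasurableSet B) :
    volume (p.receiverRegion ∩ (fun x => dist x p.posR) ⁻¹' B) =
      ENNReal.ofReal (2 * Real.pi) * ∫⁻ u in Icc p.h₁ (p.h₂ / Real.cos p.φ),
        ENNReal.ofReal (p.distRecWeight u) * B.indicator 1 u := by
  have hc := p.cos_φ_pos
  set V : Set (ℝ × ℝ) := {q | (p.h₁ ≤ q.2 ∧ q.2 ≤ p.h₂ ∧ q.1 * Real.cos p.φ ≤ q.2) ∧ q.1 ∈ B}
    with hV
  have hVm : MeasurableSet V :=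
    ((measurableSet_le measurable_const measurable_snd).inter
      ((measurableSet_le measurable_snd measurable_const).inter
        (measurableSet_le (by fun_prop) measurable_snd))).inter (measurable_fst hB)
  have hf : Measurable (V.indicator (1 : ℝ × ℝ → ENNReal)) := measurable_one.indicator hVm
  have h := lintegral_norm_coord hf
  have hpre : MeasurableSet (p.receiverRegion ∩ (fun x => dist x p.posR) ⁻¹' B) :=
    p.measurableSet_receiverRegion.inter ((by fun_prop : Measurable fun x => dist x p.posR) hB)
  rw [← lintegral_indicator_one hpre, ← lintegral_sub_left_eq_self _ p.posR]
  have hL : ∀ x : EuclideanSpace ℝ (Fin 3),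
      (p.receiverRegion ∩ (fun x => dist x p.posR) ⁻¹' B).indicator
        (1 : EuclideanSpace ℝ (Fin 3) → ENNReal) (p.posR - x) = V.indicator 1 (‖x‖, x 2) := by
    intro x
    refine indicator_one_congr ?_
    simp only [receiverRegion, hV, mem_inter_iff, mem_ofPred_eq, sub_sub_cancel, mem_preimage]
    rw [dist_eq_norm, sub_sub_cancel_left, norm_neg]
  rw [lintegral_congr hL, h]
  congr 1
  have hsub : Icc p.h₁ (p.h₂ / Real.cos p.φ) ⊆ Ioi 0 := fun u hu => p.h₁_pos.trans_le hu.1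
  rw [← inter_eq_left.2 hsub, ← Measure.restrict_restrict measurableSet_Icc,
    ← lintegral_indicator measurableSet_Icc]
  refine setLIntegral_congr_fun measurableSet_Ioi fun r hr => ?_
  have hr : 0 < r := hr
  by_cases hrB : r ∈ B
  · have hset : (fun z => V.indicator (1 : ℝ × ℝ → ENNReal) (r, z)) =
        (Icc (max p.h₁ (Real.cos p.φ * r)) p.h₂).indicator 1 := by
      ext z
      refine indicator_one_congr ?_
      simp only [hV, mem_ofPred_eq, hrB, and_true, mem_Icc, max_le_iff, mul_comm r]
      tauto
    have hvol : volume (Icc (max p.h₁ (Real.cos p.φ * r)) p.h₂ ∩ Ioo (-r) r) =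
        ENNReal.ofReal (min r p.h₂ - max p.h₁ (Real.cos p.φ * r)) := by
      have h0 : 0 < max p.h₁ (Real.cos p.φ * r) := lt_max_of_lt_left p.h₁_pos
      rw [← Real.volume_Icc]
      refine measure_congr ?_
      have : Icc (max p.h₁ (Real.cos p.φ * r)) p.h₂ ∩ Ioo (-r) r =
          Icc (max p.h₁ (Real.cos p.φ * r)) p.h₂ ∩ Iio r := by
        ext z
        simp only [mem_inter_iff, mem_Icc, mem_Ioo, mem_Iio]
        constructor
        · rintro ⟨h1, h2⟩; exact ⟨h1, h2.2⟩
        · rintro ⟨h1, h2⟩; exact ⟨h1, by linarith [h1.1], h2⟩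
      rw [this]
      refine ((ae_eq_refl _).inter Iio_ae_eq_Iic).trans ?_
      rw [← Ici_inter_Iic, inter_assoc, Iic_inter_Iic, Ici_inter_Iic, min_comm]
      rfl
    rw [hset, lintegral_indicator_one measurableSet_Icc,
      Measure.restrict_apply measurableSet_Icc, hvol, ← ENNReal.ofReal_mul hr.le]
    -- Outside this interval there is no admissible height: the signed length is nonpositive and
    -- `ENNReal.ofReal` sends it to 0.
    by_cases hI : r ∈ Icc p.h₁ (p.h₂ / Real.cos p.φ)
    · rw [indicator_of_mem hI, indicator_of_mem hrB, Pi.one_apply, mul_one, distRecWeight]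
    · rw [indicator_of_notMem hI, ENNReal.ofReal_eq_zero]
      refine mul_nonpos_of_nonneg_of_nonpos hr.le (sub_nonpos.2 ?_)
      rw [mem_Icc, not_and_or, not_le, not_le] at hI
      rcases hI with hI | hI
      · exact (min_le_left _ _).trans (hI.le.trans (le_max_left _ _))
      · rw [div_lt_iff₀' hc] at hI
        exact (min_le_right _ _).trans (hI.le.trans (le_max_right _ _))
  · have : ∀ z, V.indicator (1 : ℝ × ℝ → ENNReal) (r, z) = 0 := fun z =>
      indicator_of_notMem (fun hz => hrB hz.2) _
    simp only [this, lintegral_zero, mul_zero]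
    simp [indicator, hrB]

theorem map_dist_receiver :
    (cond (volume : Measure (EuclideanSpace ℝ (Fin 3))) p.receiverRegion).map
      (fun x => dist x p.posR) = volume.withDensity p.distRecDensity := by
  have ht := p.tan_φ_pos
  have hh := p.h_cube_pos
  have htot : volume p.receiverRegion =
      ENNReal.ofReal (2 * Real.pi * (Real.tan p.φ ^ 2 * (p.h₂ ^ 3 - p.h₁ ^ 3) / 6)) := by
    have h := p.volume_receiverRegion_inter MeasurableSet.univ
    simp only [preimage_univ, inter_univ, indicator_univ, Pi.one_apply, mul_one] at h
    rw [h, ENNReal.ofReal_mul (q := Real.tan p.φ ^ 2 * (p.h₂ ^ 3 - p.h₁ ^ 3) / 6)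
      (by positivity : 0 ≤ 2 * Real.pi)]
    congr 1
    rw [← ofReal_integral_eq_lintegral_ofReal]
    · rw [integral_Icc_eq_integral_Ioc, ← intervalIntegral.integral_of_le p.h₁_lt_top.le,
        p.integral_distRecWeight]
    · exact p.continuous_distRecWeight.integrableOn_Icc
    · filter_upwards [ae_restrict_mem measurableSet_Icc] with u hu
      exact p.distRecWeight_nonneg hu
  ext B hB
  rw [Measure.map_apply (by fun_prop) hB, cond_apply p.measurableSet_receiverRegion,
    p.volume_receiverRegion_inter hB, htot, withDensity_apply _ hB, ← lintegral_indicator hB,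
    ← mul_assoc, ← ENNReal.ofReal_inv_of_pos (by positivity),
    ← ENNReal.ofReal_mul (by positivity), ← lintegral_const_mul _ (by
      exact (p.continuous_distRecWeight.measurable.ennreal_ofReal).mul
        (measurable_one.indicator hB)), ← lintegral_indicator measurableSet_Icc]
  refine lintegral_congr fun w => ?_
  simp only [indicator, distRecDensity, Pi.one_apply]
  split_ifs with h1 h2
  · rw [mul_one, ← ENNReal.ofReal_mul (by positivity)]
    congr 1
    field_simp
  all_goals simp

end Params

/-! ### The Rician tail as a Poisson mixture; signs of the constants -/

/-- The probability that a Poisson variable with mean `A` is at most `j`. -/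
def poissonCdf (j : ℕ) (A : ℝ) : ℝ :=
  (∑ n ∈ Finset.range (j + 1), A ^ n / (n.factorial : ℝ)) * Real.exp (-A)

theorem poissonCdf_nonneg (j : ℕ) {A : ℝ} (hA : 0 ≤ A) : 0 ≤ poissonCdf j A :=
  mul_nonneg (Finset.sum_nonneg fun _ _ => by positivity) (Real.exp_nonneg _)

theorem poissonCdf_le_one (j : ℕ) {A : ℝ} (hA : 0 ≤ A) : poissonCdf j A ≤ 1 := by
  have h := Real.sum_le_exp_of_nonneg hA (j + 1)
  calc poissonCdf j A ≤ Real.exp A * Real.exp (-A) :=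
        mul_le_mul_of_nonneg_right h (Real.exp_nonneg _)
    _ = 1 := by rw [← Real.exp_add, add_neg_cancel, Real.exp_zero]

theorem continuous_poissonCdf (j : ℕ) : Continuous (poissonCdf j) := by
  unfold poissonCdf; fun_prop

/-- The derivatives of the summands telescope, and only the negative part of the last one survives.
-/
theorem hasDerivAt_poissonCdf (j : ℕ) (A : ℝ) :
    HasDerivAt (poissonCdf j) (-(A ^ j / (j.factorial : ℝ) * Real.exp (-A))) A := by
  have hexp : HasDerivAt (fun A : ℝ => Real.exp (-A)) (-Real.exp (-A)) A := by
    simpa using (hasDerivAt_neg A).exp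
  induction j with
  | zero =>
    have h : poissonCdf 0 = fun A : ℝ => Real.exp (-A) := by ext; simp [poissonCdf]
    rw [h]
    simpa using hexp
  | succ j ih =>
    have h : poissonCdf (j + 1) = fun A : ℝ => poissonCdf j A +
        A ^ (j + 1) / ((j + 1).factorial : ℝ) * Real.exp (-A) := by
      ext A
      rw [poissonCdf, Finset.sum_range_succ, add_mul, poissonCdf]
    rw [h]
    refine (ih.add (((hasDerivAt_pow (j + 1) A).div_const _).mul hexp)).congr_deriv ?_
    rw [Nat.factorial_succ]
    push_cast
    have : (j.factorial : ℝ) ≠ 0 := by positivity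
    have : (j : ℝ) + 1 ≠ 0 := by positivity
    field_simp
    ring_nf

theorem tendsto_poissonCdf (j : ℕ) : Tendsto (poissonCdf j) atTop (𝓝 0) := by
  have h : poissonCdf j = fun A : ℝ =>
      ∑ n ∈ Finset.range (j + 1), (A ^ n * Real.exp (-A)) / (n.factorial : ℝ) := by
    ext A
    rw [poissonCdf, Finset.sum_mul]
    exact Finset.sum_congr rfl fun _ _ => by ring
  rw [h, ← Finset.sum_const_zero (s := Finset.range (j + 1))]
  refine tendsto_finsetSum _ fun n _ => ?_
  simpa using (Real.tendsto_pow_mul_exp_neg_atTop_nhds_zero n).div_const (n.factorial : ℝ)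

/-- In a Poisson process of rate c, the point number j + 1 comes after time a exactly when at most j
points have come by then. Analytically, -`poissonCdf` j (c z) is an antiderivative that vanishes at
infinity. -/
theorem lintegral_erlang (j : ℕ) {c a : ℝ} (hc : 0 < c) (ha : 0 ≤ a) :
    ∫⁻ z in Ioi a, ENNReal.ofReal (c * ((c * z) ^ j / (j.factorial : ℝ) * Real.exp (-(c * z)))) =
      ENNReal.ofReal (poissonCdf j (c * a)) := by
  have hder : ∀ z ∈ Ici a, HasDerivAt (fun z => -poissonCdf j (c * z))
      (c * ((c * z) ^ j / (j.factorial : ℝ) * Real.exp (-(c * z)))) z := by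
    intro z _
    have h1 : HasDerivAt (fun z : ℝ => c * z) c z := by simpa using (hasDerivAt_id z).const_mul c
    refine ((hasDerivAt_poissonCdf j (c * z)).comp z h1).neg.congr_deriv ?_
    ring
  have hnn : ∀ z ∈ Ioi a,
      0 ≤ c * ((c * z) ^ j / (j.factorial : ℝ) * Real.exp (-(c * z))) := by
    intro z hz
    have : 0 < z := ha.trans_lt hz
    positivity
  have htend : Tendsto (fun z => -poissonCdf j (c * z)) atTop (𝓝 0) := by
    simpa using ((tendsto_poissonCdf j).comp (tendsto_id.const_mul_atTop hc)).neg
  rw [← ofReal_integral_eq_lintegral_ofReal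
    (integrableOn_Ioi_deriv_of_nonneg' hder hnn htend)
    ((ae_restrict_mem measurableSet_Ioi).mono hnn),
    integral_Ioi_of_hasDerivAt_of_nonneg' hder hnn htend]
  simp

/-- Tail function of the Rician power gain with factor `K` and mean `1`, as a function of
`(1 + K) x`. -/
def ricianTail (K A : ℝ) : ℝ :=
  ∑' m : ℕ, K ^ m * Real.exp (-K) / (m.factorial : ℝ) * poissonCdf m A

theorem summable_poisson (K : ℝ) :
    Summable fun m : ℕ => K ^ m * Real.exp (-K) / (m.factorial : ℝ) := by
  refine ((Real.summable_pow_div_factorial K).mul_right (Real.exp (-K))).congr fun m => ?_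
  ring

theorem summable_ricianTail {K A : ℝ} (hK : 0 ≤ K) (hA : 0 ≤ A) :
    Summable fun m : ℕ => K ^ m * Real.exp (-K) / (m.factorial : ℝ) * poissonCdf m A :=
  Summable.of_nonneg_of_le (fun m => mul_nonneg (by positivity) (poissonCdf_nonneg m hA))
    (fun m => mul_le_of_le_one_right (by positivity) (poissonCdf_le_one m hA)) (summable_poisson K)

theorem ricianTail_nonneg {K A : ℝ} (hK : 0 ≤ K) (hA : 0 ≤ A) : 0 ≤ ricianTail K A :=
  tsum_nonneg fun m => mul_nonneg (by positivity) (poissonCdf_nonneg m hA)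

theorem ricianTail_le_one {K A : ℝ} (hK : 0 ≤ K) (hA : 0 ≤ A) : ricianTail K A ≤ 1 := by
  have h1 : ∑' m : ℕ, K ^ m * Real.exp (-K) / (m.factorial : ℝ) = 1 := by
    have : (fun m : ℕ => K ^ m * Real.exp (-K) / (m.factorial : ℝ)) =
        fun m : ℕ => K ^ m / (m.factorial : ℝ) * Real.exp (-K) := by ext; ring
    rw [this, tsum_mul_right]
    have h := congrFun (NormedSpace.exp_eq_tsum_div (𝔸 := ℝ)) K
    rw [← h, ← Real.exp_eq_exp_ℝ, ← Real.exp_add, add_neg_cancel, Real.exp_zero]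
  rw [← h1]
  exact (summable_ricianTail hK hA).tsum_le_tsum
    (fun m => mul_le_of_le_one_right (by positivity) (poissonCdf_le_one m hA)) (summable_poisson K)

theorem continuousOn_ricianTail {K : ℝ} (hK : 0 ≤ K) : ContinuousOn (ricianTail K) (Ici 0) := by
  refine continuousOn_tsum (fun m => ((continuous_poissonCdf m).const_mul _).continuousOn)
    (summable_poisson K) fun m A hA => ?_
  rw [Real.norm_of_nonneg (mul_nonneg (by positivity) (poissonCdf_nonneg m hA))]
  exact mul_le_of_le_one_right (by positivity) (poissonCdf_le_one m hA)

theorem measurable_ricianTail (K : ℝ) : Measurable (ricianTail K) := by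
  unfold ricianTail
  exact Measurable.tsum fun m => ((continuous_poissonCdf m).measurable.const_mul _)

theorem summable_besselI0 (z : ℝ) :
    Summable fun j : ℕ => (1 / ((j.factorial : ℝ) ^ 2)) * (z / 2) ^ (2 * j) := by
  refine Summable.of_nonneg_of_le (fun j => ?_) (fun j => ?_)
    (Real.summable_pow_div_factorial ((z / 2) ^ 2))
  · rw [pow_mul]; positivity
  · rw [pow_mul, one_div_mul_eq_div]
    refine div_le_div_of_nonneg_left (by positivity) (by positivity) ?_
    exact le_self_pow₀ (by exact_mod_cast Nat.one_le_iff_ne_zero.2 j.factorial_ne_zero)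
      two_ne_zero

namespace Params

variable (p : Params)

/-- The power series of I₀ exhibits the Rician density as a mixture of the Erlang densities of rate
1 + K with Poisson(K) weights. All terms are nonnegative, so the tail may be computed termwise. -/
theorem hasSum_ricianPdf {z : ℝ} (hz : 0 ≤ z) :
    HasSum (fun j : ℕ => p.K ^ j * Real.exp (-p.K) / (j.factorial : ℝ) *
      ((1 + p.K) * (((1 + p.K) * z) ^ j / (j.factorial : ℝ) * Real.exp (-((1 + p.K) * z)))))
      (p.ricianPdf z) := by
  have hK := p.K_nonneg
  rw [ricianPdf, if_pos hz, besselI0]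
  refine ((summable_besselI0 _).hasSum.mul_left _).congr_fun fun j => ?_
  rw [pow_mul, mul_div_cancel_left₀ _ two_ne_zero, Real.sq_sqrt (by positivity), sub_eq_add_neg,
    Real.exp_add, mul_pow, mul_pow, mul_pow]
  field_simp

theorem lintegral_ricianPdf {a : ℝ} (ha : 0 ≤ a) :
    (volume.withDensity fun x => ENNReal.ofReal (p.ricianPdf x)) (Ioi a) =
      ENNReal.ofReal (ricianTail p.K ((1 + p.K) * a)) := by
  have hK := p.K_nonneg
  rw [withDensity_apply _ measurableSet_Ioi]
  have h : ∀ z ∈ Ioi a, ENNReal.ofReal (p.ricianPdf z) = ∑' j : ℕ,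
      ENNReal.ofReal (p.K ^ j * Real.exp (-p.K) / (j.factorial : ℝ)) * ENNReal.ofReal
      ((1 + p.K) * (((1 + p.K) * z) ^ j / (j.factorial : ℝ) * Real.exp (-((1 + p.K) * z)))) := by
    intro z hz
    have hz0 : 0 ≤ z := ha.trans (le_of_lt hz)
    rw [← (p.hasSum_ricianPdf hz0).tsum_eq, ENNReal.ofReal_tsum_of_nonneg (fun j => by positivity)
      (p.hasSum_ricianPdf hz0).summable]
    exact tsum_congr fun j => ENNReal.ofReal_mul (by positivity)
  rw [setLIntegral_congr_fun measurableSet_Ioi h, lintegral_tsum (fun j => by fun_prop)]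
  have hA : 0 ≤ (1 + p.K) * a := by positivity
  rw [ricianTail, ENNReal.ofReal_tsum_of_nonneg
    (fun m => mul_nonneg (by positivity) (poissonCdf_nonneg m hA)) (summable_ricianTail hK hA)]
  refine tsum_congr fun j => ?_
  rw [lintegral_const_mul _ (by fun_prop), lintegral_erlang j (by positivity) ha,
    ENNReal.ofReal_mul (by positivity)]

theorem δ_nonneg : 0 ≤ p.δ := by
  have := p.flat_pos; have := p.Ωsr_nonneg
  unfold δ; positivity

theorem msr_pos' : 0 < (p.msr : ℝ) := by exact_mod_cast p.msr_pos

theorem α_pos : 0 < p.α := by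
  have := p.flat_pos; have := p.Ωsr_nonneg; have := p.msr_pos'
  unfold α; positivity

theorem βbar_pos : 0 < p.βbar := by
  have h1 := p.flat_pos; have h2 := p.Ωsr_nonneg; have h3 := p.msr_pos'
  have h : p.βbar = p.msr / (2 * p.flat * p.msr + p.Ωsr) := by
    unfold βbar β δ
    field_simp
    ring
  rw [h]; positivity

/-- The product (-1)^k (1 - m_sr)_k is the falling factorial of the natural number m_sr - 1, so the
signs cancel. -/
theorem ζ_nonneg (k : ℕ) : 0 ≤ p.ζ k := by
  have hδ := p.δ_nonneg
  have h : 0 ≤ (-1) ^ k * (ascPochhammer ℝ k).eval (1 - (p.msr : ℝ)) := by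
    have h1 : (1 - (p.msr : ℝ)) = -((p.msr - 1 : ℕ) : ℝ) := by
      rw [Nat.cast_sub p.msr_pos]; simp
    rw [h1, ascPochhammer_eval_neg_eq_descPochhammer, ← mul_assoc, ← mul_pow]
    simp only [mul_neg, mul_one, neg_neg, one_pow, one_mul]
    rw [descPochhammer_eval_eq_descFactorial]
    positivity
  unfold ζ
  positivity

theorem χρε_pos : 0 < p.χρε := by
  have h1 := p.χ_pos
  have h2 : 0 < 1 - p.ρ := sub_pos.2 p.ρ_lt
  have h3 := p.ρ_nonneg
  have h4 := p.ε_nonneg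
  unfold χρε
  rcases p.harvests with h | h <;> positivity

theorem με_pos : 0 < p.με := by
  have h1 := p.μ_pos
  have h2 : 0 < 1 - p.ε := sub_pos.2 p.ε_lt
  have h3 := p.σr2_pos
  have h4 := p.σrb2_pos
  unfold με; positivity

theorem D_pos {γA : ℝ} (h : 0 < γA) : 0 < p.D γA := mul_pos (mul_pos p.με_pos p.χρε_pos) h

theorem E_pos : 0 < p.E := mul_pos (mul_pos p.χρε_pos p.ηs_pos) (sub_pos.2 p.μ_lt)

theorem θ_pos {Pth γA : ℝ} (hP : 0 < Pth) (h : 0 < γA) : 0 < p.θ Pth γA := by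
  have := p.ηs_pos; have := p.σt2_pos; have := p.K_nonneg
  unfold θ Θ; positivity

end Params

/-! ### The excess gain t and the integrand of the triple integral -/

/-- Half of the exponential rate absorbs the polynomial, since y^k / k! ≤ e^y at y = (c/2)(t + d).
-/
theorem exists_pow_mul_exp_le (k : ℕ) (d : ℝ) {c : ℝ} (hc : 0 < c) (hd : 0 ≤ d) :
    ∃ C, 0 ≤ C ∧ ∀ t, 0 ≤ t → (t + d) ^ k * Real.exp (-(c * t)) ≤ C * Real.exp (-(c / 2 * t)) := by
  refine ⟨(k.factorial : ℝ) / (c / 2) ^ k * Real.exp (c / 2 * d), by positivity, fun t ht => ?_⟩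
  have h := Real.pow_div_factorial_le_exp (c / 2 * (t + d)) (by positivity) k
  rw [mul_pow, div_le_iff₀ (by positivity)] at h
  have h2 : (t + d) ^ k ≤
      (k.factorial : ℝ) / (c / 2) ^ k * Real.exp (c / 2 * (t + d)) := by
    rw [div_mul_eq_mul_div, le_div_iff₀ (by positivity)]
    linarith
  calc (t + d) ^ k * Real.exp (-(c * t))
      ≤ (k.factorial : ℝ) / (c / 2) ^ k * Real.exp (c / 2 * (t + d)) * Real.exp (-(c * t)) :=
        mul_le_mul_of_nonneg_right h2 (Real.exp_nonneg _)
    _ = _ := by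
        rw [mul_assoc, mul_assoc, ← Real.exp_add, ← Real.exp_add]
        congr 2
        ring

namespace Params

variable (p : Params)

/-- Lebesgue measure on the range of the distances `w`, `u` and of the excess gain `t > t₀`. -/
def region (t₀ : ℝ) : Measure (ℝ × ℝ × ℝ) :=
  (volume.restrict (Icc p.wmin p.wmax)).prod
    ((volume.restrict (Icc p.h₁ (p.h₂ / Real.cos p.φ))).prod (volume.restrict (Ioi t₀)))

theorem region_eq (t₀ : ℝ) : p.region t₀ = volume.restrict
    (Icc p.wmin p.wmax ×ˢ Icc p.h₁ (p.h₂ / Real.cos p.φ) ×ˢ Ioi t₀) := by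
  rw [region, Measure.prod_restrict, Measure.prod_restrict]
  rfl

theorem measurableSet_box (t₀ : ℝ) : MeasurableSet
    (Icc p.wmin p.wmax ×ˢ Icc p.h₁ (p.h₂ / Real.cos p.φ) ×ˢ Ioi t₀) :=
  measurableSet_Icc.prod (measurableSet_Icc.prod measurableSet_Ioi)

theorem ae_region {t₀ : ℝ} {P : ℝ × ℝ × ℝ → Prop}
    (h : ∀ w ∈ Icc p.wmin p.wmax, ∀ u ∈ Icc p.h₁ (p.h₂ / Real.cos p.φ), ∀ t ∈ Ioi t₀,
      P (w, u, t)) : ∀ᵐ q ∂p.region t₀, P q := by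
  rw [region_eq]
  filter_upwards [ae_restrict_mem (p.measurableSet_box t₀)] with q hq
  exact h q.1 hq.1 q.2.1 hq.2.1 q.2.2 hq.2.2

theorem integrable_exp_region (t₀ : ℝ) {c : ℝ} (hc : 0 < c) :
    Integrable (fun q : ℝ × ℝ × ℝ => Real.exp (-(c * q.2.2))) (p.region t₀) := by
  have h : Integrable (fun t : ℝ => Real.exp (-(c * t))) (volume.restrict (Ioi t₀)) := by
    have h := exp_neg_integrableOn_Ioi t₀ hc
    simp only [neg_mul] at h
    exact h
  exact (h.comp_snd (volume.restrict (Icc p.h₁ (p.h₂ / Real.cos p.φ)))).comp_snd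
    (volume.restrict (Icc p.wmin p.wmax))

theorem integrable_region_of_le {t₀ : ℝ} {F : ℝ × ℝ × ℝ → ℝ} (hF : Measurable F)
    {C c : ℝ} (hc : 0 < c)
    (h : ∀ w ∈ Icc p.wmin p.wmax, ∀ u ∈ Icc p.h₁ (p.h₂ / Real.cos p.φ), ∀ t ∈ Ioi t₀,
      |F (w, u, t)| ≤ C * Real.exp (-(c * t))) : Integrable F (p.region t₀) :=
  ((p.integrable_exp_region t₀ hc).const_mul C).mono' hF.aestronglyMeasurable (p.ae_region h)

theorem exists_distRecWeight_le :
    ∃ Q, 0 ≤ Q ∧ ∀ u ∈ Icc p.h₁ (p.h₂ / Real.cos p.φ), p.distRecWeight u ≤ Q := by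
  obtain ⟨Q, hQ⟩ := (isCompact_Icc (a := p.h₁)
    (b := p.h₂ / Real.cos p.φ)).exists_bound_of_continuousOn
    p.continuous_distRecWeight.continuousOn
  have h1 : p.h₁ ∈ Icc p.h₁ (p.h₂ / Real.cos p.φ) := left_mem_Icc.2 p.h₁_lt_top.le
  exact ⟨Q, (norm_nonneg _).trans (hQ _ h1), fun u hu => (le_abs_self _).trans (hQ u hu)⟩

/-- Density, up to a constant factor, of the part of order `k` of the joint law of the distances
`w`, `u` and of the excess gain `t` of the satellite link, given by `x = w² (t + 𝒟) / ℰ`. -/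
def gainWeight (γA : ℝ) (k : ℕ) (w u t : ℝ) : ℝ :=
  w ^ (2 * k + 3) * p.distRecWeight u * ((t + p.D γA) ^ k / p.E ^ (k + 1)) *
    Real.exp (-(p.βbar * (w ^ 2 * (t + p.D γA) / p.E)))

/-- `(1 + K)` times the gain of the air-to-air link that is needed at distance `u` for the excess
gain `t` of the satellite link. -/
def tailArg (Pth γA u t : ℝ) : ℝ := p.θ Pth γA * u ^ p.ν / p.E * (1 + p.D γA / t)

variable {p} {Pth γA : ℝ}

theorem tailArg_pos (hP : 0 < Pth) (hγ : 0 < γA) {u t : ℝ} (hu : 0 < u) (ht : 0 < t) :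
    0 < p.tailArg Pth γA u t := by
  have := p.θ_pos hP hγ; have := p.E_pos; have := p.D_pos hγ
  have := Real.rpow_pos_of_pos hu p.ν
  unfold tailArg; positivity

theorem measurable_tailArg : Measurable fun q : ℝ × ℝ => p.tailArg Pth γA q.1 q.2 := by
  unfold tailArg; fun_prop

theorem measurable_gainWeight (k : ℕ) :
    Measurable fun q : ℝ × ℝ × ℝ => p.gainWeight γA k q.1 q.2.1 q.2.2 := by
  have := p.continuous_distRecWeight.measurable
  unfold gainWeight
  fun_prop

theorem gainWeight_nonneg (hγ : 0 < γA) (k : ℕ) {w u t : ℝ} (hw : w ∈ Icc p.wmin p.wmax)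
    (hu : u ∈ Icc p.h₁ (p.h₂ / Real.cos p.φ)) (ht : 0 < t) : 0 ≤ p.gainWeight γA k w u t := by
  have := p.distRecWeight_nonneg hu
  have := p.wmin_pos.trans_le hw.1
  have := p.E_pos; have := p.D_pos hγ
  unfold gainWeight; positivity

/-- The integrability of the whole proof comes from here: w and u range over compact intervals, and
w ≥ w_min > 0 gives a rate of decay in t that is uniform in both. -/
theorem exists_gainWeight_le (hγ : 0 < γA) (k : ℕ) : ∃ C c, 0 < c ∧
    ∀ w ∈ Icc p.wmin p.wmax, ∀ u ∈ Icc p.h₁ (p.h₂ / Real.cos p.φ), ∀ t ∈ Ioi (0 : ℝ),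
      p.gainWeight γA k w u t ≤ C * Real.exp (-(c * t)) := by
  have hE := p.E_pos
  have hD := p.D_pos hγ
  have hβ := p.βbar_pos
  have hwmin := p.wmin_pos
  have hc : 0 < p.βbar * p.wmin ^ 2 / p.E := by positivity
  obtain ⟨Q, hQ0, hQ⟩ := p.exists_distRecWeight_le
  obtain ⟨C, hC0, hC⟩ := exists_pow_mul_exp_le k (p.D γA) hc hD.le
  refine ⟨p.wmax ^ (2 * k + 3) * Q / p.E ^ (k + 1) * C, _, half_pos hc, fun w hw u hu t ht => ?_⟩
  have ht : 0 < t := ht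
  have hw0 := hwmin.trans_le hw.1
  have hq := p.distRecWeight_nonneg hu
  have h1 : w ^ (2 * k + 3) * p.distRecWeight u ≤ p.wmax ^ (2 * k + 3) * Q :=
    mul_le_mul (pow_le_pow_left₀ hw0.le hw.2 _) (hQ u hu) hq (by have := p.wmax_pos; positivity)
  have h2 : Real.exp (-(p.βbar * (w ^ 2 * (t + p.D γA) / p.E))) ≤
      Real.exp (-(p.βbar * p.wmin ^ 2 / p.E * t)) := by
    apply Real.exp_le_exp.2
    rw [neg_le_neg_iff]
    have : p.wmin ^ 2 * t ≤ w ^ 2 * (t + p.D γA) :=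
      mul_le_mul (pow_le_pow_left₀ hwmin.le hw.1 2) (by linarith) ht.le (by positivity)
    calc p.βbar * p.wmin ^ 2 / p.E * t = p.βbar * (p.wmin ^ 2 * t / p.E) := by ring
      _ ≤ _ := by gcongr
  calc p.gainWeight γA k w u t = w ^ (2 * k + 3) * p.distRecWeight u / p.E ^ (k + 1) *
        ((t + p.D γA) ^ k * Real.exp (-(p.βbar * (w ^ 2 * (t + p.D γA) / p.E)))) := by
        unfold gainWeight; ring
    _ ≤ p.wmax ^ (2 * k + 3) * Q / p.E ^ (k + 1) *
        ((t + p.D γA) ^ k * Real.exp (-(p.βbar * p.wmin ^ 2 / p.E * t))) := by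
        have := p.wmax_pos
        gcongr
    _ ≤ p.wmax ^ (2 * k + 3) * Q / p.E ^ (k + 1) *
        (C * Real.exp (-(p.βbar * p.wmin ^ 2 / p.E / 2 * t))) := by
        have := p.wmax_pos
        exact mul_le_mul_of_nonneg_left (hC t ht.le) (by positivity)
    _ = _ := by ring

theorem integrable_gainWeight_mul (hγ : 0 < γA) (k : ℕ) {t₀ : ℝ} (ht₀ : 0 ≤ t₀)
    {S : ℝ × ℝ × ℝ → ℝ} (hS : Measurable S)
    (hS' : ∀ w ∈ Icc p.wmin p.wmax, ∀ u ∈ Icc p.h₁ (p.h₂ / Real.cos p.φ), ∀ t ∈ Ioi t₀,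
      |S (w, u, t)| ≤ 1) :
    Integrable (fun q => p.gainWeight γA k q.1 q.2.1 q.2.2 * S q) (p.region t₀) := by
  obtain ⟨C, c, hc, h⟩ := p.exists_gainWeight_le hγ k
  refine p.integrable_region_of_le ((measurable_gainWeight k).mul hS) hc
    (C := C) fun w hw u hu t ht => ?_
  have ht' : 0 < t := ht₀.trans_lt ht
  have h0 := gainWeight_nonneg hγ k hw hu ht'
  rw [abs_mul, abs_of_nonneg h0]
  exact (mul_le_of_le_one_right h0 (hS' w hw u hu t ht)).trans (h w hw u hu t ht')

/-- Put V = z u^(-ν) and Y = η_s x w^(-2) with x = w² (t + 𝒟) / ℰ. The numerator of the SNR is (t +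
𝒟) P_th V, and γ_A times the first term of the denominator is 𝒟 P_th V. After cancellation the SNR
condition is γ_A Y σ_t² < t P_th V, which forces t > 0 and is then a lower bound for z. Saturation
P_th < Y is t > 𝒫. This is the reason for shifting the gain by 𝒟. -/
theorem lt_snrPICSat_iff (hP : 0 < Pth) (hγ : 0 < γA) {w u z : ℝ} (hw : 0 < w)
    (hu : 0 < u) (hz : 0 ≤ z) (t : ℝ) :
    (γA < p.snrPICSat Pth (w ^ 2 * (t + p.D γA) / p.E) w z u ∧
      Pth < p.ηs * (w ^ 2 * (t + p.D γA) / p.E) * w ^ (-2 : ℝ)) ↔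
    max (p.PED Pth γA) 0 < t ∧ p.tailArg Pth γA u t / (1 + p.K) < z := by
  have hE := p.E_pos
  have hD := p.D_pos hγ
  have hη := p.ηs_pos
  have hK := p.K_nonneg
  have hK1 : 0 < 1 + p.K := by linarith
  have hσ := p.σt2_pos
  have hw2 : w ^ (-2 : ℝ) = (w ^ 2)⁻¹ := by
    rw [Real.rpow_neg hw.le, Real.rpow_two]
  have huν : 0 < u ^ p.ν := Real.rpow_pos_of_pos hu _
  set V := z * u ^ (-p.ν) with hV
  have hV' : V = z / u ^ p.ν := by rw [hV, Real.rpow_neg hu.le, div_eq_mul_inv]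
  have hV0 : 0 ≤ V := by rw [hV']; positivity
  set Y := p.ηs * (w ^ 2 * (t + p.D γA) / p.E) * w ^ (-2 : ℝ) with hYdef
  have hY : Y = p.ηs * (t + p.D γA) / p.E := by
    rw [hYdef, hw2]; field_simp
  have hsnr : p.snrPICSat Pth (w ^ 2 * (t + p.D γA) / p.E) w z u =
      ((t + p.D γA) * Pth * V) / (p.με * p.χρε * Pth * V + Y * p.σt2) := by
    unfold snrPICSat
    congr 1
    · calc _ = (p.χρε * (1 - p.μ)) * Pth * Y * V := by rw [hYdef, hV]; ring
        _ = _ := by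
          rw [hY]
          have : p.E = p.χρε * p.ηs * (1 - p.μ) := rfl
          field_simp
          rw [this]; ring
    · rw [hYdef, hV]; ring
  have hPED : Pth < Y ↔ p.PED Pth γA < t := by
    rw [hY, lt_div_iff₀ hE, PED, sub_lt_iff_lt_add, div_lt_iff₀ hη, mul_comm p.ηs]
  have hmain : ∀ (_ : 0 < t + p.D γA), (γA < p.snrPICSat Pth (w ^ 2 * (t + p.D γA) / p.E) w z u ↔
      0 < t ∧ p.tailArg Pth γA u t / (1 + p.K) < z) := by
    intro ht
    have hYpos : 0 < Y := by rw [hY]; positivity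
    have hden : 0 < p.με * p.χρε * Pth * V + Y * p.σt2 := by
      have := p.με_pos; have := p.χρε_pos; positivity
    rw [hsnr, lt_div_iff₀ hden]
    have hDe : γA * (p.με * p.χρε * Pth * V + Y * p.σt2) =
        p.D γA * Pth * V + γA * (Y * p.σt2) := by unfold D; ring
    have hpos : 0 < γA * (Y * p.σt2) := by positivity
    have h1 : γA * (p.με * p.χρε * Pth * V + Y * p.σt2) < (t + p.D γA) * Pth * V ↔
        γA * (Y * p.σt2) < t * (Pth * V) := by
      rw [hDe]; constructor <;> intro h <;> linarith
    rw [h1]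
    constructor
    · intro h
      have ht0 : 0 < t := by
        by_contra hcon
        have : t * (Pth * V) ≤ 0 :=
          mul_nonpos_of_nonpos_of_nonneg (not_lt.1 hcon) (by positivity)
        linarith
      refine ⟨ht0, ?_⟩
      rw [hY, hV'] at h
      rw [tailArg, θ, Θ]
      have e : p.ηs * ((1 + p.K) * p.σt2 * γA) / Pth * u ^ p.ν / p.E * (1 + p.D γA / t) /
          (1 + p.K) = (γA * (p.ηs * (t + p.D γA) / p.E * p.σt2)) * u ^ p.ν / (t * Pth) := by
        field_simp
      rw [e, div_lt_iff₀ (by positivity)]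
      have h2 : t * (Pth * (z / u ^ p.ν)) = t * Pth * z / u ^ p.ν := by ring
      rw [h2, lt_div_iff₀ huν] at h
      linarith
    · rintro ⟨ht0, h⟩
      rw [hY, hV']
      rw [tailArg, θ, Θ] at h
      have e : p.ηs * ((1 + p.K) * p.σt2 * γA) / Pth * u ^ p.ν / p.E * (1 + p.D γA / t) /
          (1 + p.K) = (γA * (p.ηs * (t + p.D γA) / p.E * p.σt2)) * u ^ p.ν / (t * Pth) := by
        field_simp
      rw [e, div_lt_iff₀ (by positivity)] at h
      have h2 : t * (Pth * (z / u ^ p.ν)) = t * Pth * z / u ^ p.ν := by ring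
      rw [h2, lt_div_iff₀ huν]
      linarith
  rw [max_lt_iff]
  constructor
  · rintro ⟨h1, h2⟩
    -- The denominator of the SNR has to be positive before it can be cleared. In this direction
    -- saturation ensures it, in the other one t > 0.
    have ht : 0 < t + p.D γA := by
      have h3 := hP.trans h2
      rw [hY, div_pos_iff_of_pos_right hE] at h3
      exact (pos_iff_pos_of_mul_pos h3).1 hη
    have h3 := (hmain ht).1 h1
    exact ⟨⟨hPED.1 h2, h3.1⟩, h3.2⟩
  · rintro ⟨⟨h1, h2⟩, h3⟩
    exact ⟨(hmain (by linarith)).2 ⟨h2, h3⟩, hPED.2 h1⟩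

theorem measurable_ricianPdf (p : Params) : Measurable p.ricianPdf := by
  unfold ricianPdf besselI0
  refine Measurable.ite measurableSet_Ici ?_ measurable_const
  refine Measurable.mul (by fun_prop) (Measurable.tsum fun j => by fun_prop)

theorem measurable_srPdf (p : Params) : Measurable p.srPdf := by
  unfold srPdf
  exact Measurable.ite measurableSet_Ici (by fun_prop) measurable_const

theorem srPdf_of_nonneg (p : Params) {x : ℝ} (hx : 0 ≤ x) : p.srPdf x =
    p.α * ∑ k ∈ Finset.range p.msr, p.ζ k * (x ^ k * Real.exp (-(p.βbar * x))) := by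
  rw [srPdf, if_pos hx]
  congr 1
  refine Finset.sum_congr rfl fun k _ => ?_
  rw [mul_assoc, neg_mul, βbar]

theorem srPdf_nonneg (p : Params) (x : ℝ) : 0 ≤ p.srPdf x := by
  by_cases hx : 0 ≤ x
  · rw [p.srPdf_of_nonneg hx]
    exact mul_nonneg p.α_pos.le (Finset.sum_nonneg fun k _ =>
      mul_nonneg (p.ζ_nonneg k) (by positivity))
  · rw [srPdf, if_neg hx]

theorem ae_ricianLaw_nonneg (p : Params) :
    ∀ᵐ z ∂(volume.withDensity fun x => ENNReal.ofReal (p.ricianPdf x)), 0 ≤ z := by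
  rw [ae_withDensity_iff p.measurable_ricianPdf.ennreal_ofReal]
  refine ae_of_all _ fun z hz => ?_
  by_contra h
  exact hz (by rw [ricianPdf, if_neg h, ENNReal.ofReal_zero])

/-- This is the conditional probability of the event given the distances and t. The equivalence
`lt_snrPICSat_iff` needs z ≥ 0, which holds almost everywhere for the Rician law. -/
theorem ricianLaw_event (hP : 0 < Pth) (hγ : 0 < γA) {w u : ℝ} (hw : 0 < w) (hu : 0 < u) (t : ℝ) :
    (volume.withDensity fun x => ENNReal.ofReal (p.ricianPdf x))
      {z | γA < p.snrPICSat Pth (w ^ 2 * (t + p.D γA) / p.E) w z u ∧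
        Pth < p.ηs * (w ^ 2 * (t + p.D γA) / p.E) * w ^ (-2 : ℝ)} =
    (Ioi (max (p.PED Pth γA) 0)).indicator
      (fun t => ENNReal.ofReal (ricianTail p.K (p.tailArg Pth γA u t))) t := by
  have hK := p.K_nonneg
  have hae : {z | γA < p.snrPICSat Pth (w ^ 2 * (t + p.D γA) / p.E) w z u ∧
        Pth < p.ηs * (w ^ 2 * (t + p.D γA) / p.E) * w ^ (-2 : ℝ)} =ᵐ[
      volume.withDensity fun x => ENNReal.ofReal (p.ricianPdf x)]
      {z | max (p.PED Pth γA) 0 < t ∧ p.tailArg Pth γA u t / (1 + p.K) < z} := by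
    filter_upwards [p.ae_ricianLaw_nonneg] with z hz
    exact propext (lt_snrPICSat_iff hP hγ hw hu hz t)
  rw [measure_congr hae]
  by_cases ht : max (p.PED Pth γA) 0 < t
  · rw [indicator_of_mem (mem_Ioi.2 ht)]
    have ht0 : 0 < t := (le_max_right _ _).trans_lt ht
    have ha := tailArg_pos (p := p) hP hγ hu ht0
    have hset : {z | max (p.PED Pth γA) 0 < t ∧ p.tailArg Pth γA u t / (1 + p.K) < z} =
        Ioi (p.tailArg Pth γA u t / (1 + p.K)) := by
      ext z; simp [ht]
    rw [hset, p.lintegral_ricianPdf (by positivity), mul_div_cancel₀ _ (by positivity)]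
  · rw [indicator_of_notMem (s := Ioi (max (p.PED Pth γA) 0)) (fun h => ht h)]
    simp [ht]

/-- The affine change of variables from the gain of the satellite link to its excess. -/
theorem lintegral_srPdf_mul (γA : ℝ) {w : ℝ} (hw : 0 < w) (g : ℝ → ENNReal) :
    ∫⁻ x, ENNReal.ofReal (p.srPdf x) * g x =
      ∫⁻ t, ENNReal.ofReal (w ^ 2 / p.E * p.srPdf (w ^ 2 * (t + p.D γA) / p.E)) *
        g (w ^ 2 * (t + p.D γA) / p.E) := by
  have hE := p.E_pos
  have hder : ∀ t ∈ univ, HasDerivWithinAt (fun t : ℝ => w ^ 2 * (t + p.D γA) / p.E)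
      (w ^ 2 / p.E) univ t := by
    intro t _
    have h := ((((hasDerivAt_id t).add_const (p.D γA)).const_mul (w ^ 2)).div_const
      p.E).hasDerivWithinAt (s := univ)
    simpa using h
  have hinj : InjOn (fun t : ℝ => w ^ 2 * (t + p.D γA) / p.E) univ := by
    intro a _ b _ hab
    have hab : w ^ 2 * (a + p.D γA) / p.E = w ^ 2 * (b + p.D γA) / p.E := hab
    rw [div_left_inj' hE.ne', mul_right_inj' (by positivity)] at hab
    linarith
  have himg : (fun t : ℝ => w ^ 2 * (t + p.D γA) / p.E) '' univ = univ := by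
    rw [image_univ]
    refine Function.Surjective.range_eq fun x => ⟨p.E * x / w ^ 2 - p.D γA, ?_⟩
    field_simp
    ring
  have h := lintegral_image_eq_lintegral_abs_deriv_mul MeasurableSet.univ hder hinj
    fun x => ENNReal.ofReal (p.srPdf x) * g x
  rw [himg, setLIntegral_univ, setLIntegral_univ] at h
  rw [h]
  refine lintegral_congr fun t => ?_
  rw [← mul_assoc, ← ENNReal.ofReal_mul (abs_nonneg _), abs_of_pos (by positivity)]

/-- The integrand of the representation of `𝒫₆` as a single triple integral. -/
def tripleIntegrand (p : Params) (Pth γA : ℝ) (q : ℝ × ℝ × ℝ) : ℝ :=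
  p.pref * p.ν * ∑ k ∈ Finset.range p.msr, p.ζ k *
    (p.gainWeight γA k q.1 q.2.1 q.2.2 * ricianTail p.K (p.tailArg Pth γA q.2.1 q.2.2))

theorem measurable_tripleIntegrand : Measurable (p.tripleIntegrand Pth γA) := by
  have h1 := measurable_ricianTail p.K
  have h2 : Measurable fun q : ℝ × ℝ × ℝ => p.tailArg Pth γA q.2.1 q.2.2 :=
    measurable_tailArg.comp measurable_snd
  unfold tripleIntegrand
  exact (Finset.measurable_sum _ fun k _ =>
    ((measurable_gainWeight k).mul (h1.comp h2)).const_mul _).const_mul _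

/-- The power w^(2k+3) collects w from the distance density, w² from the Jacobian and w^(2k) from
x^k. The factor ν in `tripleIntegrand` removes the 1/ν contained in `pref`. -/
theorem mul_densities_eq (hγ : 0 < γA) {w u t : ℝ} (ht : 0 < t) :
    w / (p.wer * p.wmin) * (6 / (Real.tan p.φ ^ 2 * (p.h₂ ^ 3 - p.h₁ ^ 3)) *
      p.distRecWeight u) * (w ^ 2 / p.E * p.srPdf (w ^ 2 * (t + p.D γA) / p.E)) *
      ricianTail p.K (p.tailArg Pth γA u t) = p.tripleIntegrand Pth γA (w, u, t) := by
  have hE := p.E_pos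
  have hD := p.D_pos hγ
  have hν := p.ν_pos
  have := p.wer_pos; have := p.wmin_pos; have := p.tan_φ_pos; have := p.h_cube_pos
  rw [p.srPdf_of_nonneg (by positivity), tripleIntegrand, pref]
  simp only [Finset.mul_sum, Finset.sum_mul]
  refine Finset.sum_congr rfl fun k _ => ?_
  simp only [gainWeight]
  rw [div_pow, mul_pow, ← pow_mul, pow_succ p.E k]
  field_simp
  ring

end Params

/-! ### The joint law, and P₆ as a triple integral -/

theorem map_joint {p : Params} {Ω : Type*} [MeasurableSpace Ω]
    {Pr : Measure Ω} [IsProbabilityMeasure Pr]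
    {gsr grt : Ω → ℂ} {S T : Ω → EuclideanSpace ℝ (Fin 3)}
    (hnet : IsNetwork p Pr gsr grt S T) :
    Pr.map (fun ω => ((‖gsr ω‖ ^ 2, ‖grt ω‖ ^ 2), (dist (S ω) p.posR, dist (T ω) p.posR))) =
      ((volume.withDensity fun x => ENNReal.ofReal (p.srPdf x)).prod
        (volume.withDensity fun x => ENNReal.ofReal (p.ricianPdf x))).prod
      ((volume.withDensity p.distSatDensity).prod (volume.withDensity p.distRecDensity)) := by
  have hX : Measurable fun ω => ‖gsr ω‖ ^ 2 := by have := hnet.measurable_gsr; fun_prop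
  have hZ : Measurable fun ω => ‖grt ω‖ ^ 2 := by have := hnet.measurable_grt; fun_prop
  have hW : Measurable fun ω => dist (S ω) p.posR := by have := hnet.measurable_S; fun_prop
  have hU : Measurable fun ω => dist (T ω) p.posR := by have := hnet.measurable_T; fun_prop
  have hm : ∀ i, Measurable ((![fun ω => ‖gsr ω‖ ^ 2, fun ω => ‖grt ω‖ ^ 2,
      fun ω => dist (S ω) p.posR, fun ω => dist (T ω) p.posR] : Fin 4 → Ω → ℝ) i) := by
    intro i
    fin_cases i
    · exact hX
    · exact hZ
    · exact hW
    · exact hU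
  have h := hnet.indep.indepFun_prodMk_prodMk hm 0 1 2 3 (by decide) (by decide) (by decide)
    (by decide)
  have h01 := hnet.indep.indepFun (i := 0) (j := 1) (by decide)
  have h23 := hnet.indep.indepFun (i := 2) (j := 3) (by decide)
  have e := (indepFun_iff_map_prod_eq_prod_map_map (hX.prodMk hZ).aemeasurable
    (hW.prodMk hU).aemeasurable).1 h
  have e01 := (indepFun_iff_map_prod_eq_prod_map_map hX.aemeasurable hZ.aemeasurable).1 h01
  have e23 := (indepFun_iff_map_prod_eq_prod_map_map hW.aemeasurable hU.aemeasurable).1 h23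
  refine e.trans ?_
  have lW : Pr.map (fun ω => dist (S ω) p.posR) = volume.withDensity p.distSatDensity := by
    rw [← p.map_dist_satelliteLaw, ← hnet.law_S, Measure.map_map (by fun_prop) hnet.measurable_S]
    rfl
  have lU : Pr.map (fun ω => dist (T ω) p.posR) = volume.withDensity p.distRecDensity := by
    rw [← p.map_dist_receiver, ← hnet.law_T, Measure.map_map (by fun_prop) hnet.measurable_T]
    rfl
  rw [e01, e23, hnet.law_gsr, hnet.law_grt, lW, lU]

end Osagin

namespace Osagin

open Params

variable {p : Params} {Pth γA : ℝ}

theorem measurable_distSatDensity (p : Params) : Measurable p.distSatDensity :=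
  Measurable.indicator (by fun_prop) measurableSet_Icc

theorem measurable_distRecDensity (p : Params) : Measurable p.distRecDensity := by
  have := p.continuous_distRecWeight.measurable
  exact Measurable.indicator (by fun_prop) measurableSet_Icc

/-- The event in the definition of `𝒫₆`, in terms of the gains and distances. -/
def successSet (p : Params) (Pth γA : ℝ) : Set ((ℝ × ℝ) × (ℝ × ℝ)) :=
  {q | γA < p.snrPICSat Pth q.1.1 q.2.1 q.1.2 q.2.2 ∧ Pth < p.ηs * q.1.1 * q.2.1 ^ (-2 : ℝ)}

theorem measurableSet_successSet : MeasurableSet (successSet p Pth γA) := by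
  have h1 : Measurable fun q : (ℝ × ℝ) × (ℝ × ℝ) =>
      p.snrPICSat Pth q.1.1 q.2.1 q.1.2 q.2.2 := by
    unfold snrPICSat; fun_prop
  have h2 : Measurable fun q : (ℝ × ℝ) × (ℝ × ℝ) => p.ηs * q.1.1 * q.2.1 ^ (-2 : ℝ) := by fun_prop
  exact (measurableSet_lt measurable_const h1).inter (measurableSet_lt measurable_const h2)

theorem lintegral_success_section (hP : 0 < Pth) (hγ : 0 < γA) {w u : ℝ} (hw : 0 < w)
    (hu : 0 < u) :
    ((volume.withDensity fun x => ENNReal.ofReal (p.srPdf x)).prod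
        (volume.withDensity fun x => ENNReal.ofReal (p.ricianPdf x)))
      ((fun x => (x, (w, u))) ⁻¹' successSet p Pth γA) =
    ∫⁻ t in Ioi (max (p.PED Pth γA) 0), ENNReal.ofReal (w ^ 2 / p.E *
      p.srPdf (w ^ 2 * (t + p.D γA) / p.E) * ricianTail p.K (p.tailArg Pth γA u t)) := by
  have hE := p.E_pos
  have hm : MeasurableSet ((fun x : ℝ × ℝ => (x, (w, u))) ⁻¹' successSet p Pth γA) :=
    measurable_prodMk_right measurableSet_successSet
  rw [Measure.prod_apply hm, lintegral_withDensity_eq_lintegral_mul _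
    p.measurable_srPdf.ennreal_ofReal (measurable_measure_prodMk_left hm)]
  refine (lintegral_srPdf_mul γA hw _).trans ?_
  rw [← lintegral_indicator measurableSet_Ioi]
  refine lintegral_congr fun t => ?_
  have h := ricianLaw_event (p := p) hP hγ hw hu t
  have h' : (volume.withDensity fun x => ENNReal.ofReal (p.ricianPdf x))
      (Prod.mk (w ^ 2 * (t + p.D γA) / p.E) ⁻¹'
        ((fun x : ℝ × ℝ => (x, (w, u))) ⁻¹' successSet p Pth γA)) = _ := h
  rw [h']
  by_cases ht : t ∈ Ioi (max (p.PED Pth γA) 0)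
  · rw [indicator_of_mem ht, indicator_of_mem ht, ← ENNReal.ofReal_mul]
    have := p.srPdf_nonneg (w ^ 2 * (t + p.D γA) / p.E)
    positivity
  · rw [indicator_of_notMem ht, indicator_of_notMem ht, mul_zero]

theorem tripleIntegrand_nonneg (hP : 0 < Pth) (hγ : 0 < γA) {w u t : ℝ}
    (hw : w ∈ Icc p.wmin p.wmax) (hu : u ∈ Icc p.h₁ (p.h₂ / Real.cos p.φ)) (ht : 0 < t) :
    0 ≤ p.tripleIntegrand Pth γA (w, u, t) := by
  have hν := p.ν_pos
  have h1 := p.wer_pos; have h2 := p.wmin_pos; have := p.tan_φ_pos; have := p.h_cube_pos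
  have := p.α_pos
  have hpref : 0 ≤ p.pref := by unfold pref; positivity
  refine mul_nonneg (by positivity) (Finset.sum_nonneg fun k _ => mul_nonneg (p.ζ_nonneg k)
    (mul_nonneg (gainWeight_nonneg hγ k hw hu ht) (ricianTail_nonneg p.K_nonneg ?_)))
  exact (tailArg_pos hP hγ (p.h₁_pos.trans_le hu.1) ht).le

/-- Tonelli for the product law: for fixed distances Z is integrated out by `ricianLaw_event` and X
is replaced by t. The lower limit max(𝒫, 0) unites saturation with the positivity of t that the SNR
condition forces; its two values are the two cases of the theorem. -/
theorem P6_eq_integral {Ω : Type*} [MeasurableSpace Ω]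
    {Pr : Measure Ω} [IsProbabilityMeasure Pr]
    {gsr grt : Ω → ℂ} {S T : Ω → EuclideanSpace ℝ (Fin 3)}
    (hnet : IsNetwork p Pr gsr grt S T) (hP : 0 < Pth) (hγ : 0 < γA) :
    P6 p Pr gsr grt S T Pth γA =
      ∫ q, p.tripleIntegrand Pth γA q ∂p.region (max (p.PED Pth γA) 0) := by
  set t₀ := max (p.PED Pth γA) 0 with ht₀
  have hjm : Measurable fun ω =>
      ((‖gsr ω‖ ^ 2, ‖grt ω‖ ^ 2), (dist (S ω) p.posR, dist (T ω) p.posR)) := by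
    have := hnet.measurable_gsr; have := hnet.measurable_grt
    have := hnet.measurable_S; have := hnet.measurable_T
    fun_prop
  have hSm : MeasurableSet (successSet p Pth γA) := measurableSet_successSet
  have hmeas : Measurable fun y : ℝ × ℝ =>
      ((volume.withDensity fun x => ENNReal.ofReal (p.srPdf x)).prod
        (volume.withDensity fun x => ENNReal.ofReal (p.ricianPdf x)))
      ((fun x => (x, y)) ⁻¹' successSet p Pth γA) := measurable_measure_prodMk_right hSm
  have hdW := measurable_distSatDensity p
  have hdU := measurable_distRecDensity p
  have hd : Measurable fun y : ℝ × ℝ => p.distSatDensity y.1 * p.distRecDensity y.2 :=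
    (hdW.comp measurable_fst).mul (hdU.comp measurable_snd)
  have key : Pr {ω |
      γA < p.snrPICSat Pth (‖gsr ω‖ ^ 2) (dist (S ω) p.posR) (‖grt ω‖ ^ 2) (dist (T ω) p.posR) ∧
      Pth < p.ηs * ‖gsr ω‖ ^ 2 * (dist (S ω) p.posR) ^ (-2 : ℝ)} =
      ∫⁻ q, ENNReal.ofReal (p.tripleIntegrand Pth γA q) ∂p.region t₀ := by
    calc _ = Pr.map (fun ω =>
          ((‖gsr ω‖ ^ 2, ‖grt ω‖ ^ 2), (dist (S ω) p.posR, dist (T ω) p.posR)))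
            (successSet p Pth γA) := (Measure.map_apply hjm hSm).symm
      _ = ∫⁻ w, ∫⁻ u, p.distSatDensity w * p.distRecDensity u *
          ((volume.withDensity fun x => ENNReal.ofReal (p.srPdf x)).prod
            (volume.withDensity fun x => ENNReal.ofReal (p.ricianPdf x)))
            ((fun x => (x, (w, u))) ⁻¹' successSet p Pth γA) := by
        rw [map_joint hnet, Measure.prod_apply_symm hSm, prod_withDensity hdW hdU,
          lintegral_withDensity_eq_lintegral_mul _ hd hmeas,
          lintegral_prod _ (hd.mul hmeas).aemeasurable]
        rfl
      _ = ∫⁻ w in Icc p.wmin p.wmax, ∫⁻ u in Icc p.h₁ (p.h₂ / Real.cos p.φ),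
          ∫⁻ t in Ioi t₀, ENNReal.ofReal (p.tripleIntegrand Pth γA (w, u, t)) := by
        rw [← lintegral_indicator measurableSet_Icc]
        refine lintegral_congr fun w => ?_
        by_cases hw : w ∈ Icc p.wmin p.wmax
        · rw [indicator_of_mem hw, ← lintegral_indicator measurableSet_Icc]
          refine lintegral_congr fun u => ?_
          by_cases hu : u ∈ Icc p.h₁ (p.h₂ / Real.cos p.φ)
          · have hw0 := p.wmin_pos.trans_le hw.1
            have hu0 := p.h₁_pos.trans_le hu.1
            have h1 := p.wer_pos; have h2 := p.wmin_pos
            have h3 := p.tan_φ_pos; have h4 := p.h_cube_pos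
            have h5 := p.distRecWeight_nonneg hu
            rw [indicator_of_mem hu, lintegral_success_section hP hγ hw0 hu0, distSatDensity,
              indicator_of_mem hw, distRecDensity, indicator_of_mem hu,
              ← ENNReal.ofReal_mul (by positivity), ← lintegral_const_mul' _ _ (by finiteness)]
            refine setLIntegral_congr_fun measurableSet_Ioi fun t ht => ?_
            have ht0 : 0 < t := (le_max_right _ _).trans_lt ht
            rw [← ENNReal.ofReal_mul (by positivity), ← mul_densities_eq hγ ht0,
              ← mul_assoc]
          · rw [indicator_of_notMem hu, distRecDensity, indicator_of_notMem hu, mul_zero, zero_mul]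
        · rw [indicator_of_notMem hw, distSatDensity, indicator_of_notMem hw]
          simp
      _ = _ := by
        have hm : Measurable fun q : ℝ × ℝ × ℝ =>
            ENNReal.ofReal (p.tripleIntegrand Pth γA q) :=
          measurable_tripleIntegrand.ennreal_ofReal
        rw [region, lintegral_prod _ hm.aemeasurable]
        refine lintegral_congr fun w => ?_
        exact (lintegral_prod _ (hm.comp measurable_prodMk_left).aemeasurable).symm
  rw [P6, Measure.real, key, ← integral_eq_lintegral_of_nonneg_ae ?_
    measurable_tripleIntegrand.aestronglyMeasurable]
  exact p.ae_region fun w hw u hu t ht =>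
    tripleIntegrand_nonneg hP hγ hw hu ((le_max_right _ _).trans_lt ht)

theorem integral_tripleIntegrand (hP : 0 < Pth) (hγ : 0 < γA) {t₀ : ℝ} (ht₀ : 0 ≤ t₀) :
    ∫ q, p.tripleIntegrand Pth γA q ∂p.region t₀ =
      p.pref * p.ν * ∑ k ∈ Finset.range p.msr, p.ζ k * ∫ q, p.gainWeight γA k q.1 q.2.1 q.2.2 *
        ricianTail p.K (p.tailArg Pth γA q.2.1 q.2.2) ∂p.region t₀ := by
  unfold tripleIntegrand
  rw [integral_const_mul, integral_finsetSum]
  · simp only [integral_const_mul]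
  · intro k _
    refine (integrable_gainWeight_mul hγ k ht₀ ((measurable_ricianTail p.K).comp
      (measurable_tailArg.comp measurable_snd)) fun w _ u hu t ht => ?_).const_mul _
    have h := (tailArg_pos (p := p) hP hγ (p.h₁_pos.trans_le hu.1) (ht₀.trans_lt ht)).le
    have h' : ((ricianTail p.K ∘ (fun q : ℝ × ℝ => p.tailArg Pth γA q.1 q.2) ∘ Prod.snd)
      (w, u, t)) = ricianTail p.K (p.tailArg Pth γA u t) := rfl
    rw [h', abs_of_nonneg (ricianTail_nonneg p.K_nonneg h)]
    exact ricianTail_le_one p.K_nonneg h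

end Osagin

namespace Osagin

/-! ### Expansion into series and interchange with the integral -/

theorem hasSum_congr_right {f : ℕ → ℝ} {a b : ℝ} (h : HasSum f a) (e : a = b) : HasSum f b :=
  e ▸ h

theorem norm_neg_one_pow_div_factorial_mul_pow_le {b C : ℝ} (h : |b| ≤ C) (j : ℕ) :
    ‖(-1) ^ j / (j.factorial : ℝ) * b ^ j‖ ≤ C ^ j / (j.factorial : ℝ) := by
  rw [norm_mul, norm_div, norm_pow, norm_neg, norm_one, one_pow, norm_pow, Real.norm_eq_abs,
    Real.norm_eq_abs, abs_of_nonneg (by positivity : (0 : ℝ) ≤ (j.factorial : ℝ)),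
    one_div_mul_eq_div]
  gcongr

theorem integrable_mul_pow_div_factorial {α : Type*} [MeasurableSpace α] {μ : Measure α}
    {g b : α → ℝ} {C : ℝ} (hg : Integrable g μ) (hb : Measurable b) (hC : ∀ᵐ x ∂μ, |b x| ≤ C)
    (j : ℕ) : Integrable (fun x => g x * ((-1) ^ j / (j.factorial : ℝ) * b x ^ j)) μ :=
  hg.mul_bdd (Measurable.aestronglyMeasurable (by fun_prop))
    (hC.mono fun _ hx => norm_neg_one_pow_div_factorial_mul_pow_le hx j)

/-- Boundedness of b is what matters: the term of order j has an integral of absolute values of at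
most C^j / j! times that of g, which is summable. Both series over k₂ are instances. -/
theorem hasSum_integral_mul_exp_neg {α : Type*} [MeasurableSpace α] {μ : Measure α}
    {g b : α → ℝ} {C : ℝ} (hg : Integrable g μ) (hb : Measurable b) (hC : ∀ᵐ x ∂μ, |b x| ≤ C) :
    HasSum (fun j : ℕ => ∫ x, g x * ((-1) ^ j / (j.factorial : ℝ) * b x ^ j) ∂μ)
      (∫ x, g x * Real.exp (-b x) ∂μ) := by
  have hint := integrable_mul_pow_div_factorial hg hb hC
  have h := hasSum_integral_of_summable_integral_norm hint ?_
  · refine hasSum_congr_right h ?_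
    refine integral_congr_ae (ae_of_all _ fun x => ?_)
    simp only
    rw [tsum_mul_left]
    congr 1
    have h1 := congrFun (NormedSpace.exp_eq_tsum_div (𝔸 := ℝ)) (-b x)
    rw [Real.exp_eq_exp_ℝ, h1]
    exact tsum_congr fun j => by rw [neg_pow (b x)]; ring
  · refine Summable.of_nonneg_of_le (fun j => integral_nonneg fun x => norm_nonneg _) (fun j => ?_)
      ((Real.summable_pow_div_factorial C).mul_right (∫ x, ‖g x‖ ∂μ))
    rw [← integral_const_mul]
    refine integral_mono_ae (hint j).norm (hg.norm.const_mul _) ?_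
    filter_upwards [hC] with x hx
    rw [norm_mul, mul_comm]
    exact mul_le_mul_of_nonneg_right (norm_neg_one_pow_div_factorial_mul_pow_le hx j)
      (norm_nonneg _)

namespace Params

/-- `θ u^ν / ℰ`, the value that `tailArg` approaches for large excess gain. -/
def rateArg (p : Params) (Pth γA u : ℝ) : ℝ := p.θ Pth γA * u ^ p.ν / p.E

/-- The part of order `k`, `n`, `k₁` of the integrand, without its exponential factor in `u`. -/
def partWeight (p : Params) (Pth γA : ℝ) (k n k₁ : ℕ) (w u t : ℝ) : ℝ :=
  w ^ (2 * k + 3) * p.distRecWeight u * (t ^ k₁ * p.D γA ^ (n + k - k₁) / t ^ n / p.E ^ (k + 1)) *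
    p.rateArg Pth γA u ^ n * Real.exp (-(p.βbar * (w ^ 2 * (t + p.D γA) / p.E)))

variable {p : Params} {Pth γA : ℝ}

/-- The first summand is bounded on the range of u, the second one only as long as t stays away from
0. This decides which exponential is expanded. -/
theorem tailArg_eq (u t : ℝ) : p.tailArg Pth γA u t =
    p.rateArg Pth γA u + p.rateArg Pth γA u * p.D γA / t := by
  rw [tailArg, rateArg]; ring

theorem measurable_rateArg : Measurable (p.rateArg Pth γA) := by
  unfold rateArg; fun_prop

theorem rateArg_pos (hP : 0 < Pth) (hγ : 0 < γA) {u : ℝ} (hu : 0 < u) : 0 < p.rateArg Pth γA u := by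
  have := p.θ_pos hP hγ; have := p.E_pos; have := Real.rpow_pos_of_pos hu p.ν
  unfold rateArg; positivity

theorem rateArg_le_rateArg (hP : 0 < Pth) (hγ : 0 < γA) {u v : ℝ} (hu : 0 < u) (h : u ≤ v) :
    p.rateArg Pth γA u ≤ p.rateArg Pth γA v := by
  have := p.θ_pos hP hγ; have := p.E_pos
  have := Real.rpow_le_rpow hu.le h p.ν_pos.le
  unfold rateArg; gcongr

theorem measurable_partWeight (k n k₁ : ℕ) :
    Measurable fun q : ℝ × ℝ × ℝ => p.partWeight Pth γA k n k₁ q.1 q.2.1 q.2.2 := by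
  have := p.continuous_distRecWeight.measurable
  have := measurable_rateArg (p := p) (Pth := Pth) (γA := γA)
  unfold partWeight
  fun_prop

/-- Binomial theorem for (t + 𝒟)^(n+k), where the power k comes from the density of the gain and the
power n from A = r (t + 𝒟) / t. -/
theorem sum_choose_mul_partWeight (k n : ℕ) (w u : ℝ) {t : ℝ} (ht : 0 < t) :
    ∑ k₁ ∈ Finset.range (n + k + 1), ((n + k).choose k₁ : ℝ) *
      p.partWeight Pth γA k n k₁ w u t =
      p.gainWeight γA k w u t * p.tailArg Pth γA u t ^ n := by
  have hA : p.tailArg Pth γA u t = p.rateArg Pth γA u * ((t + p.D γA) / t) := by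
    rw [tailArg_eq]; field_simp
  have h := add_pow t (p.D γA) (n + k)
  rw [pow_add] at h
  rw [gainWeight, hA, mul_pow, div_pow]
  have e : w ^ (2 * k + 3) * p.distRecWeight u * ((t + p.D γA) ^ k / p.E ^ (k + 1)) *
      Real.exp (-(p.βbar * (w ^ 2 * (t + p.D γA) / p.E))) *
      (p.rateArg Pth γA u ^ n * ((t + p.D γA) ^ n / t ^ n)) =
      w ^ (2 * k + 3) * p.distRecWeight u / p.E ^ (k + 1) / t ^ n *
      Real.exp (-(p.βbar * (w ^ 2 * (t + p.D γA) / p.E))) *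
      p.rateArg Pth γA u ^ n * ((t + p.D γA) ^ n * (t + p.D γA) ^ k) := by ring
  rw [e, h, Finset.mul_sum]
  refine Finset.sum_congr rfl fun k₁ _ => ?_
  rw [partWeight]
  ring

/-- As t^k₁ 𝒟^(n+k-k₁) ≤ (t + 𝒟)^(n+k), apart from the factor t^(-n) the weight is at most a
constant times `gainWeight` of order k + n. The factor h only has to compensate t^(-n): trivially
for t > t₀ > 0, or through e^(-s/t) near 0. -/
theorem integrable_partWeight_mul (hP : 0 < Pth) (hγ : 0 < γA) {k n k₁ : ℕ} (hk₁ : k₁ ≤ n + k)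
    {t₀ : ℝ} (ht₀ : 0 ≤ t₀) {h : ℝ × ℝ × ℝ → ℝ} (hm : Measurable h) {H : ℝ}
    (hH : ∀ w ∈ Icc p.wmin p.wmax, ∀ u ∈ Icc p.h₁ (p.h₂ / Real.cos p.φ), ∀ t ∈ Ioi t₀,
      |h (w, u, t)| / t ^ n ≤ H) :
    Integrable (fun q => p.partWeight Pth γA k n k₁ q.1 q.2.1 q.2.2 * h q) (p.region t₀) := by
  obtain ⟨C, c, hc, hC⟩ := p.exists_gainWeight_le hγ (k + n)
  have hE := p.E_pos
  have hD := p.D_pos hγ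
  have hwmin := p.wmin_pos
  set R := p.rateArg Pth γA (p.h₂ / Real.cos p.φ) with hR
  refine p.integrable_region_of_le ((measurable_partWeight k n k₁).mul hm) hc
    (C := C * ((p.E / p.wmin ^ 2) ^ n * R ^ n * H)) fun w hw u hu t ht => ?_
  have ht0 : 0 < t := ht₀.trans_lt ht
  have hw0 : 0 < w := hwmin.trans_le hw.1
  have hu0 : 0 < u := p.h₁_pos.trans_le hu.1
  have hq := p.distRecWeight_nonneg hu
  have hr := rateArg_pos (p := p) hP hγ hu0
  have hrR : p.rateArg Pth γA u ≤ R := rateArg_le_rateArg hP hγ hu0 hu.2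
  have hG := hC w hw u hu t ht0
  have hG0 := gainWeight_nonneg (p := p) hγ (k + n) hw hu ht0
  have hHt := hH w hw u hu t ht
  have hH0 : 0 ≤ H := (by positivity : 0 ≤ |h (w, u, t)| / t ^ n).trans hHt
  have h1 : t ^ k₁ * p.D γA ^ (n + k - k₁) ≤ (t + p.D γA) ^ (k + n) := by
    have e : (t + p.D γA) ^ (k + n) = (t + p.D γA) ^ k₁ * (t + p.D γA) ^ (n + k - k₁) := by
      rw [← pow_add]; congr 1; omega
    rw [e]
    gcongr <;> linarith
  have h2 : (p.E / w ^ 2) ^ n ≤ (p.E / p.wmin ^ 2) ^ n := by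
    have := hw.1
    gcongr
  have h0 : 0 ≤ p.partWeight Pth γA k n k₁ w u t := by unfold partWeight; positivity
  rw [abs_mul, abs_of_nonneg h0]
  calc p.partWeight Pth γA k n k₁ w u t * |h (w, u, t)|
      = w ^ (2 * k + 3) * p.distRecWeight u * (t ^ k₁ * p.D γA ^ (n + k - k₁) / p.E ^ (k + 1)) *
          p.rateArg Pth γA u ^ n * Real.exp (-(p.βbar * (w ^ 2 * (t + p.D γA) / p.E))) *
          (|h (w, u, t)| / t ^ n) := by unfold partWeight; ring
    _ ≤ w ^ (2 * k + 3) * p.distRecWeight u * ((t + p.D γA) ^ (k + n) / p.E ^ (k + 1)) *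
          R ^ n * Real.exp (-(p.βbar * (w ^ 2 * (t + p.D γA) / p.E))) * H := by
        have hR0 : 0 ≤ R := hr.le.trans hrR
        gcongr
    _ = p.gainWeight γA (k + n) w u t * ((p.E / w ^ 2) ^ n * R ^ n * H) := by
        unfold gainWeight
        rw [div_pow, show 2 * (k + n) + 3 = 2 * k + 3 + 2 * n by ring, pow_add w _ (2 * n),
          pow_mul w 2 n, show k + n + 1 = k + 1 + n by ring, pow_add p.E (k + 1)]
        field_simp
    _ ≤ C * Real.exp (-(c * t)) * ((p.E / p.wmin ^ 2) ^ n * R ^ n * H) := by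
        have hR0 : 0 ≤ R := hr.le.trans hrR
        gcongr
        exact hG0.trans hG
    _ = _ := by ring

theorem integrable_partWeight_exp_rate (hP : 0 < Pth) (hγ : 0 < γA) {k n k₁ : ℕ}
    (hk₁ : k₁ ≤ n + k) {t₀ : ℝ} (ht₀ : 0 < t₀) :
    Integrable (fun q => p.partWeight Pth γA k n k₁ q.1 q.2.1 q.2.2 *
      Real.exp (-p.rateArg Pth γA q.2.1)) (p.region t₀) := by
  have := measurable_rateArg (p := p) (Pth := Pth) (γA := γA)
  refine integrable_partWeight_mul hP hγ hk₁ ht₀.le (by fun_prop) (H := 1 / t₀ ^ n)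
    fun w hw u hu t ht => ?_
  have hr := rateArg_pos (p := p) hP hγ (p.h₁_pos.trans_le hu.1)
  have ht : t₀ < t := ht
  rw [abs_of_pos (Real.exp_pos _)]
  gcongr
  exact Real.exp_le_one_iff.2 (by linarith)

theorem integrable_partWeight_exp_div (hP : 0 < Pth) (hγ : 0 < γA) {k n k₁ : ℕ}
    (hk₁ : k₁ ≤ n + k) :
    Integrable (fun q => p.partWeight Pth γA k n k₁ q.1 q.2.1 q.2.2 *
      Real.exp (-(p.rateArg Pth γA q.2.1 * p.D γA / q.2.2))) (p.region 0) := by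
  have := measurable_rateArg (p := p) (Pth := Pth) (γA := γA)
  have hD := p.D_pos hγ
  -- The least value of r 𝒟, positive because h₁ > 0. With (s/t)^n / n! ≤ e^(s/t) it bounds
  -- e^(-r𝒟/t) / t^n uniformly down to t = 0.
  set s := p.rateArg Pth γA p.h₁ * p.D γA with hs
  have hs0 : 0 < s := mul_pos (rateArg_pos hP hγ p.h₁_pos) hD
  refine integrable_partWeight_mul hP hγ hk₁ le_rfl (by fun_prop)
    (H := (n.factorial : ℝ) / s ^ n) fun w hw u hu t ht => ?_
  have ht : 0 < t := ht
  have hr : s ≤ p.rateArg Pth γA u * p.D γA :=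
    mul_le_mul_of_nonneg_right (rateArg_le_rateArg hP hγ p.h₁_pos hu.1) hD.le
  have h1 := Real.pow_div_factorial_le_exp (s / t) (by positivity) n
  rw [abs_of_pos (Real.exp_pos _)]
  calc _ ≤ Real.exp (-(s / t)) / t ^ n := by gcongr
    _ ≤ _ := by
      rw [Real.exp_neg, div_le_div_iff₀ (by positivity) (by positivity),
        inv_mul_le_iff₀ (Real.exp_pos _)]
      rw [div_pow, div_div, div_le_iff₀ (by positivity)] at h1
      linarith

theorem ae_abs_rateArg_le (hP : 0 < Pth) (hγ : 0 < γA) (t₀ : ℝ) :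
    ∀ᵐ q ∂p.region t₀, |p.rateArg Pth γA q.2.1| ≤ p.rateArg Pth γA (p.h₂ / Real.cos p.φ) :=
  p.ae_region fun w hw u hu t ht => by
    have hu0 := p.h₁_pos.trans_le hu.1
    simp only
    rw [abs_of_pos (rateArg_pos hP hγ hu0)]
    exact rateArg_le_rateArg hP hγ hu0 hu.2

theorem ae_abs_rateArg_div_le (hP : 0 < Pth) (hγ : 0 < γA) {t₀ : ℝ} (ht₀ : 0 < t₀) :
    ∀ᵐ q ∂p.region t₀, |p.rateArg Pth γA q.2.1 * p.D γA / q.2.2| ≤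
      p.rateArg Pth γA (p.h₂ / Real.cos p.φ) * p.D γA / t₀ :=
  p.ae_region fun w hw u hu t ht => by
    have hD := p.D_pos hγ
    have hu0 := p.h₁_pos.trans_le hu.1
    have hr := rateArg_pos (p := p) hP hγ hu0
    have hr' := rateArg_le_rateArg (p := p) hP hγ hu0 hu.2
    have ht : t₀ < t := ht
    have ht' := ht₀.trans ht
    simp only
    rw [abs_of_nonneg (by positivity)]
    have := hr.le.trans hr'
    gcongr

/-- The series of integrals obtained from the expansion of the exponential of the second part of
`tailArg`. -/
theorem hasSum_expand_div (hP : 0 < Pth) (hγ : 0 < γA) {k n k₁ : ℕ} (hk₁ : k₁ ≤ n + k) {t₀ : ℝ}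
    (ht₀ : 0 < t₀) :
    HasSum (fun k₂ : ℕ => ∫ q, p.partWeight Pth γA k n k₁ q.1 q.2.1 q.2.2 *
      Real.exp (-p.rateArg Pth γA q.2.1) * ((-1) ^ k₂ / (k₂.factorial : ℝ) *
        (p.rateArg Pth γA q.2.1 * p.D γA / q.2.2) ^ k₂) ∂p.region t₀)
      (∫ q, p.partWeight Pth γA k n k₁ q.1 q.2.1 q.2.2 *
        Real.exp (-p.tailArg Pth γA q.2.1 q.2.2) ∂p.region t₀) := by
  have hm := measurable_rateArg (p := p) (Pth := Pth) (γA := γA)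
  refine hasSum_congr_right (hasSum_integral_mul_exp_neg
    (integrable_partWeight_exp_rate hP hγ hk₁ ht₀)
    (b := fun q : ℝ × ℝ × ℝ => p.rateArg Pth γA q.2.1 * p.D γA / q.2.2)
    (by fun_prop) (ae_abs_rateArg_div_le hP hγ ht₀))
    (integral_congr_ae (ae_of_all _ fun q => ?_))
  simp only
  rw [tailArg_eq, neg_add, Real.exp_add, mul_assoc]

/-- The series of integrals obtained from the expansion of the exponential of the first part of
`tailArg`. -/
theorem hasSum_expand_rate (hP : 0 < Pth) (hγ : 0 < γA) {k n k₁ : ℕ} (hk₁ : k₁ ≤ n + k) :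
    HasSum (fun k₂ : ℕ => ∫ q, p.partWeight Pth γA k n k₁ q.1 q.2.1 q.2.2 *
      Real.exp (-(p.rateArg Pth γA q.2.1 * p.D γA / q.2.2)) * ((-1) ^ k₂ / (k₂.factorial : ℝ) *
        p.rateArg Pth γA q.2.1 ^ k₂) ∂p.region 0)
      (∫ q, p.partWeight Pth γA k n k₁ q.1 q.2.1 q.2.2 *
        Real.exp (-p.tailArg Pth γA q.2.1 q.2.2) ∂p.region 0) := by
  have hm := measurable_rateArg (p := p) (Pth := Pth) (γA := γA)
  refine hasSum_congr_right (hasSum_integral_mul_exp_neg (integrable_partWeight_exp_div hP hγ hk₁)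
    (b := fun q : ℝ × ℝ × ℝ => p.rateArg Pth γA q.2.1)
    (by fun_prop) (ae_abs_rateArg_le hP hγ 0)) (integral_congr_ae (ae_of_all _ fun q => ?_))
  simp only
  rw [tailArg_eq, neg_add_rev, Real.exp_add, mul_assoc]

theorem integrable_partWeight_exp_tailArg (hP : 0 < Pth) (hγ : 0 < γA) {k n k₁ : ℕ}
    (hk₁ : k₁ ≤ n + k) {t₀ : ℝ} (ht₀ : 0 ≤ t₀) :
    Integrable (fun q => p.partWeight Pth γA k n k₁ q.1 q.2.1 q.2.2 *
      Real.exp (-p.tailArg Pth γA q.2.1 q.2.2)) (p.region t₀) := by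
  have hm := measurable_rateArg (p := p) (Pth := Pth) (γA := γA)
  have h0 : p.region t₀ ≤ p.region 0 := by
    rw [region_eq, region_eq]
    exact Measure.restrict_mono
      (prod_mono le_rfl (prod_mono le_rfl (Ioi_subset_Ioi ht₀))) le_rfl
  refine Integrable.mono_measure ?_ h0
  refine ((integrable_partWeight_exp_div (p := p) hP hγ hk₁).mul_bdd (c := 1)
    (g := fun q => Real.exp (-p.rateArg Pth γA q.2.1))
    (Measurable.aestronglyMeasurable (by fun_prop))
    (p.ae_region fun w hw u hu t ht => ?_)).congr (ae_of_all _ fun q => ?_)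
  · rw [Real.norm_of_nonneg (Real.exp_nonneg _)]
    exact Real.exp_le_one_iff.2
      (by linarith [rateArg_pos (p := p) hP hγ (p.h₁_pos.trans_le hu.1)])
  · simp only
    rw [tailArg_eq, neg_add_rev, Real.exp_add, mul_assoc]

/-- The finite sums are recollected: k₁ gives A^n by the binomial theorem, n gives the Poisson
distribution function at A. In this form the general term of the series over m is easy to bound. -/
theorem integral_gainWeight_mul_poissonCdf (hP : 0 < Pth) (hγ : 0 < γA) (k m : ℕ) {t₀ : ℝ}
    (ht₀ : 0 ≤ t₀) :
    ∑ n ∈ Finset.range (m + 1),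
      p.K ^ m * Real.exp (-p.K) / ((m.factorial : ℝ) * (n.factorial : ℝ)) *
        ∑ k₁ ∈ Finset.range (n + k + 1), ((n + k).choose k₁ : ℝ) *
          (p.ν * ∫ q, p.partWeight Pth γA k n k₁ q.1 q.2.1 q.2.2 *
            Real.exp (-p.tailArg Pth γA q.2.1 q.2.2) ∂p.region t₀) =
      p.ν * ∫ q, p.gainWeight γA k q.1 q.2.1 q.2.2 *
        (p.K ^ m * Real.exp (-p.K) / (m.factorial : ℝ) *
          poissonCdf m (p.tailArg Pth γA q.2.1 q.2.2)) ∂p.region t₀ := by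
  have hint : ∀ n, ∀ k₁ ∈ Finset.range (n + k + 1), Integrable (fun q : ℝ × ℝ × ℝ =>
      ((n + k).choose k₁ : ℝ) * (p.partWeight Pth γA k n k₁ q.1 q.2.1 q.2.2 *
            Real.exp (-p.tailArg Pth γA q.2.1 q.2.2))) (p.region t₀) := fun n k₁ hk₁ =>
    (integrable_partWeight_exp_tailArg hP hγ
      (Nat.lt_succ_iff.1 (Finset.mem_range.1 hk₁)) ht₀).const_mul _
  have h1 : ∀ n, ∑ k₁ ∈ Finset.range (n + k + 1), ((n + k).choose k₁ : ℝ) *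
          (p.ν * ∫ q, p.partWeight Pth γA k n k₁ q.1 q.2.1 q.2.2 *
            Real.exp (-p.tailArg Pth γA q.2.1 q.2.2) ∂p.region t₀) =
      p.ν * ∫ q, ∑ k₁ ∈ Finset.range (n + k + 1), ((n + k).choose k₁ : ℝ) *
        (p.partWeight Pth γA k n k₁ q.1 q.2.1 q.2.2 *
            Real.exp (-p.tailArg Pth γA q.2.1 q.2.2)) ∂p.region t₀ := by
    intro n
    rw [integral_finsetSum _ (hint n), Finset.mul_sum]
    refine Finset.sum_congr rfl fun k₁ _ => ?_
    rw [integral_const_mul]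
    ring
  simp only [h1]
  have h2 : ∀ n, p.K ^ m * Real.exp (-p.K) / ((m.factorial : ℝ) * (n.factorial : ℝ)) *
      (p.ν * ∫ q, ∑ k₁ ∈ Finset.range (n + k + 1), ((n + k).choose k₁ : ℝ) *
        (p.partWeight Pth γA k n k₁ q.1 q.2.1 q.2.2 *
            Real.exp (-p.tailArg Pth γA q.2.1 q.2.2)) ∂p.region t₀) =
      p.ν * ∫ q, p.K ^ m * Real.exp (-p.K) / ((m.factorial : ℝ) * (n.factorial : ℝ)) *
        ∑ k₁ ∈ Finset.range (n + k + 1), ((n + k).choose k₁ : ℝ) *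
        (p.partWeight Pth γA k n k₁ q.1 q.2.1 q.2.2 *
            Real.exp (-p.tailArg Pth γA q.2.1 q.2.2)) ∂p.region t₀ := by
    intro n
    rw [integral_const_mul]
    ring
  simp only [h2]
  rw [← Finset.mul_sum, ← integral_finsetSum _ fun n _ =>
    (integrable_finsetSum _ (hint n)).const_mul _]
  congr 1
  refine integral_congr_ae (p.ae_region fun w hw u hu t ht => ?_)
  have ht0 : 0 < t := ht₀.trans_lt ht
  simp only
  rw [poissonCdf, Finset.sum_mul, Finset.mul_sum, Finset.mul_sum]
  refine Finset.sum_congr rfl fun n _ => ?_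
  simp only [← mul_assoc (((n + k).choose _ : ℕ) : ℝ)]
  rw [← Finset.sum_mul, sum_choose_mul_partWeight k n w u ht0]
  have := Nat.factorial_ne_zero n
  have := Nat.factorial_ne_zero m
  field_simp

/-- Distribution functions are at most 1, so the Poisson weights K^m e^(-K) / m! times the integral
of `gainWeight` dominate. -/
theorem hasSum_gainWeight_mul_poissonCdf (hP : 0 < Pth) (hγ : 0 < γA) (k : ℕ) {t₀ : ℝ}
    (ht₀ : 0 ≤ t₀) :
    HasSum (fun m : ℕ => p.ν * ∫ q, p.gainWeight γA k q.1 q.2.1 q.2.2 *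
        (p.K ^ m * Real.exp (-p.K) / (m.factorial : ℝ) *
          poissonCdf m (p.tailArg Pth γA q.2.1 q.2.2)) ∂p.region t₀)
      (p.ν * ∫ q, p.gainWeight γA k q.1 q.2.1 q.2.2 *
        ricianTail p.K (p.tailArg Pth γA q.2.1 q.2.2) ∂p.region t₀) := by
  have hK := p.K_nonneg
  have hA : ∀ u ∈ Icc p.h₁ (p.h₂ / Real.cos p.φ), ∀ t ∈ Ioi t₀, 0 ≤ p.tailArg Pth γA u t :=
    fun u hu t ht => (tailArg_pos hP hγ (p.h₁_pos.trans_le hu.1) (ht₀.trans_lt ht)).le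
  have hmA : Measurable fun q : ℝ × ℝ × ℝ => p.tailArg Pth γA q.2.1 q.2.2 :=
    measurable_tailArg.comp measurable_snd
  have hbase : ∀ m : ℕ, Integrable (fun q : ℝ × ℝ × ℝ => p.gainWeight γA k q.1 q.2.1 q.2.2 *
      poissonCdf m (p.tailArg Pth γA q.2.1 q.2.2)) (p.region t₀) := fun m =>
    integrable_gainWeight_mul hγ k ht₀ ((continuous_poissonCdf m).measurable.comp hmA)
      fun w _ u hu t ht => by
        rw [abs_of_nonneg (poissonCdf_nonneg m (hA u hu t ht))]
        exact poissonCdf_le_one m (hA u hu t ht)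
  have hone : Integrable (fun q : ℝ × ℝ × ℝ => p.gainWeight γA k q.1 q.2.1 q.2.2)
      (p.region t₀) := by
    simpa using integrable_gainWeight_mul (p := p) hγ k ht₀ (S := fun _ => 1) measurable_const
      (fun _ _ _ _ _ _ => by simp)
  have hint : ∀ m : ℕ, Integrable (fun q : ℝ × ℝ × ℝ => p.gainWeight γA k q.1 q.2.1 q.2.2 *
        (p.K ^ m * Real.exp (-p.K) / (m.factorial : ℝ) *
          poissonCdf m (p.tailArg Pth γA q.2.1 q.2.2))) (p.region t₀) := fun m =>
    ((hbase m).const_mul (p.K ^ m * Real.exp (-p.K) / (m.factorial : ℝ))).congr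
      (ae_of_all _ fun q => by ring)
  refine HasSum.mul_left _ ?_
  refine hasSum_congr_right (hasSum_integral_of_summable_integral_norm hint ?_) ?_
  · refine Summable.of_nonneg_of_le (fun m => integral_nonneg fun q => norm_nonneg _) (fun m => ?_)
      ((summable_poisson p.K).mul_right (∫ q, p.gainWeight γA k q.1 q.2.1 q.2.2 ∂p.region t₀))
    rw [← integral_const_mul]
    refine integral_mono_ae (hint m).norm (hone.const_mul _) (p.ae_region fun w hw u hu t ht => ?_)
    have h0 := gainWeight_nonneg (p := p) hγ k hw hu (ht₀.trans_lt ht)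
    have h1 := poissonCdf_nonneg m (hA u hu t ht)
    have h2 := poissonCdf_le_one m (hA u hu t ht)
    simp only
    rw [Real.norm_of_nonneg (by positivity), mul_comm]
    exact mul_le_mul_of_nonneg_right (mul_le_of_le_one_right (by positivity) h2) h0
  · refine integral_congr_ae (ae_of_all _ fun q => ?_)
    simp only
    rw [tsum_mul_left, ricianTail]

end Params

/-! ### Incomplete Gamma and Whittaker functions; the terms of Ψ̄₂ -/

/-- With positive reals written as exponentials, an identity between products of real powers becomes
an identity of exponents, which is left to `ring`. -/
theorem exists_exp_eq {x : ℝ} (hx : 0 < x) : ∃ y, x = Real.exp y := ⟨_, (Real.exp_log hx).symm⟩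

theorem deltaGamma_eq_integral {a b c : ℝ} (ha : 0 < a) (hb : 0 ≤ b) (hbc : b ≤ c) :
    deltaGamma a b c = ∫ t in b..c, t ^ (a - 1) * Real.exp (-t) := by
  refine intervalIntegral.integral_Ioi_sub_Ioi ?_ hbc
  refine ((Real.GammaIntegral_convergent ha).mono_set (Ioi_subset_Ioi hb)).congr_fun
    (fun x _ => mul_comm _ _) measurableSet_Ioi

/-- Incomplete Gamma functions from integrals of powers against `exp (-κ u^ν)`. -/
theorem integral_pow_mul_rpow_exp {κ ν x y : ℝ} (hκ : 0 < κ) (hν : 0 < ν) (hx : 0 < x)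
    (hxy : x ≤ y) (r s : ℕ) :
    ν * ∫ u in x..y, u ^ s * ((κ * u ^ ν) ^ r * Real.exp (-(κ * u ^ ν))) =
      κ ^ (-((s : ℝ) + 1) / ν) *
        deltaGamma (r + ((s : ℝ) + 1) / ν) (κ * x ^ ν) (κ * y ^ ν) := by
  have hle : κ * x ^ ν ≤ κ * y ^ ν :=
    mul_le_mul_of_nonneg_left (Real.rpow_le_rpow hx.le hxy hν.le) hκ.le
  have hx' : 0 < κ * x ^ ν := mul_pos hκ (Real.rpow_pos_of_pos hx _)
  rw [deltaGamma_eq_integral (by positivity) hx'.le hle]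
  have hpos : ∀ u ∈ uIcc x y, 0 < u := fun u hu => by
    rw [uIcc_of_le hxy] at hu
    exact hx.trans_le hu.1
  have h := intervalIntegral.integral_comp_mul_deriv' (a := x) (b := y)
    (f := fun u => κ * u ^ ν) (f' := fun u => κ * (ν * u ^ (ν - 1)))
    (g := fun t => t ^ (r + ((s : ℝ) + 1) / ν - 1) * Real.exp (-t)) ?_ ?_ ?_
  · rw [← h, ← intervalIntegral.integral_const_mul, ← intervalIntegral.integral_const_mul]
    refine intervalIntegral.integral_congr fun u hu => ?_
    obtain ⟨l, hl⟩ := exists_exp_eq (hpos u hu)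
    obtain ⟨m, hm⟩ := exists_exp_eq hκ
    simp only [Function.comp]
    have key : u ^ s * (κ * u ^ ν) ^ r = κ ^ (-((s : ℝ) + 1) / ν) *
        ((κ * u ^ ν) ^ (r + ((s : ℝ) + 1) / ν - 1) * (κ * u ^ (ν - 1))) := by
      rw [hl, hm]
      simp only [← Real.exp_mul, ← Real.exp_add, ← Real.exp_nat_mul]
      congr 1
      field_simp
      ring
    calc _ = ν * (u ^ s * (κ * u ^ ν) ^ r) * Real.exp (-(κ * u ^ ν)) := by ring
      _ = _ := by rw [key]; ring
  · intro u hu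
    exact (Real.hasDerivAt_rpow_const (Or.inl (hpos u hu).ne')).const_mul κ
  · exact continuousOn_const.mul (continuousOn_const.mul
      (continuousOn_id.rpow_const fun u hu => Or.inl (hpos u hu).ne'))
  · rintro _ ⟨u, hu, rfl⟩
    have : 0 < κ * u ^ ν := mul_pos hκ (Real.rpow_pos_of_pos (hpos u hu) _)
    exact ((Real.continuousAt_rpow_const _ _ (Or.inl this.ne')).mul
      (by fun_prop)).continuousWithinAt

/-- The substitution t = P (1 + τ) turns the left side into the integral for U(1, 2 - q, cP). -/
theorem integral_Ioi_rpow_mul_exp_eq_whittakerW {P c : ℝ} (hP : 0 < P) (hc : 0 < c) (q : ℝ) :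
    ∫ t in Ioi P, t ^ (-q) * Real.exp (-(c * t)) =
      P ^ (1 - q) * Real.exp (-(c * P) / 2) * (c * P) ^ (q / 2 - 1) *
        whittakerW (-q / 2) ((q - 1) / 2) (c * P) := by
  have hz : 0 < c * P := mul_pos hc hP
  have himg : (fun τ : ℝ => P * τ + P) '' Ioi 0 = Ioi P := by
    ext t
    simp only [mem_image, mem_Ioi]
    constructor
    · rintro ⟨τ, hτ, rfl⟩
      have := mul_pos hP hτ
      linarith
    · intro ht
      exact ⟨(t - P) / P, div_pos (by linarith) hP, by field_simp; ring⟩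
  have hder : ∀ τ ∈ Ioi (0 : ℝ), HasDerivWithinAt (fun τ : ℝ => P * τ + P) P (Ioi 0) τ := by
    intro τ _
    have h := (((hasDerivAt_id τ).const_mul P).add_const P).hasDerivWithinAt (s := Ioi 0)
    simpa using h
  have hinj : InjOn (fun τ : ℝ => P * τ + P) (Ioi 0) := by
    intro a _ b _ hab
    have hab : P * a + P = P * b + P := hab
    exact mul_left_cancel₀ hP.ne' (by linarith)
  have hW : whittakerW (-q / 2) ((q - 1) / 2) (c * P) =
      Real.exp (-(c * P) / 2) * (c * P) ^ (1 - q / 2) *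
        ∫ t in Ioi (0 : ℝ), Real.exp (-(c * P) * t) * (1 + t) ^ (-q) := by
    -- For these indices 1/2 - μ - κ = 1 whatever q is, so `whittakerW` takes μ' = -μ. Then U has
    -- first parameter 1 and its integral converges for every real q.
    have h1 : (0 : ℝ) < 1 / 2 - (q - 1) / 2 - -q / 2 := by ring_nf; norm_num
    rw [whittakerW]
    simp only [if_pos h1]
    rw [tricomiU, show 1 / 2 + -((q - 1) / 2) - -q / 2 = 1 by ring, Real.Gamma_one, inv_one,
      one_mul, show -((q - 1) / 2) + 1 / 2 = 1 - q / 2 by ring,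
      show 1 + 2 * -((q - 1) / 2) - 1 - 1 = -q by ring]
    simp only [sub_self, Real.rpow_zero, mul_one]
  rw [hW, ← himg, integral_image_eq_integral_abs_deriv_smul measurableSet_Ioi hder hinj]
  have hfac : P ^ (1 - q) * Real.exp (-(c * P) / 2) * (c * P) ^ (q / 2 - 1) *
      (Real.exp (-(c * P) / 2) * (c * P) ^ (1 - q / 2) *
        ∫ t in Ioi (0 : ℝ), Real.exp (-(c * P) * t) * (1 + t) ^ (-q)) =
      P ^ (1 - q) * Real.exp (-(c * P)) *
        ∫ t in Ioi (0 : ℝ), Real.exp (-(c * P) * t) * (1 + t) ^ (-q) := by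
    have h1 : (c * P) ^ (q / 2 - 1) * (c * P) ^ (1 - q / 2) = 1 := by
      rw [← Real.rpow_add hz]; simp
    have h2 : Real.exp (-(c * P)) = Real.exp (-(c * P) / 2) * Real.exp (-(c * P) / 2) := by
      rw [← Real.exp_add]; ring_nf
    rw [h2]
    linear_combination (P ^ (1 - q) * Real.exp (-(c * P) / 2) * Real.exp (-(c * P) / 2) *
      ∫ t in Ioi (0 : ℝ), Real.exp (-(c * P) * t) * (1 + t) ^ (-q)) * h1
  rw [hfac, ← integral_const_mul]
  refine setIntegral_congr_fun measurableSet_Ioi fun τ hτ => ?_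
  have hτ : 0 < τ := hτ
  simp only [smul_eq_mul, abs_of_pos hP]
  rw [show P * τ + P = P * (1 + τ) by ring, Real.mul_rpow hP.le (by positivity),
    show 1 - q = 1 + -q by ring, Real.rpow_add hP, Real.rpow_one,
    show -(c * (P * (1 + τ))) = -(c * P) + -(c * P) * τ by ring, Real.exp_add]
  ring

namespace Params

variable {p : Params} {Pth γA : ℝ}

theorem rateArg_eq (u : ℝ) : p.rateArg Pth γA u = p.θ Pth γA / p.E * u ^ p.ν := by
  rw [rateArg]; ring

theorem continuousOn_rateArg : ContinuousOn (p.rateArg Pth γA)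
    (Icc p.h₁ (p.h₂ / Real.cos p.φ)) := by
  unfold rateArg
  exact (continuousOn_const.mul (continuousOn_id.rpow_const fun u hu =>
    Or.inl (p.h₁_pos.trans_le hu.1).ne')).div_const _

/-- The four ranges of `integral_distRecWeight_mul`, each treated by the substitution of r = θ u^ν /
ℰ for u. A factor u² leads to the parameter shift 3/ν, a factor u to 2/ν. -/
theorem gammaBracket_eq_integral (hP : 0 < Pth) (hγ : 0 < γA) (r : ℕ) :
    (p.θ Pth γA / p.E) ^ (-2 / p.ν) * p.gammaBracket Pth γA r =
      p.ν * ∫ u in Icc p.h₁ (p.h₂ / Real.cos p.φ),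
        p.distRecWeight u * (p.rateArg Pth γA u ^ r * Real.exp (-p.rateArg Pth γA u)) := by
  have hκ : 0 < p.θ Pth γA / p.E := div_pos (p.θ_pos hP hγ) p.E_pos
  have hν := p.ν_pos
  have hc := p.cos_φ_pos
  have h1 := p.h₁_pos
  have h2 := p.h₂_pos
  have hcont := continuousOn_rateArg (p := p) (Pth := Pth) (γA := γA)
  rw [integral_Icc_eq_integral_Ioc, ← intervalIntegral.integral_of_le p.h₁_lt_top.le,
    p.integral_distRecWeight_mul (f := fun u => p.rateArg Pth γA u ^ r *
      Real.exp (-p.rateArg Pth γA u)) ((hcont.pow r).mul hcont.neg.rexp)]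
  have i2 := fun {x y : ℝ} (hx : 0 < x) (hxy : x ≤ y) =>
    integral_pow_mul_rpow_exp hκ hν hx hxy r 2
  have i1 := fun {x y : ℝ} (hx : 0 < x) (hxy : x ≤ y) =>
    integral_pow_mul_rpow_exp hκ hν hx hxy r 1
  have hs : (p.θ Pth γA / p.E) ^ (-(((2 : ℕ) : ℝ) + 1) / p.ν) =
      (p.θ Pth γA / p.E) ^ (-2 / p.ν) * (p.θ Pth γA / p.E) ^ (-1 / p.ν) := by
    rw [← Real.rpow_add hκ]
    congr 1
    push_cast
    ring
  have hs1 : -(((1 : ℕ) : ℝ) + 1) / p.ν = -2 / p.ν := by norm_num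
  have hs3 : (((2 : ℕ) : ℝ) + 1) / p.ν = 3 / p.ν := by norm_num
  have hs2 : (((1 : ℕ) : ℝ) + 1) / p.ν = 2 / p.ν := by norm_num
  simp only [hs, hs3] at i2
  simp only [hs1, hs2, pow_one] at i1
  simp only [rateArg_eq]
  have hdist : ∀ a b c d e f : ℝ, p.ν * (a - e * b + f * c - d) =
      p.ν * a - e * (p.ν * b) + f * (p.ν * c) - p.ν * d := by intros; ring
  rw [hdist, mul_left_comm p.ν (Real.cos p.φ), i2 h1 p.h₁_lt_h₂.le, i1 h1 (p.lt_div_cos h1).le,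
    i1 h2 (p.lt_div_cos h2).le, i2 (by positivity) p.div_cos_lt_div_cos.le, gammaBracket]
  simp only [mul_div_right_comm]
  ring

theorem psi2_factor_eq {w β E P D : ℝ} (hw : 0 < w) (hβ : 0 < β) (hE : 0 < E) (hP : 0 < P)
    (hD : 0 < D) (k : ℕ) (j q : ℝ) :
    w ^ (2 * k + 3) * D ^ j / E ^ (k + 1) * (P ^ (1 - q) * (β * w ^ 2 / E * P) ^ (q / 2 - 1)) =
      β ^ (q / 2 - 1) * P ^ (-q / 2) * (D ^ j / E ^ (k + q / 2)) * w ^ (2 * k + q + 1) := by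
  obtain ⟨lw, rfl⟩ := exists_exp_eq hw
  obtain ⟨lβ, rfl⟩ := exists_exp_eq hβ
  obtain ⟨lE, rfl⟩ := exists_exp_eq hE
  obtain ⟨lP, rfl⟩ := exists_exp_eq hP
  obtain ⟨lD, rfl⟩ := exists_exp_eq hD
  simp only [← Real.exp_nat_mul, ← Real.exp_add, ← Real.exp_sub, ← Real.exp_mul]
  congr 1
  push_cast
  ring

/-- Once e^(-r𝒟/t) is expanded, for fixed w the integrand is a product of a function of u and a
function of t. The former integrates to Q, the latter to a Whittaker function, and the integral over
w that remains is 𝕀₁. -/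
theorem psi2Term_eq (hP : 0 < Pth) (hγ : 0 < γA) (hPED : 0 < p.PED Pth γA) {k n k₁ : ℕ}
    (hk₁ : k₁ ≤ n + k) (k₂ : ℕ) :
    p.psi2Term Pth γA k n k₁ k₂ =
      p.ν * ∫ q, p.partWeight Pth γA k n k₁ q.1 q.2.1 q.2.2 *
        Real.exp (-p.rateArg Pth γA q.2.1) * ((-1) ^ k₂ / (k₂.factorial : ℝ) *
          (p.rateArg Pth γA q.2.1 * p.D γA / q.2.2) ^ k₂) ∂p.region (p.PED Pth γA) := by
  have hE := p.E_pos
  have hD := p.D_pos hγ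
  have hβ := p.βbar_pos
  have hm := measurable_rateArg (p := p) (Pth := Pth) (γA := γA)
  have hint := integrable_mul_pow_div_factorial
    (integrable_partWeight_exp_rate (p := p) hP hγ hk₁ hPED)
    (b := fun q : ℝ × ℝ × ℝ => p.rateArg Pth γA q.2.1 * p.D γA / q.2.2) (by fun_prop)
    (ae_abs_rateArg_div_le hP hγ hPED) k₂
  set P := p.PED Pth γA with hPdef
  -- The total exponents of 𝒟 (here j) and of 1/t (here x). The second may be negative, hence real
  -- powers.
  set j : ℝ := (k : ℝ) + n - k₁ + k₂ with hj
  set x : ℝ := (n : ℝ) - k₁ + k₂ with hx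
  set W : ℝ → ℝ := fun w => whittakerW (-x / 2) ((x - 1) / 2) (p.βbar * w ^ 2 / p.E * P) with hW
  set J := ∫ u in Icc p.h₁ (p.h₂ / Real.cos p.φ), p.distRecWeight u *
    (p.rateArg Pth γA u ^ (n + k₂) * Real.exp (-p.rateArg Pth γA u)) with hJ
  have hinner : ∀ w ∈ Icc p.wmin p.wmax,
      ∫ q : ℝ × ℝ, p.partWeight Pth γA k n k₁ w q.1 q.2 *
        Real.exp (-p.rateArg Pth γA q.1) * ((-1) ^ k₂ / (k₂.factorial : ℝ) *
          (p.rateArg Pth γA q.1 * p.D γA / q.2) ^ k₂)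
          ∂((volume.restrict (Icc p.h₁ (p.h₂ / Real.cos p.φ))).prod (volume.restrict (Ioi P))) =
      (-1) ^ k₂ / (k₂.factorial : ℝ) * J * (p.βbar ^ (x / 2 - 1) * P ^ (-x / 2) *
        (p.D γA ^ j / p.E ^ (k + x / 2))) * (w ^ (2 * k + x + 1) *
          Real.exp (-(p.βbar * w ^ 2 / p.E) * (p.D γA + P / 2)) * W w) := by
    intro w hw
    have hw0 := p.wmin_pos.trans_le hw.1
    have hc : 0 < p.βbar * w ^ 2 / p.E := by positivity
    have hsplit : ∀ q ∈ Icc p.h₁ (p.h₂ / Real.cos p.φ) ×ˢ Ioi P,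
        p.partWeight Pth γA k n k₁ w q.1 q.2 *
        Real.exp (-p.rateArg Pth γA q.1) * ((-1) ^ k₂ / (k₂.factorial : ℝ) *
          (p.rateArg Pth γA q.1 * p.D γA / q.2) ^ k₂) =
        (p.distRecWeight q.1 * (p.rateArg Pth γA q.1 ^ (n + k₂) *
          Real.exp (-p.rateArg Pth γA q.1))) * ((-1) ^ k₂ / (k₂.factorial : ℝ) *
          (w ^ (2 * k + 3) * p.D γA ^ j / p.E ^ (k + 1)) *
          Real.exp (-(p.βbar * w ^ 2 / p.E * p.D γA)) *
          (q.2 ^ (-x) * Real.exp (-(p.βbar * w ^ 2 / p.E * q.2)))) := by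
      rintro ⟨u, t⟩ ⟨_, ht⟩
      have ht0 : 0 < t := hPED.trans ht
      have hDj : p.D γA ^ j = p.D γA ^ (n + k - k₁) * p.D γA ^ k₂ := by
        rw [← pow_add, ← Real.rpow_natCast]
        congr 1
        push_cast [Nat.cast_sub hk₁]
        rw [hj]; ring
      have htx : t ^ (-x) = t ^ k₁ / t ^ n / t ^ k₂ := by
        rw [hx, neg_add, neg_sub, Real.rpow_add ht0, Real.rpow_sub ht0, Real.rpow_neg ht0.le,
          Real.rpow_natCast, Real.rpow_natCast, Real.rpow_natCast]
        rfl
      have he : Real.exp (-(p.βbar * (w ^ 2 * (t + p.D γA) / p.E))) =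
          Real.exp (-(p.βbar * w ^ 2 / p.E * p.D γA)) *
            Real.exp (-(p.βbar * w ^ 2 / p.E * t)) := by
        rw [← Real.exp_add]; congr 1; ring
      simp only [partWeight]
      rw [hDj, htx, he, div_pow, mul_pow, pow_add (p.rateArg Pth γA u)]
      ring
    rw [Measure.prod_restrict, setIntegral_congr_fun (measurableSet_Icc.prod measurableSet_Ioi)
      hsplit, ← Measure.prod_restrict, integral_prod_mul (fun u => p.distRecWeight u *
        (p.rateArg Pth γA u ^ (n + k₂) * Real.exp (-p.rateArg Pth γA u))) (fun t =>
          (-1) ^ k₂ / (k₂.factorial : ℝ) *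
          (w ^ (2 * k + 3) * p.D γA ^ j / p.E ^ (k + 1)) *
          Real.exp (-(p.βbar * w ^ 2 / p.E * p.D γA)) *
          (t ^ (-x) * Real.exp (-(p.βbar * w ^ 2 / p.E * t)))), integral_const_mul,
      integral_Ioi_rpow_mul_exp_eq_whittakerW hPED hc]
    have hf := psi2_factor_eq hw0 hβ hE hPED hD k j x
    have he : Real.exp (-(p.βbar * w ^ 2 / p.E) * (p.D γA + P / 2)) =
        Real.exp (-(p.βbar * w ^ 2 / p.E * p.D γA)) *
          Real.exp (-(p.βbar * w ^ 2 / p.E * P) / 2) := by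
      rw [← Real.exp_add]; congr 1; ring
    rw [he]
    linear_combination (J * ((-1) ^ k₂ / (k₂.factorial : ℝ)) *
      Real.exp (-(p.βbar * w ^ 2 / p.E * p.D γA)) *
        Real.exp (-(p.βbar * w ^ 2 / p.E * P) / 2) * W w) * hf
  have hR : ∫ q, p.partWeight Pth γA k n k₁ q.1 q.2.1 q.2.2 *
        Real.exp (-p.rateArg Pth γA q.2.1) * ((-1) ^ k₂ / (k₂.factorial : ℝ) *
          (p.rateArg Pth γA q.2.1 * p.D γA / q.2.2) ^ k₂) ∂p.region P =
      ∫ w in Icc p.wmin p.wmax, (-1) ^ k₂ / (k₂.factorial : ℝ) * J *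
        (p.βbar ^ (x / 2 - 1) * P ^ (-x / 2) *
        (p.D γA ^ j / p.E ^ (k + x / 2))) * (w ^ (2 * k + x + 1) *
          Real.exp (-(p.βbar * w ^ 2 / p.E) * (p.D γA + P / 2)) * W w) := by
    rw [region, integral_prod _ hint]
    exact setIntegral_congr_fun measurableSet_Icc hinner
  have hI₁ : p.I₁ Pth γA k n k₁ k₂ = ∫ w in Icc p.wmin p.wmax, w ^ (2 * k + x + 1) *
          Real.exp (-(p.βbar * w ^ 2 / p.E) * (p.D γA + P / 2)) * W w := by
    rw [I₁, intervalIntegral.integral_of_le p.wmin_lt_wmax.le, integral_Icc_eq_integral_Ioc]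
    refine integral_congr_ae (ae_of_all _ fun w => ?_)
    simp only [hW, ← hPdef]
    congr 2
    · congr 2
      rw [hx]; ring
    · rw [hx]; ring
    · ring
  have hb := gammaBracket_eq_integral (p := p) hP hγ (n + k₂)
  rw [← hJ] at hb
  push_cast at hb
  rw [hR, integral_const_mul, ← hI₁, psi2Term, ← hPdef,
    show (-(n : ℝ) + k₁ - k₂) / 2 = -x / 2 by rw [hx]; ring]
  linear_combination ((-1) ^ k₂ / (k₂.factorial : ℝ) * (p.βbar ^ (x / 2 - 1) * P ^ (-x / 2) *
        (p.D γA ^ j / p.E ^ (k + x / 2))) * p.I₁ Pth γA k n k₁ k₂) * hb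

end Params

/-! ### Mellin transforms; the Meijer function as an integral of a Bessel function -/

theorem hasMellin_congr {f g : ℝ → ℂ} {s m : ℂ} (h : HasMellin f s m)
    (hfg : ∀ x, 0 < x → f x = g x) : HasMellin g s m := by
  have e : EqOn (fun t : ℝ => (t : ℂ) ^ (s - 1) • f t) (fun t : ℝ => (t : ℂ) ^ (s - 1) • g t)
      (Ioi 0) := fun x hx => by simp only [hfg x hx]
  refine ⟨h.1.congr_fun e measurableSet_Ioi, ?_⟩
  rw [← h.2]
  exact (setIntegral_congr_fun measurableSet_Ioi e).symm

/-- The Mellin transform of a multiplicative convolution. -/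
theorem hasMellin_mulConvolution {f g : ℝ → ℂ} (hf : Measurable f) (hg : Measurable g) {s mf mg : ℂ}
    (hfm : HasMellin f (1 - s) mf) (hgm : HasMellin g s mg) :
    HasMellin (fun x => ∫ y in Ioi (0 : ℝ), f y * g (y * x)) s (mf * mg) := by
  have hmeas : AEStronglyMeasurable
      (fun q : ℝ × ℝ => (q.2 : ℂ) ^ (s - 1) * (f q.1 * g (q.1 * q.2)))
      ((volume.restrict (Ioi 0)).prod (volume.restrict (Ioi 0))) := by
    refine Measurable.aestronglyMeasurable ?_
    fun_prop
  have hgint : IntegrableOn (fun x : ℝ => ‖(x : ℂ) ^ (s - 1) • g x‖) (Ioi 0) := hgm.1.norm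
  -- Scaling x by y factors the norm integral into |y^(-s) f(y)| and a constant. This gives absolute
  -- integrability on the quadrant, hence Fubini.
  have hscale : ∀ y : ℝ, 0 < y → ∫ x in Ioi (0 : ℝ), ‖(x : ℂ) ^ (s - 1) * (f y * g (y * x))‖ =
      ‖(y : ℂ) ^ (1 - s - 1) • f y‖ * ∫ x in Ioi (0 : ℝ), ‖(x : ℂ) ^ (s - 1) • g x‖ := by
    intro y hy
    have h := integral_comp_mul_left_Ioi (fun x : ℝ => ‖(x : ℂ) ^ (s - 1) • g x‖) 0 hy
    rw [mul_zero] at h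
    have e : ∀ x ∈ Ioi (0 : ℝ), ‖(x : ℂ) ^ (s - 1) * (f y * g (y * x))‖ =
        ‖f y‖ * y ^ (1 - s.re) * ‖((y * x : ℝ) : ℂ) ^ (s - 1) • g (y * x)‖ := by
      intro x hx
      have hx : 0 < x := hx
      rw [norm_smul, norm_mul, norm_mul, Complex.norm_cpow_eq_rpow_re_of_pos hx,
        Complex.norm_cpow_eq_rpow_re_of_pos (mul_pos hy hx), Real.mul_rpow hy.le hx.le]
      have : y ^ (1 - s.re) * y ^ (s - 1).re = 1 := by
        rw [← Real.rpow_add hy]; simp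
      linear_combination (-(x ^ (s - 1).re * ‖f y‖ * ‖g (y * x)‖)) * this
    rw [setIntegral_congr_fun measurableSet_Ioi e, integral_const_mul, h, norm_smul,
      Complex.norm_cpow_eq_rpow_re_of_pos hy, smul_eq_mul]
    have : y ^ (1 - s.re) * y⁻¹ = y ^ (1 - s - 1).re := by
      rw [← Real.rpow_neg_one, ← Real.rpow_add hy]; congr 1
    rw [← this]
    ring
  have hint : Integrable (fun q : ℝ × ℝ => (q.2 : ℂ) ^ (s - 1) * (f q.1 * g (q.1 * q.2)))
      ((volume.restrict (Ioi 0)).prod (volume.restrict (Ioi 0))) := by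
    rw [integrable_prod_iff hmeas]
    constructor
    · filter_upwards [ae_restrict_mem measurableSet_Ioi] with y hy
      have h := (MellinConvergent.comp_mul_left (f := g) (s := s) hy).2 hgm.1
      refine (Integrable.const_mul h (f y)).congr (ae_of_all _ fun x => ?_)
      simp only [smul_eq_mul]
      ring
    · refine Integrable.congr (Integrable.mul_const (hfm.1.norm)
        (∫ x in Ioi (0 : ℝ), ‖(x : ℂ) ^ (s - 1) • g x‖)) ?_
      filter_upwards [ae_restrict_mem measurableSet_Ioi] with y hy
      exact (hscale y hy).symm
  constructor
  · refine (hint.integral_prod_right).congr (ae_of_all _ fun x => ?_)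
    simp only [smul_eq_mul]
    rw [integral_const_mul]
  · have e1 : mellin (fun x => ∫ y in Ioi (0 : ℝ), f y * g (y * x)) s =
        ∫ x in Ioi (0 : ℝ), ∫ y in Ioi (0 : ℝ), (x : ℂ) ^ (s - 1) * (f y * g (y * x)) := by
      refine integral_congr_ae (ae_of_all _ fun x => ?_)
      simp only [smul_eq_mul]
      rw [integral_const_mul]
    rw [e1, ← integral_integral_swap (f := fun (y x : ℝ) => (x : ℂ) ^ (s - 1) *
      (f y * g (y * x))) hint, ← hfm.2, ← hgm.2, mellin.eq_1 f, ← integral_mul_const]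
    refine setIntegral_congr_fun measurableSet_Ioi fun y hy => ?_
    have h := mellin_comp_mul_left g s hy
    have e2 : ∫ x in Ioi (0 : ℝ), (x : ℂ) ^ (s - 1) * (f y * g (y * x)) =
        f y * mellin (fun x => g (y * x)) s := by
      rw [mellin, ← integral_const_mul]
      refine integral_congr_ae (ae_of_all _ fun x => ?_)
      simp only [smul_eq_mul]
      ring
    rw [show (∫ x in Ioi (0 : ℝ), (x : ℂ) ^ (s - 1) * (f y * g (y * x))) = _ from e2, h,
      smul_eq_mul, smul_eq_mul, show 1 - s - 1 = -s by ring]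
    ring

theorem hasMellin_exp_neg {s : ℂ} (hs : 0 < s.re) :
    HasMellin (fun x : ℝ => (Real.exp (-x) : ℂ)) s (Complex.Gamma s) := by
  constructor
  · refine (Complex.GammaIntegral_convergent hs).congr_fun (fun x _ => ?_) measurableSet_Ioi
    simp only [smul_eq_mul]
    rw [mul_comm]
  · rw [Complex.Gamma_eq_integral hs, Complex.GammaIntegral_eq_mellin]

theorem hasMellin_cpow_smul {f : ℝ → ℂ} {s a m : ℂ} (h : HasMellin f (s + a) m) :
    HasMellin (fun t : ℝ => (t : ℂ) ^ a • f t) s m :=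
  ⟨MellinConvergent.cpow_smul.2 h.1, by rw [mellin_cpow_smul, h.2]⟩

theorem hasMellin_comp_inv {f : ℝ → ℂ} {s m : ℂ} (h : HasMellin f (-s) m) :
    HasMellin (fun t : ℝ => f t⁻¹) s m := by
  constructor
  · have h1 := (MellinConvergent.comp_rpow (f := f) (s := s) (a := -1) (by norm_num)).2 (by
      simpa [div_neg] using h.1)
    simpa only [Real.rpow_neg_one] using h1
  · rw [mellin_comp_inv, h.2]

/-- `2 K_{2b}(2 √v)` with the Bessel function `K`; this is `G^{2,0}_{0,2}[v | b, -b]`. -/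
def besselKernel (b v : ℝ) : ℝ :=
  v ^ b * ∫ y in Ioi (0 : ℝ), y ^ (2 * b - 1) * Real.exp (-y⁻¹) * Real.exp (-(y * v))

theorem measurable_besselKernel (b : ℝ) : Measurable (besselKernel b) := by
  unfold besselKernel
  refine (measurable_id.pow_const b).mul ?_
  exact (StronglyMeasurable.integral_prod_right' (f := fun q : ℝ × ℝ =>
    q.2 ^ (2 * b - 1) * Real.exp (-q.2⁻¹) * Real.exp (-(q.2 * q.1)))
    (Measurable.stronglyMeasurable (by fun_prop))).measurable

/-- The kernel is v^b times the multiplicative convolution of y^(2b-1) e^(-1/y) and e^(-x).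
Evaluated at 1 - (s + b) and s + b, their Mellin transforms are Γ(s - b) and Γ(s + b); both converge
for |b| < Re s. -/
theorem hasMellin_besselKernel {b : ℝ} {s : ℂ} (hs : |b| < s.re) :
    HasMellin (fun v => (besselKernel b v : ℂ)) s
      (Complex.Gamma (s - b) * Complex.Gamma (s + b)) := by
  have hb := abs_lt.1 hs
  have hf : HasMellin (fun y : ℝ => (y : ℂ) ^ (2 * b - 1 : ℂ) • (Real.exp (-y⁻¹) : ℂ))
      (1 - (s + b)) (Complex.Gamma (s - b)) := by
    refine hasMellin_cpow_smul (hasMellin_comp_inv (f := fun x : ℝ => (Real.exp (-x) : ℂ)) ?_)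
    rw [show -(1 - (s + b) + (2 * b - 1)) = s - b by ring]
    exact hasMellin_exp_neg (by simp; linarith)
  have hg : HasMellin (fun x : ℝ => (Real.exp (-x) : ℂ)) (s + b) (Complex.Gamma (s + b)) :=
    hasMellin_exp_neg (by simp; linarith)
  have h := hasMellin_cpow_smul (s := s) (a := b)
    (hasMellin_mulConvolution (by fun_prop) (by fun_prop) hf hg)
  refine hasMellin_congr h fun v hv => ?_
  rw [besselKernel, Complex.ofReal_mul, Complex.ofReal_cpow hv.le, smul_eq_mul,
    ← integral_complex_ofReal]
  congr 1
  refine setIntegral_congr_fun measurableSet_Ioi fun y hy => ?_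
  have hy : 0 < y := hy
  simp only [smul_eq_mul]
  push_cast
  rw [Complex.ofReal_cpow hy.le]
  push_cast
  ring

/-- `∫₀¹ τ^(κ - 1) 2 K_{2b}(2 √(τ x)) dτ`. -/
def integratedKernel (κ b x : ℝ) : ℝ :=
  ∫ τ in Ioc (0 : ℝ) 1, τ ^ (κ - 1) * besselKernel b (τ * x)

/-- A further convolution, with τ^(κ-1) on (0, 1], whose Mellin transform at 1 - s is 1 / (κ - s);
convergence at τ = 0 needs Re s < κ. -/
theorem hasMellin_integratedKernel {κ b : ℝ} {s : ℂ} (hs : |b| < s.re) (hκ : s.re < κ) :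
    HasMellin (fun x => (integratedKernel κ b x : ℂ)) s
      (1 / (κ - s) * (Complex.Gamma (s - b) * Complex.Gamma (s + b))) := by
  have hf : HasMellin (indicator (Ioc 0 1) (fun t : ℝ => (t : ℂ) ^ (κ - 1 : ℂ))) (1 - s)
      (1 / (κ - s)) := by
    have h := hasMellin_cpow_Ioc (κ - 1 : ℂ) (s := 1 - s) (by simp; linarith)
    rwa [show 1 - s + (κ - 1 : ℂ) = κ - s by ring] at h
  have hbm := measurable_besselKernel b
  refine hasMellin_congr (hasMellin_mulConvolution (Measurable.indicator (by fun_prop)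
    measurableSet_Ioc) (by fun_prop) hf (hasMellin_besselKernel hs)) fun x _ => ?_
  rw [integratedKernel, ← integral_complex_ofReal]
  have e : (fun y : ℝ => (Ioc (0 : ℝ) 1).indicator (fun t : ℝ => (t : ℂ) ^ (κ - 1 : ℂ)) y *
      (besselKernel b (y * x) : ℂ)) = (Ioc (0 : ℝ) 1).indicator (fun y : ℝ =>
        (y : ℂ) ^ (κ - 1 : ℂ) * (besselKernel b (y * x) : ℂ)) := by
    ext y
    rw [indicator_mul_left]
  have hI : Ioi (0 : ℝ) ∩ Ioc 0 1 = Ioc 0 1 := inter_eq_right.2 fun y hy => hy.1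
  rw [e, setIntegral_indicator measurableSet_Ioc, hI]
  refine setIntegral_congr_fun measurableSet_Ioc fun y hy => ?_
  push_cast
  rw [Complex.ofReal_cpow hy.1.le]
  push_cast
  rfl

theorem norm_Gamma_le {s : ℂ} (hs : 0 < s.re) : ‖Complex.Gamma s‖ ≤ Real.Gamma s.re := by
  rw [Complex.Gamma_eq_integral hs, Complex.GammaIntegral, Real.Gamma_eq_integral hs]
  refine (norm_integral_le_integral_norm _).trans (le_of_eq ?_)
  refine setIntegral_congr_fun measurableSet_Ioi fun x hx => ?_
  rw [norm_mul, Complex.norm_cpow_eq_rpow_re_of_pos hx, Complex.norm_real, Real.norm_eq_abs,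
    Real.abs_exp]
  simp

/-- Quadratic decay of the Gamma function on vertical lines. -/
theorem norm_Gamma_mul_normSq_le {s : ℂ} (hs : 0 < s.re) :
    ‖Complex.Gamma s‖ * (s.re ^ 2 + s.im ^ 2) ≤ Real.Gamma (s.re + 2) := by
  have h0 : s ≠ 0 := fun h => by simp [h] at hs
  have h1 : s + 1 ≠ 0 := fun h => by
    have : (s + 1).re = 0 := by rw [h]; simp
    simp at this
    linarith
  have e : Complex.Gamma (s + 2) = (s + 1) * (s * Complex.Gamma s) := by
    rw [← Complex.Gamma_add_one s h0, ← Complex.Gamma_add_one (s + 1) h1]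
    congr 1; ring
  have hle : ‖Complex.Gamma (s + 2)‖ ≤ Real.Gamma (s.re + 2) := by
    have := norm_Gamma_le (s := s + 2) (by simp; linarith)
    simpa using this
  rw [e, norm_mul, norm_mul] at hle
  have hn : s.re ^ 2 + s.im ^ 2 = ‖s‖ * ‖s‖ := by
    rw [← sq, Complex.sq_norm, Complex.normSq_apply]; ring
  have h2 : ‖s‖ ≤ ‖s + 1‖ := by
    rw [← sq_le_sq₀ (norm_nonneg _) (norm_nonneg _), Complex.sq_norm, Complex.sq_norm,
      Complex.normSq_apply, Complex.normSq_apply]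
    simp
    nlinarith
  rw [hn]
  refine le_trans ?_ hle
  calc _ = ‖s‖ * (‖s‖ * ‖Complex.Gamma s‖) := by ring
    _ ≤ _ := by gcongr

theorem continuous_Gamma_vertical {a : ℝ} (ha : 0 < a) :
    Continuous fun t : ℝ => Complex.Gamma (a + t * Complex.I) := by
  rw [continuous_iff_continuousAt]
  intro t
  have hd : DifferentiableAt ℂ Complex.Gamma (a + t * Complex.I) := by
    refine Complex.differentiableAt_Gamma _ fun m h => ?_
    have h2 := congrArg Complex.re h
    simp at h2
    have : (0 : ℝ) ≤ m := m.cast_nonneg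
    linarith
  exact ContinuousAt.comp (f := fun t : ℝ => (a + t * Complex.I : ℂ)) hd.continuousAt
    (by fun_prop)

/-- Needed for Mellin inversion. Quadratic decay of one Gamma factor suffices, since the other one
and 1 / (κ - s) are bounded on the line. -/
theorem verticalIntegrable_gamma_mul {κ b σ : ℝ} (hσ : |b| < σ) (hκ : σ < κ) :
    Complex.VerticalIntegrable
      (fun s => 1 / (κ - s) * (Complex.Gamma (s - b) * Complex.Gamma (s + b))) σ := by
  have hb := abs_lt.1 hσ
  have h1 : 0 < σ - b := by linarith
  have h2 : 0 < σ + b := by linarith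
  have hc : Continuous fun t : ℝ => 1 / ((κ : ℂ) - (σ + t * Complex.I)) *
      (Complex.Gamma (σ + t * Complex.I - b) * Complex.Gamma (σ + t * Complex.I + b)) := by
    refine Continuous.mul (Continuous.div continuous_const (by fun_prop) fun t h => ?_)
      (Continuous.mul ?_ ?_)
    · have := congrArg Complex.re h
      simp at this
      linarith
    · convert continuous_Gamma_vertical h1 using 3
      push_cast; ring
    · convert continuous_Gamma_vertical h2 using 3
      push_cast; ring
  -- Chosen so that A (1 + t²) ≤ (σ - b)² + t², which makes 1 / (1 + t²) the majorant.
  set A := min ((σ - b) ^ 2) 1 with hA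
  have hA0 : 0 < A := lt_min (by positivity) one_pos
  refine ((integrable_inv_one_add_sq.const_mul (1 / (κ - σ) * (Real.Gamma (σ - b + 2) / A *
    Real.Gamma (σ + b)))).mono' hc.aestronglyMeasurable (ae_of_all _ fun t => ?_))
  rw [norm_mul, norm_mul, norm_div, norm_one]
  have e1 : κ - σ ≤ ‖(κ : ℂ) - (σ + t * Complex.I)‖ := by
    have := Complex.abs_re_le_norm ((κ : ℂ) - (σ + t * Complex.I))
    simp at this
    exact (le_abs_self _).trans this
  have e2 : ‖Complex.Gamma (σ + t * Complex.I - b)‖ ≤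
      Real.Gamma (σ - b + 2) / A * (1 + t ^ 2)⁻¹ := by
    have h := norm_Gamma_mul_normSq_le (s := σ + t * Complex.I - b) (by simp; linarith)
    simp only [Complex.sub_re, Complex.add_re, Complex.ofReal_re, Complex.mul_re, Complex.I_re,
      mul_zero, Complex.ofReal_im, Complex.I_im, mul_one, sub_self, add_zero, Complex.sub_im,
      Complex.add_im, Complex.mul_im, zero_add, sub_zero] at h
    have h3 : A * (1 + t ^ 2) ≤ (σ - b) ^ 2 + t ^ 2 := by
      have := min_le_left ((σ - b) ^ 2) 1
      have h4 := mul_le_of_le_one_left (sq_nonneg t) (min_le_right ((σ - b) ^ 2) 1)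
      rw [hA]; linarith
    rw [← div_eq_mul_inv, div_div, le_div_iff₀ (by positivity)]
    exact (mul_le_mul_of_nonneg_left h3 (norm_nonneg _)).trans h
  have e3 : ‖Complex.Gamma (σ + t * Complex.I + b)‖ ≤ Real.Gamma (σ + b) := by
    have h := norm_Gamma_le (s := σ + t * Complex.I + b) (by simp; linarith)
    simpa using h
  have hκσ : 0 < κ - σ := by linarith
  have hG2 : 0 < Real.Gamma (σ - b + 2) := Real.Gamma_pos_of_pos (by linarith)
  calc _ ≤ 1 / (κ - σ) * ((Real.Gamma (σ - b + 2) / A * (1 + t ^ 2)⁻¹) * Real.Gamma (σ + b)) := by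
        gcongr
    _ = _ := by ring

theorem besselKernel_nonneg (b : ℝ) {v : ℝ} (hv : 0 ≤ v) : 0 ≤ besselKernel b v :=
  mul_nonneg (Real.rpow_nonneg hv _) (setIntegral_nonneg measurableSet_Ioi fun y hy => by
    have hy : 0 < y := hy
    positivity)

theorem integrableOn_rpow_mul_besselKernel {κ b : ℝ} (hκ : |b| < κ) :
    IntegrableOn (fun v => v ^ (κ - 1) * besselKernel b v) (Ioi 0) := by
  have h := (hasMellin_besselKernel (b := b) (s := κ) (by simpa using hκ)).1.norm
  refine IntegrableOn.congr_fun h (fun v hv => ?_) measurableSet_Ioi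
  have hv : 0 < v := hv
  simp only
  rw [norm_smul, Complex.norm_cpow_eq_rpow_re_of_pos hv, Complex.norm_real,
    Real.norm_of_nonneg (besselKernel_nonneg b hv.le)]
  simp

/-- Substitution v = τ x. Thus x^κ times the integrated kernel is a primitive of v^(κ-1)
`besselKernel` b v, from which its continuity and `integratedKernel_sub` follow. -/
theorem integratedKernel_eq {κ : ℝ} (b : ℝ) {x : ℝ} (hx : 0 < x) :
    integratedKernel κ b x = x ^ (-κ) * ∫ v in (0 : ℝ)..x, v ^ (κ - 1) * besselKernel b v := by
  have h := intervalIntegral.integral_comp_mul_right (a := 0) (b := 1)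
    (fun v => v ^ (κ - 1) * besselKernel b v) hx.ne'
  rw [zero_mul, one_mul] at h
  rw [integratedKernel, ← intervalIntegral.integral_of_le zero_le_one]
  have e : ∀ τ ∈ uIcc (0 : ℝ) 1, τ ^ (κ - 1) * besselKernel b (τ * x) =
      x ^ (1 - κ) * ((τ * x) ^ (κ - 1) * besselKernel b (τ * x)) := by
    intro τ hτ
    rw [uIcc_of_le zero_le_one] at hτ
    rw [Real.mul_rpow hτ.1 hx.le]
    have : x ^ (1 - κ) * x ^ (κ - 1) = 1 := by rw [← Real.rpow_add hx]; simp
    linear_combination (-(τ ^ (κ - 1) * besselKernel b (τ * x))) * this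
  rw [intervalIntegral.integral_congr e, intervalIntegral.integral_const_mul, h, smul_eq_mul,
    ← mul_assoc]
  congr 1
  rw [← Real.rpow_neg_one x, ← Real.rpow_add hx]
  congr 1
  ring

theorem continuousAt_integratedKernel {κ b x : ℝ} (hκ : |b| < κ) (hx : 0 < x) :
    ContinuousAt (integratedKernel κ b) x := by
  have hint := integrableOn_rpow_mul_besselKernel hκ
  have h1 : ContinuousAt (fun x => ∫ v in (0 : ℝ)..x, v ^ (κ - 1) * besselKernel b v) x := by
    have h2 : ContinuousOn (fun x => ∫ v in (0 : ℝ)..x, v ^ (κ - 1) * besselKernel b v)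
        (Icc 0 (x + 1)) := by
      have := intervalIntegral.continuousOn_primitive_interval (μ := volume)
        (f := fun v => v ^ (κ - 1) * besselKernel b v) (a := 0) (b := x + 1) (by
          rw [uIcc_of_le (by linarith), integrableOn_Icc_iff_integrableOn_Ioc]
          exact hint.mono_set fun y hy => hy.1)
      rwa [uIcc_of_le (by linarith)] at this
    exact h2.continuousAt (Icc_mem_nhds hx (by linarith))
  refine ((Real.continuousAt_rpow_const x (-κ) (Or.inl hx.ne')).mul h1).congr ?_
  filter_upwards [lt_mem_nhds hx] with y hy
  exact (integratedKernel_eq b hy).symm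

/-- The Meijer function of the theorem as an integral of a Bessel function. -/
theorem meijerG2113_eq_integratedKernel {κ b z : ℝ} (hκ : |b| < κ) (hz : 0 < z) :
    meijerG2113 (1 - κ) b (-b) (-κ) z = integratedKernel κ b z := by
  set σ := (κ + |b|) / 2 with hσ
  have h1 : |b| < σ := by rw [hσ]; linarith
  have h2 : σ < κ := by rw [hσ]; linarith
  have hkey : meijerG [1 - κ] [] [b, -b] [-κ] z = (integratedKernel κ b z : ℂ) := by
    have hmel : ∀ t : ℝ, mellin (fun x => (integratedKernel κ b x : ℂ)) (σ + t * Complex.I) =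
        1 / (κ - (σ + t * Complex.I)) * (Complex.Gamma (σ + t * Complex.I - b) *
          Complex.Gamma (σ + t * Complex.I + b)) := fun t =>
      (hasMellin_integratedKernel (by simpa using h1) (by simpa using h2)).2
    have hinv := mellinInv_mellin_eq σ (fun x => (integratedKernel κ b x : ℂ)) hz
      (hasMellin_integratedKernel (s := σ) (by simpa using h1) (by simpa using h2)).1
      ((verticalIntegrable_gamma_mul h1 h2).congr (ae_of_all _ fun t => (hmel t).symm))
      (Complex.continuous_ofReal.continuousAt.comp (continuousAt_integratedKernel hκ hz))
    rw [← hinv, mellinInv, meijerG]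
    have habs : (meijerAbscissa [1 - κ] [b, -b] : ℝ) = -σ := by
      have e1 : {x | x ∈ [1 - κ]} = {1 - κ} := by ext; simp
      have e2 : {x | x ∈ [b, -b]} = {b, -b} := by ext; simp
      rw [meijerAbscissa, e1, e2, csSup_singleton, csInf_pair, hσ]
      have : b ⊓ -b = -|b| := by rw [← neg_neg (b ⊓ -b), neg_inf, neg_neg, sup_comm]; rfl
      rw [this]; ring
    -- The Mellin-Barnes contour has abscissa -σ, the negative of the one used for inversion; t ↦ -t
    -- completes the change of s to -s.
    rw [habs, ← integral_neg_eq_self, Complex.real_smul]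
    congr 1
    · push_cast; ring
    · refine integral_congr_ae (ae_of_all _ fun t => ?_)
      simp only
      rw [hmel t]
      simp only [meijerIntegrand, List.pure_def, List.bind_eq_flatMap, List.flatMap_cons,
        List.flatMap_nil, List.cons_append, List.nil_append, List.map_cons, List.map_nil,
        List.prod_cons, List.prod_nil, mul_one]
      have hk : (κ : ℂ) - (σ + t * Complex.I) ≠ 0 := by
        intro h
        have := congrArg Complex.re h
        simp at this
        linarith
      -- The upper parameter and the third lower one differ by 1, so their Gamma factors form the
      -- quotient Γ(κ - s) / Γ(κ - s + 1) = 1 / (κ - s).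
      have hG := Complex.Gamma_add_one _ hk
      have hGne : Complex.Gamma ((κ : ℂ) - (σ + t * Complex.I)) ≠ 0 := by
        refine Complex.Gamma_ne_zero_of_re_pos ?_
        simp; linarith
      push_cast
      have a1 : (b : ℂ) - (-σ + -t * Complex.I) = σ + t * Complex.I + b := by ring
      have a2 : -(b : ℂ) - (-σ + -t * Complex.I) = σ + t * Complex.I - b := by ring
      have a3 : (1 : ℂ) - (1 - κ) + (-σ + -t * Complex.I) = κ - (σ + t * Complex.I) := by ring
      have a4 : (1 : ℂ) - -κ + (-σ + -t * Complex.I) = κ - (σ + t * Complex.I) + 1 := by ring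
      have a5 : (-σ + -t * Complex.I : ℂ) = -(σ + t * Complex.I) := by ring
      rw [a1, a2, a3, a4, a5, hG, smul_eq_mul]
      field_simp
  rw [meijerG2113, hkey, Complex.ofReal_re]

/-- The bound e^(-1/y) ≤ M! y^M makes the integrand integrable at 0 as soon as 2b + M > 0; at
infinity e^(-yv) suffices. -/
theorem integrableOn_besselKernel_integrand (b : ℝ) {v : ℝ} (hv : 0 < v) :
    IntegrableOn (fun y => y ^ (2 * b - 1) * Real.exp (-y⁻¹) * Real.exp (-(y * v))) (Ioi 0) := by
  obtain ⟨M, hM⟩ := exists_nat_gt (-(2 * b))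
  have h := (integrableOn_rpow_mul_exp_neg_mul_rpow (p := 1) (s := 2 * b + M - 1) (b := v)
    (by linarith) one_pos hv).const_mul (M.factorial : ℝ)
  refine Integrable.mono' h (Measurable.aestronglyMeasurable (by fun_prop)) ?_
  filter_upwards [ae_restrict_mem measurableSet_Ioi] with y hy
  have hy : 0 < y := hy
  have h1 := Real.pow_div_factorial_le_exp y⁻¹ (by positivity) M
  have h2 : Real.exp (-y⁻¹) ≤ M.factorial * y ^ M := by
    rw [Real.exp_neg]
    refine inv_le_of_inv_le₀ (by positivity) (le_trans (le_of_eq ?_) h1)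
    rw [inv_pow]
    field_simp
  rw [Real.norm_of_nonneg (by positivity), Real.rpow_one,
    show 2 * b + M - 1 = 2 * b - 1 + M by ring, Real.rpow_add hy, Real.rpow_natCast]
  calc y ^ (2 * b - 1) * Real.exp (-y⁻¹) * Real.exp (-(y * v))
      ≤ y ^ (2 * b - 1) * (M.factorial * y ^ M) * Real.exp (-(y * v)) := by gcongr
    _ = _ := by rw [show -(y * v) = -v * y by ring]; ring

theorem continuousAt_besselKernel (b : ℝ) {v : ℝ} (hv : 0 < v) :
    ContinuousAt (besselKernel b) v := by
  refine (Real.continuousAt_rpow_const v b (Or.inl hv.ne')).mul ?_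
  refine continuousAt_of_dominated (Eventually.of_forall fun x => Measurable.aestronglyMeasurable
    (by fun_prop)) ?_ (integrableOn_besselKernel_integrand b (half_pos hv))
    (ae_of_all _ fun y => by fun_prop)
  filter_upwards [lt_mem_nhds (half_lt_self hv)] with x hx
  filter_upwards [ae_restrict_mem measurableSet_Ioi] with y hy
  have hy : 0 < y := hy
  rw [Real.norm_of_nonneg (by positivity)]
  gcongr

/-- Scaling t = d y. This is the t-integral of Ψ̄₃, where the factor e^(-r𝒟/t) is kept and d = r 𝒟.
-/
theorem integral_Ioi_rpow_mul_exp_mul_exp_inv (b : ℝ) {c d : ℝ} (hc : 0 < c) (hd : 0 < d) :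
    ∫ t in Ioi (0 : ℝ), t ^ (2 * b - 1) * Real.exp (-(c * t)) * Real.exp (-(d / t)) =
      c ^ (-b) * d ^ b * besselKernel b (c * d) := by
  have h := integral_comp_mul_left_Ioi
    (fun t => t ^ (2 * b - 1) * Real.exp (-(c * t)) * Real.exp (-(d / t))) 0 hd
  rw [mul_zero, smul_eq_mul, eq_inv_mul_iff_mul_eq₀ hd.ne'] at h
  rw [← h, besselKernel, Real.mul_rpow hc.le hd.le, ← integral_const_mul, ← integral_const_mul,
    ← integral_const_mul]
  refine setIntegral_congr_fun measurableSet_Ioi fun y hy => ?_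
  have hy : 0 < y := hy
  have e1 : d * d ^ (2 * b - 1) = d ^ b * d ^ b := by
    nth_rw 1 [← Real.rpow_one d]
    rw [← Real.rpow_add hd, ← Real.rpow_add hd]
    congr 1
    ring
  have e2 : c ^ (-b) * c ^ b = 1 := by rw [← Real.rpow_add hc]; simp
  rw [Real.mul_rpow hd.le hy.le, show d / (d * y) = y⁻¹ by field_simp,
    show c * (d * y) = y * (c * d) by ring]
  linear_combination (y ^ (2 * b - 1) * Real.exp (-y⁻¹) * Real.exp (-(y * (c * d)))) * e1 -
    (y ^ (2 * b - 1) * Real.exp (-y⁻¹) * Real.exp (-(y * (c * d))) * d ^ b * d ^ b) * e2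

/-- By `integratedKernel_eq` each term on the left is c^(-κ) times a primitive evaluated at c u^ν.
The difference is an integral between the two values, and v = c u^ν brings it to the variable u. -/
theorem integratedKernel_sub {κ b c ν x y : ℝ} (hκ : |b| < κ) (hc : 0 < c)
    (hx : 0 < x) (hxy : x ≤ y) :
    y ^ (ν * κ) * integratedKernel κ b (c * y ^ ν) -
        x ^ (ν * κ) * integratedKernel κ b (c * x ^ ν) =
      ν * ∫ u in x..y, u ^ (ν * κ - 1) * besselKernel b (c * u ^ ν) := by
  have hpos : ∀ u ∈ uIcc x y, 0 < u := fun u hu => by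
    rw [uIcc_of_le hxy] at hu
    exact hx.trans_le hu.1
  have hcu : ∀ u, 0 < u → 0 < c * u ^ ν := fun u hu => mul_pos hc (Real.rpow_pos_of_pos hu _)
  have hfac : ∀ u, 0 < u → u ^ (ν * κ) * (c * u ^ ν) ^ (-κ) = c ^ (-κ) := fun u hu => by
    rw [Real.mul_rpow hc.le (Real.rpow_nonneg hu.le _), ← Real.rpow_mul hu.le, mul_left_comm,
      ← Real.rpow_add hu]
    simp
  have hint : ∀ z, 0 < z → IntervalIntegrable (fun v => v ^ (κ - 1) * besselKernel b v)
      volume 0 z := fun z hz => by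
    rw [intervalIntegrable_iff_integrableOn_Ioc_of_le hz.le]
    exact (integrableOn_rpow_mul_besselKernel hκ).mono_set fun _ h => h.1
  have hy := hx.trans_le hxy
  rw [integratedKernel_eq b (hcu x hx), integratedKernel_eq b (hcu y hy), ← mul_assoc, ← mul_assoc,
    hfac x hx, hfac y hy, ← mul_sub,
    intervalIntegral.integral_interval_sub_left (hint _ (hcu y hy)) (hint _ (hcu x hx))]
  have h := intervalIntegral.integral_comp_mul_deriv' (a := x) (b := y)
    (f := fun u => c * u ^ ν) (f' := fun u => c * (ν * u ^ (ν - 1)))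
    (g := fun v => v ^ (κ - 1) * besselKernel b v) ?_ ?_ ?_
  · rw [← h, ← intervalIntegral.integral_const_mul, ← intervalIntegral.integral_const_mul]
    refine intervalIntegral.integral_congr fun u hu => ?_
    obtain ⟨l, hl⟩ := exists_exp_eq (hpos u hu)
    obtain ⟨m, hm⟩ := exists_exp_eq hc
    simp only [Function.comp]
    have key : c ^ (-κ) * ((c * u ^ ν) ^ (κ - 1) * (c * u ^ (ν - 1))) = u ^ (ν * κ - 1) := by
      rw [hl, hm]
      simp only [← Real.exp_mul, ← Real.exp_add]
      congr 1
      ring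
    rw [← key]
    ring
  · intro u hu
    exact (Real.hasDerivAt_rpow_const (Or.inl (hpos u hu).ne')).const_mul c
  · exact continuousOn_const.mul (continuousOn_const.mul
      (continuousOn_id.rpow_const fun u hu => Or.inl (hpos u hu).ne'))
  · rintro _ ⟨u, hu, rfl⟩
    have := hcu u (hpos u hu)
    exact ((Real.continuousAt_rpow_const _ _ (Or.inl this.ne')).mul
      (continuousAt_besselKernel b this)).continuousWithinAt

/-! ### The terms of Ψ̄₃ -/

namespace Params

variable {p : Params} {Pth γA : ℝ}

/-- This separates the two families of poles of the Meijer function. Here ς₂ - ς₃ = n + k₂ and ς₂ +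
ς₃ = k₁ + k₂ + 1; the shift r > 0 is needed when n = k₂ = 0. -/
theorem abs_ς₃_lt (n k₁ k₂ : ℕ) {r : ℝ} (hr : 0 < r) : |ς₃ n k₁| < ς₂ n k₁ k₂ + r := by
  have h0 : (0 : ℝ) ≤ n := n.cast_nonneg
  have h1 : (0 : ℝ) ≤ k₁ := k₁.cast_nonneg
  have h2 : (0 : ℝ) ≤ k₂ := k₂.cast_nonneg
  rw [abs_lt, ς₃, ς₂]
  constructor <;> linarith

theorem meijerPart_eq (hP : 0 < Pth) (hγ : 0 < γA) (n k₁ k₂ : ℕ) {s h w : ℝ} (hs : 0 < s)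
    (hh : 0 < h) (hw : 0 < w) :
    p.meijerPart Pth γA n k₁ k₂ s h w = h ^ (p.ν * (ς₂ n k₁ k₂ + s / p.ν)) *
      integratedKernel (ς₂ n k₁ k₂ + s / p.ν) (ς₃ n k₁)
        (p.θ Pth γA / p.E * p.D γA * (p.βbar * w ^ 2 / p.E) * h ^ p.ν) := by
  have hν := p.ν_pos
  have hE := p.E_pos
  have hD := p.D_pos hγ
  have hβ := p.βbar_pos
  have hθ := p.θ_pos hP hγ
  have := Real.rpow_pos_of_pos hh p.ν
  rw [← meijerG2113_eq_integratedKernel (abs_ς₃_lt n k₁ k₂ (by positivity)) (by positivity),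
    meijerPart]
  congr 1
  · congr 1; field_simp
  · congr 1
    · ring
    · ring
    · field_simp

theorem continuousOn_meijerPart (hP : 0 < Pth) (hγ : 0 < γA) (n k₁ k₂ : ℕ) {s h : ℝ} (hs : 0 < s)
    (hh : 0 < h) : ContinuousOn (p.meijerPart Pth γA n k₁ k₂ s h) (Icc p.wmin p.wmax) := by
  have hν := p.ν_pos
  have hE := p.E_pos
  have hD := p.D_pos hγ
  have hβ := p.βbar_pos
  have hθ := p.θ_pos hP hγ
  have := Real.rpow_pos_of_pos hh p.ν
  refine ContinuousOn.congr (f := fun w => h ^ (p.ν * (ς₂ n k₁ k₂ + s / p.ν)) *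
      integratedKernel (ς₂ n k₁ k₂ + s / p.ν) (ς₃ n k₁)
        (p.θ Pth γA / p.E * p.D γA * (p.βbar * w ^ 2 / p.E) * h ^ p.ν)) ?_ fun w hw =>
    meijerPart_eq hP hγ n k₁ k₂ hs hh (p.wmin_pos.trans_le hw.1)
  refine continuousOn_const.mul fun w hw => ContinuousAt.continuousWithinAt ?_
  have hw := p.wmin_pos.trans_le hw.1
  exact ContinuousAt.comp (f := fun w =>
    p.θ Pth γA / p.E * p.D γA * (p.βbar * w ^ 2 / p.E) * h ^ p.ν)
    (continuousAt_integratedKernel (abs_ς₃_lt n k₁ k₂ (by positivity)) (by positivity))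
    (by fun_prop)

/-- The index s + 1 belongs to the weight u^s, because νκ - 1 = ν ς₂ + s for κ = ς₂ + (s + 1) / ν.
Hence index 3 goes with u² and index 2 with u. -/
theorem meijerPart_sub (hP : 0 < Pth) (hγ : 0 < γA) (n k₁ k₂ : ℕ) (s : ℕ) {x y w : ℝ}
    (hx : 0 < x) (hxy : x ≤ y) (hw : 0 < w) :
    p.meijerPart Pth γA n k₁ k₂ (s + 1 : ℕ) y w - p.meijerPart Pth γA n k₁ k₂ (s + 1 : ℕ) x w =
      p.ν * ∫ u in x..y, u ^ s * (u ^ (p.ν * ς₂ n k₁ k₂) * besselKernel (ς₃ n k₁)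
        (p.θ Pth γA / p.E * p.D γA * (p.βbar * w ^ 2 / p.E) * u ^ p.ν)) := by
  have hν := p.ν_pos
  have hE := p.E_pos
  have hD := p.D_pos hγ
  have hβ := p.βbar_pos
  have hθ := p.θ_pos hP hγ
  have hs : (0 : ℝ) < (s + 1 : ℕ) := by positivity
  rw [meijerPart_eq hP hγ n k₁ k₂ hs hx hw, meijerPart_eq hP hγ n k₁ k₂ hs (hx.trans_le hxy) hw,
    integratedKernel_sub (abs_ς₃_lt n k₁ k₂ (by positivity)) (by positivity) hx hxy]
  congr 1
  refine intervalIntegral.integral_congr fun u hu => ?_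
  rw [uIcc_of_le hxy] at hu
  have hu := hx.trans_le hu.1
  rw [← mul_assoc, ← Real.rpow_natCast u s, ← Real.rpow_add hu]
  congr 2
  push_cast
  field_simp
  ring

end Params
namespace Params

variable {p : Params} {Pth γA : ℝ}

/-- The combination of Meijer functions in the theorem as an integral over both distances. -/
theorem meijer_combination_eq (hP : 0 < Pth) (hγ : 0 < γA) (k n k₁ k₂ : ℕ) :
    p.I₂ Pth γA k n k₁ k₂ - p.I₃ Pth γA k n k₁ k₂ - p.I₄ Pth γA k n k₁ k₂
      + p.I₅ Pth γA k n k₁ k₂ =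
      ∫ w in Icc p.wmin p.wmax, p.ν * (∫ u in Icc p.h₁ (p.h₂ / Real.cos p.φ),
        p.distRecWeight u * (u ^ (p.ν * ς₂ n k₁ k₂) * besselKernel (ς₃ n k₁)
          (p.θ Pth γA / p.E * p.D γA * (p.βbar * w ^ 2 / p.E) * u ^ p.ν))) *
        w ^ (2 * (k : ℝ) + n - k₁ + 2) * Real.exp (-(p.D γA * p.βbar * w ^ 2 / p.E)) := by
  have hν := p.ν_pos
  have hE := p.E_pos
  have hD := p.D_pos hγ
  have hβ := p.βbar_pos
  have hθ := p.θ_pos hP hγ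
  have hc := p.cos_φ_pos
  have h1 := p.h₁_pos
  have h2 := p.h₂_pos
  have hg : ContinuousOn (fun w : ℝ => w ^ (2 * (k : ℝ) + n - k₁ + 2)) (Icc p.wmin p.wmax) :=
    continuousOn_id.rpow_const fun w hw => Or.inl (p.wmin_pos.trans_le hw.1).ne'
  have hint : ∀ {s x y : ℝ}, 0 < s → 0 < x → 0 < y → IntervalIntegrable (fun w =>
      (p.meijerPart Pth γA n k₁ k₂ s y w - p.meijerPart Pth γA n k₁ k₂ s x w) *
      w ^ (2 * (k : ℝ) + n - k₁ + 2) * Real.exp (-(p.D γA * p.βbar * w ^ 2 / p.E)))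
      volume p.wmin p.wmax := fun hs hx hy => by
    refine ContinuousOn.intervalIntegrable_of_Icc p.wmin_lt_wmax.le ?_
    exact (((continuousOn_meijerPart hP hγ n k₁ k₂ hs hy).sub
      (continuousOn_meijerPart hP hγ n k₁ k₂ hs hx)).mul hg).mul
      (Continuous.continuousOn (by fun_prop))
  simp only [I₂, I₃, I₄, I₅, meijerIntegral]
  have i2 := hint (s := 3) three_pos h1 h2
  have i3 := (hint two_pos h1 (div_pos h1 hc)).const_mul p.h₁
  have i4 := (hint three_pos (div_pos h1 hc) (div_pos h2 hc)).const_mul (Real.cos p.φ)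
  have i5 := (hint two_pos h2 (div_pos h2 hc)).const_mul p.h₂
  rw [← intervalIntegral.integral_const_mul, ← intervalIntegral.integral_const_mul,
    ← intervalIntegral.integral_const_mul, ← intervalIntegral.integral_sub i2 i3,
    ← intervalIntegral.integral_sub (i2.sub i3) i4,
    ← intervalIntegral.integral_add ((i2.sub i3).sub i4) i5, integral_Icc_eq_integral_Ioc,
    ← intervalIntegral.integral_of_le p.wmin_lt_wmax.le]
  refine intervalIntegral.integral_congr fun w hw => ?_
  rw [uIcc_of_le p.wmin_lt_wmax.le] at hw
  have hw0 := p.wmin_pos.trans_le hw.1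
  have m3 := fun {x y : ℝ} (hx : 0 < x) (hxy : x ≤ y) =>
    meijerPart_sub (p := p) hP hγ n k₁ k₂ 2 hx hxy hw0
  have m2 := fun {x y : ℝ} (hx : 0 < x) (hxy : x ≤ y) =>
    meijerPart_sub (p := p) hP hγ n k₁ k₂ 1 hx hxy hw0
  simp only [Nat.reduceAdd, Nat.cast_ofNat, pow_one] at m3 m2
  have hcont : ContinuousOn (fun u : ℝ => u ^ (p.ν * ς₂ n k₁ k₂) * besselKernel (ς₃ n k₁)
          (p.θ Pth γA / p.E * p.D γA * (p.βbar * w ^ 2 / p.E) * u ^ p.ν))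
      (Icc p.h₁ (p.h₂ / Real.cos p.φ)) := by
    intro u hu
    have hu0 := h1.trans_le hu.1
    have := Real.rpow_pos_of_pos hu0 p.ν
    refine ContinuousAt.continuousWithinAt ?_
    refine (Real.continuousAt_rpow_const u _ (Or.inl hu0.ne')).mul ?_
    exact ContinuousAt.comp (f := fun u : ℝ =>
      p.θ Pth γA / p.E * p.D γA * (p.βbar * w ^ 2 / p.E) * u ^ p.ν)
      (continuousAt_besselKernel _ (by positivity))
      (continuousAt_const.mul (Real.continuousAt_rpow_const u _ (Or.inl hu0.ne')))
  rw [integral_Icc_eq_integral_Ioc, ← intervalIntegral.integral_of_le p.h₁_lt_top.le,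
    p.integral_distRecWeight_mul hcont, m3 h1 p.h₁_lt_h₂.le, m2 h1 (p.lt_div_cos h1).le,
    m2 h2 (p.lt_div_cos h2).le, m3 (by positivity) p.div_cos_lt_div_cos.le]
  ring

theorem psi3_factor_eq {w u θ β E D : ℝ} (hw : 0 < w) (hu : 0 < u) (hθ : 0 < θ) (hβ : 0 < β)
    (hE : 0 < E) (hD : 0 < D) (ν : ℝ) {k n k₁ : ℕ} (hk₁ : k₁ ≤ n + k) (k₂ : ℕ) :
    w ^ (2 * k + 3) * (D ^ (n + k - k₁) / E ^ (k + 1)) * (θ / E * u ^ ν) ^ (n + k₂) *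
      ((β * w ^ 2 / E) ^ (-ς₃ n k₁) * (θ / E * u ^ ν * D) ^ ς₃ n k₁) =
      D ^ ((2 * (k : ℝ) + n - k₁ + 1) / 2) / (β ^ ς₃ n k₁ * E ^ ((k : ℝ) + n + k₂ + 1)) *
        θ ^ ((n : ℝ) + k₂ + ς₃ n k₁) * (u ^ (ν * ς₂ n k₁ k₂) *
          w ^ (2 * (k : ℝ) + n - k₁ + 2)) := by
  obtain ⟨lw, rfl⟩ := exists_exp_eq hw
  obtain ⟨lu, rfl⟩ := exists_exp_eq hu
  obtain ⟨lθ, rfl⟩ := exists_exp_eq hθ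
  obtain ⟨lβ, rfl⟩ := exists_exp_eq hβ
  obtain ⟨lE, rfl⟩ := exists_exp_eq hE
  obtain ⟨lD, rfl⟩ := exists_exp_eq hD
  simp only [← Real.exp_nat_mul, ← Real.exp_add, ← Real.exp_sub, ← Real.exp_mul]
  congr 1
  push_cast [Nat.cast_sub hk₁, ς₂, ς₃]
  ring

/-- Here u and t do not separate, as e^(-r𝒟/t) couples them. The t-integral over (0, ∞) is evaluated
first and gives the Bessel kernel of index ς₃, since 2 ς₃ - 1 = k₁ - n is the exponent of t. The
u-integral of this kernel is the combination of Meijer functions. -/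
theorem psi3Term_eq (hP : 0 < Pth) (hγ : 0 < γA) {k n k₁ : ℕ} (hk₁ : k₁ ≤ n + k) (k₂ : ℕ) :
    p.psi3Term Pth γA k n k₁ k₂ =
      p.ν * ∫ q, p.partWeight Pth γA k n k₁ q.1 q.2.1 q.2.2 *
        Real.exp (-(p.rateArg Pth γA q.2.1 * p.D γA / q.2.2)) * ((-1) ^ k₂ / (k₂.factorial : ℝ) *
          p.rateArg Pth γA q.2.1 ^ k₂) ∂p.region 0 := by
  have hE := p.E_pos
  have hD := p.D_pos hγ
  have hβ := p.βbar_pos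
  have hθ := p.θ_pos hP hγ
  have hm := measurable_rateArg (p := p) (Pth := Pth) (γA := γA)
  have hint := integrable_mul_pow_div_factorial
    (integrable_partWeight_exp_div (p := p) hP hγ hk₁)
    (b := fun q : ℝ × ℝ × ℝ => p.rateArg Pth γA q.2.1) (by fun_prop)
    (ae_abs_rateArg_le hP hγ 0) k₂
  set b := ς₃ n k₁ with hb
  set C := (-1) ^ k₂ / (k₂.factorial : ℝ) * (p.D γA ^ ((2 * (k : ℝ) + n - k₁ + 1) / 2) /
      (p.βbar ^ b * p.E ^ ((k : ℝ) + n + k₂ + 1))) * p.θ Pth γA ^ ((n : ℝ) + k₂ + b) with hC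
  have hpoint : ∀ w, 0 < w → ∀ u, 0 < u →
      ∫ t in Ioi (0 : ℝ), p.partWeight Pth γA k n k₁ w u t *
        Real.exp (-(p.rateArg Pth γA u * p.D γA / t)) * ((-1) ^ k₂ / (k₂.factorial : ℝ) *
          p.rateArg Pth γA u ^ k₂) =
      C * (w ^ (2 * (k : ℝ) + n - k₁ + 2) * Real.exp (-(p.D γA * p.βbar * w ^ 2 / p.E))) *
        (p.distRecWeight u * (u ^ (p.ν * ς₂ n k₁ k₂) * besselKernel b
          (p.θ Pth γA / p.E * p.D γA * (p.βbar * w ^ 2 / p.E) * u ^ p.ν))) := by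
    intro w hw u hu
    have hr := rateArg_pos (p := p) hP hγ hu
    have h := integral_Ioi_rpow_mul_exp_mul_exp_inv b
      (by positivity : 0 < p.βbar * w ^ 2 / p.E) (mul_pos hr hD)
    have hsplit : ∀ t ∈ Ioi (0 : ℝ), p.partWeight Pth γA k n k₁ w u t *
        Real.exp (-(p.rateArg Pth γA u * p.D γA / t)) * ((-1) ^ k₂ / (k₂.factorial : ℝ) *
          p.rateArg Pth γA u ^ k₂) =
        (-1) ^ k₂ / (k₂.factorial : ℝ) * p.distRecWeight u *
          (w ^ (2 * k + 3) * (p.D γA ^ (n + k - k₁) / p.E ^ (k + 1)) *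
            p.rateArg Pth γA u ^ (n + k₂)) * Real.exp (-(p.D γA * p.βbar * w ^ 2 / p.E)) *
          (t ^ (2 * b - 1) * Real.exp (-(p.βbar * w ^ 2 / p.E * t)) *
            Real.exp (-(p.rateArg Pth γA u * p.D γA / t))) := by
      intro t ht
      have ht : 0 < t := ht
      have htx : t ^ (2 * b - 1) = t ^ k₁ / t ^ n := by
        rw [hb, ς₃, show 2 * ((-(n : ℝ) + k₁ + 1) / 2) - 1 = k₁ - n by ring, Real.rpow_sub ht,
          Real.rpow_natCast, Real.rpow_natCast]
      have he : Real.exp (-(p.βbar * (w ^ 2 * (t + p.D γA) / p.E))) =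
          Real.exp (-(p.D γA * p.βbar * w ^ 2 / p.E)) *
            Real.exp (-(p.βbar * w ^ 2 / p.E * t)) := by
        rw [← Real.exp_add]; congr 1; ring
      rw [partWeight, htx, he, pow_add (p.rateArg Pth γA u)]
      ring
    have hf := psi3_factor_eq hw hu hθ hβ hE hD p.ν hk₁ k₂
    rw [← rateArg_eq, ← hb] at hf
    rw [setIntegral_congr_fun measurableSet_Ioi hsplit, integral_const_mul, h,
      show p.θ Pth γA / p.E * p.D γA * (p.βbar * w ^ 2 / p.E) * u ^ p.ν =
        p.βbar * w ^ 2 / p.E * (p.rateArg Pth γA u * p.D γA) by rw [rateArg_eq]; ring, hC]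
    linear_combination ((-1) ^ k₂ / (k₂.factorial : ℝ) * p.distRecWeight u *
      Real.exp (-(p.D γA * p.βbar * w ^ 2 / p.E)) *
      besselKernel b (p.βbar * w ^ 2 / p.E * (p.rateArg Pth γA u * p.D γA))) * hf
  rw [region, integral_prod _ hint, psi3Term, meijer_combination_eq hP hγ, ← hb, ← hC,
    ← integral_const_mul, ← integral_const_mul]
  refine integral_congr_ae ?_
  filter_upwards [hint.prod_right_ae, ae_restrict_mem measurableSet_Icc] with w hwi hw
  have hw0 := p.wmin_pos.trans_le hw.1
  rw [integral_prod _ hwi, setIntegral_congr_fun measurableSet_Icc fun u hu =>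
    hpoint w hw0 u (p.h₁_pos.trans_le hu.1), integral_const_mul]
  ring

/-! ### Summation of Ψ̄₂ and Ψ̄₃ -/

theorem lt_iff_PED_pos : p.D γA / p.E * p.ηs < Pth ↔ 0 < p.PED Pth γA := by
  have hE := p.E_pos
  have hη := p.ηs_pos
  rw [PED, sub_pos, lt_div_iff₀ hη, div_mul_eq_mul_div, div_lt_iff₀ hE]

theorem hasSum_psi2Term (hP : 0 < Pth) (hγ : 0 < γA) (hPED : 0 < p.PED Pth γA) {k n k₁ : ℕ}
    (hk₁ : k₁ ≤ n + k) : HasSum (fun k₂ => p.psi2Term Pth γA k n k₁ k₂)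
      (p.ν * ∫ q, p.partWeight Pth γA k n k₁ q.1 q.2.1 q.2.2 *
        Real.exp (-p.tailArg Pth γA q.2.1 q.2.2) ∂p.region (p.PED Pth γA)) := by
  simp only [psi2Term_eq hP hγ hPED hk₁]
  exact (hasSum_expand_div hP hγ hk₁ hPED).mul_left _

theorem hasSum_psi3Term (hP : 0 < Pth) (hγ : 0 < γA) {k n k₁ : ℕ} (hk₁ : k₁ ≤ n + k) :
    HasSum (fun k₂ => p.psi3Term Pth γA k n k₁ k₂)
      (p.ν * ∫ q, p.partWeight Pth γA k n k₁ q.1 q.2.1 q.2.2 *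
        Real.exp (-p.tailArg Pth γA q.2.1 q.2.2) ∂p.region 0) := by
  simp only [psi3Term_eq hP hγ hk₁]
  exact (hasSum_expand_rate hP hγ hk₁).mul_left _

theorem hasSum_psi2Outer (hP : 0 < Pth) (hγ : 0 < γA) (hPED : 0 < p.PED Pth γA) (k : ℕ) :
    HasSum (fun m => p.psi2Outer Pth γA k m)
      (p.ν * ∫ q, p.gainWeight γA k q.1 q.2.1 q.2.2 *
        ricianTail p.K (p.tailArg Pth γA q.2.1 q.2.2) ∂p.region (p.PED Pth γA)) := by
  refine (hasSum_gainWeight_mul_poissonCdf hP hγ k hPED.le).congr_fun fun m => ?_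
  rw [← integral_gainWeight_mul_poissonCdf hP hγ k m hPED.le, psi2Outer]
  refine Finset.sum_congr rfl fun n _ => congrArg _ (Finset.sum_congr rfl fun k₁ hk₁ => ?_)
  rw [(hasSum_psi2Term hP hγ hPED (Nat.lt_succ_iff.1 (Finset.mem_range.1 hk₁))).tsum_eq]

theorem hasSum_psi3Outer (hP : 0 < Pth) (hγ : 0 < γA) (k : ℕ) :
    HasSum (fun m => p.psi3Outer Pth γA k m)
      (p.ν * ∫ q, p.gainWeight γA k q.1 q.2.1 q.2.2 *
        ricianTail p.K (p.tailArg Pth γA q.2.1 q.2.2) ∂p.region 0) := by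
  refine (hasSum_gainWeight_mul_poissonCdf hP hγ k le_rfl).congr_fun fun m => ?_
  rw [← integral_gainWeight_mul_poissonCdf hP hγ k m le_rfl, psi3Outer]
  refine Finset.sum_congr rfl fun n _ => congrArg _ (Finset.sum_congr rfl fun k₁ hk₁ => ?_)
  rw [(hasSum_psi3Term hP hγ (Nat.lt_succ_iff.1 (Finset.mem_range.1 hk₁))).tsum_eq]

theorem psi2Converges (hP : 0 < Pth) (hγ : 0 < γA) (hPED : 0 < p.PED Pth γA) :
    p.Psi2Converges Pth γA := fun k _ =>
  ⟨fun _ _ hk₁ => (hasSum_psi2Term hP hγ hPED hk₁).summable,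
    (hasSum_psi2Outer hP hγ hPED k).summable⟩

theorem psi3Converges (hP : 0 < Pth) (hγ : 0 < γA) : p.Psi3Converges Pth γA := fun k _ =>
  ⟨fun _ _ hk₁ => (hasSum_psi3Term hP hγ hk₁).summable, (hasSum_psi3Outer hP hγ k).summable⟩

theorem psi2_eq_integral (hP : 0 < Pth) (hγ : 0 < γA) (hPED : 0 < p.PED Pth γA) :
    p.psi2 Pth γA = ∫ q, p.tripleIntegrand Pth γA q ∂p.region (p.PED Pth γA) := by
  rw [integral_tripleIntegrand hP hγ hPED.le, psi2, mul_assoc, Finset.mul_sum _ _ p.ν]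
  refine congrArg _ (Finset.sum_congr rfl fun k _ => ?_)
  rw [(hasSum_psi2Outer hP hγ hPED k).tsum_eq]
  ring

/-- This holds whatever the sign of 𝒫; the case distinction enters only through the lower limit of t
in `P6_eq_integral`, which is 0 for 𝒫 ≤ 0. -/
theorem psi3_eq_integral (hP : 0 < Pth) (hγ : 0 < γA) :
    p.psi3 Pth γA = ∫ q, p.tripleIntegrand Pth γA q ∂p.region 0 := by
  rw [integral_tripleIntegrand hP hγ le_rfl, psi3, mul_assoc, Finset.mul_sum _ _ p.ν]
  refine congrArg _ (Finset.sum_congr rfl fun k _ => ?_)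
  rw [(hasSum_psi3Outer hP hγ k).tsum_eq]
  ring

/-! ### The limit at the threshold, and the theorem -/

/-- The domain moves with P_th; expressed through an indicator on a fixed domain, the integral is
accessible to dominated convergence. -/
theorem integral_region_eq_indicator {t₀ : ℝ} (ht₀ : 0 ≤ t₀) (f : ℝ × ℝ × ℝ → ℝ) :
    ∫ q, f q ∂p.region t₀ = ∫ q, {q : ℝ × ℝ × ℝ | t₀ < q.2.2}.indicator f q ∂p.region 0 := by
  have hs : MeasurableSet {q : ℝ × ℝ × ℝ | t₀ < q.2.2} :=
    measurableSet_lt measurable_const (by fun_prop)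
  rw [integral_indicator hs, region_eq, region_eq, Measure.restrict_restrict hs]
  congr 2
  ext ⟨w, u, t⟩
  simp only [mem_inter_iff, mem_prod, mem_Ioi, mem_ofPred_eq]
  constructor
  · rintro ⟨hw, hu, ht⟩
    exact ⟨ht, hw, hu, ht₀.trans_lt ht⟩
  · rintro ⟨ht, hw, hu, _⟩
    exact ⟨hw, hu, ht⟩

/-- Continuity from the right at the threshold where `𝒫_{ℰ,𝒟}` vanishes. -/
theorem tendsto_integral_tripleIntegrand (hP : 0 < Pth) (hγ : 0 < γA)
    (hPED : p.PED Pth γA = 0) :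
    Tendsto (fun P => ∫ q, p.tripleIntegrand P γA q ∂p.region (p.PED P γA)) (𝓝[>] Pth)
      (𝓝 (∫ q, p.tripleIntegrand Pth γA q ∂p.region 0)) := by
  have hcPED : Tendsto (fun P => p.PED P γA) (𝓝[>] Pth) (𝓝 0) := by
    rw [← hPED]
    have : Continuous fun P => p.PED P γA := by unfold PED; fun_prop
    exact this.continuousAt.mono_left nhdsWithin_le_nhds
  have hpos : ∀ᶠ P in 𝓝[>] Pth, 0 < P ∧ 0 ≤ p.PED P γA := by
    filter_upwards [self_mem_nhdsWithin] with P hPP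
    have hPP : Pth < P := hPP
    refine ⟨hP.trans hPP, ?_⟩
    rw [← hPED, PED, PED]
    have := p.E_pos
    have := p.ηs_pos
    gcongr
  have hmA : ∀ P, Measurable fun q : ℝ × ℝ × ℝ => p.tailArg P γA q.2.1 q.2.2 := fun P =>
    measurable_tailArg.comp measurable_snd
  rw [integral_tripleIntegrand hP hγ le_rfl]
  have hlim : ∀ k, Tendsto (fun P => ∫ q, p.gainWeight γA k q.1 q.2.1 q.2.2 *
      ricianTail p.K (p.tailArg P γA q.2.1 q.2.2) ∂p.region (p.PED P γA)) (𝓝[>] Pth)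
      (𝓝 (∫ q, p.gainWeight γA k q.1 q.2.1 q.2.2 *
        ricianTail p.K (p.tailArg Pth γA q.2.1 q.2.2) ∂p.region 0)) := by
    intro k
    have hone : Integrable (fun q : ℝ × ℝ × ℝ => p.gainWeight γA k q.1 q.2.1 q.2.2)
        (p.region 0) := by
      simpa using integrable_gainWeight_mul (p := p) hγ k le_rfl (S := fun _ => 1)
        measurable_const (fun _ _ _ _ _ _ => by simp)
    have h : Tendsto (fun P => ∫ q, {q : ℝ × ℝ × ℝ | p.PED P γA < q.2.2}.indicator
        (fun q => p.gainWeight γA k q.1 q.2.1 q.2.2 *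
          ricianTail p.K (p.tailArg P γA q.2.1 q.2.2)) q ∂p.region 0) (𝓝[>] Pth)
      (𝓝 (∫ q, p.gainWeight γA k q.1 q.2.1 q.2.2 *
        ricianTail p.K (p.tailArg Pth γA q.2.1 q.2.2) ∂p.region 0)) := by
      -- The Rician tail is at most 1, so `gainWeight`, which does not depend on P_th, is the
      -- majorant.
      refine tendsto_integral_filter_of_dominated_convergence
        (fun q => p.gainWeight γA k q.1 q.2.1 q.2.2) ?_ ?_ hone ?_
      · refine Eventually.of_forall fun P => Measurable.aestronglyMeasurable ?_
        exact ((measurable_gainWeight k).mul ((measurable_ricianTail p.K).comp (hmA P))).indicator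
          (measurableSet_lt measurable_const (by fun_prop))
      · filter_upwards [hpos] with P hPP
        refine p.ae_region fun w hw u hu t ht => ?_
        have h0 := gainWeight_nonneg (p := p) hγ k hw hu ht
        have hA := tailArg_pos (p := p) hPP.1 hγ (p.h₁_pos.trans_le hu.1) ht
        have h1 := ricianTail_nonneg p.K_nonneg hA.le
        have h2 := ricianTail_le_one p.K_nonneg hA.le
        refine (norm_indicator_le_norm_self _ _).trans ?_
        rw [Real.norm_of_nonneg (mul_nonneg h0 h1)]
        exact mul_le_of_le_one_right h0 h2
      · refine p.ae_region fun w hw u hu t ht => ?_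
        have ht : 0 < t := ht
        have hA := tailArg_pos (p := p) hP hγ (p.h₁_pos.trans_le hu.1) ht
        have hcA : ContinuousAt (fun P => p.tailArg P γA u t) Pth := by
          unfold tailArg θ
          exact (((continuousAt_const.div continuousAt_id hP.ne').mul continuousAt_const).div_const
            _).mul continuousAt_const
        have hcT : ContinuousAt (ricianTail p.K) (p.tailArg Pth γA u t) :=
          (continuousOn_ricianTail p.K_nonneg).continuousAt (Ici_mem_nhds hA)
        have hT : Tendsto (fun P => p.gainWeight γA k w u t *
            ricianTail p.K (p.tailArg P γA u t)) (𝓝[>] Pth)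
            (𝓝 (p.gainWeight γA k w u t * ricianTail p.K (p.tailArg Pth γA u t))) :=
          ((ContinuousAt.comp (f := fun P => p.tailArg P γA u t) hcT hcA).mono_left
            nhdsWithin_le_nhds).const_mul _
        refine hT.congr' ?_
        -- For fixed t > 0 the indicator is eventually 1, as 𝒫 tends to 0.
        filter_upwards [hcPED.eventually (gt_mem_nhds ht)] with P hPt
        rw [indicator_of_mem (show (w, u, t) ∈ {q : ℝ × ℝ × ℝ | p.PED P γA < q.2.2} from hPt)]
    refine h.congr' ?_
    filter_upwards [hpos] with P hPP
    exact (integral_region_eq_indicator hPP.2 _).symm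
  refine Tendsto.congr' ?_ (Tendsto.const_mul (p.pref * p.ν)
    (tendsto_finsetSum _ fun k _ => (hlim k).const_mul (p.ζ k)))
  filter_upwards [hpos] with P hPP
  rw [integral_tripleIntegrand hPP.1 hγ hPP.2]

end Params

end Osagin

end

theorem theorem6 (p : Osagin.Params) {Ω : Type*} [MeasurableSpace Ω]
    (Pr : Measure Ω) [IsProbabilityMeasure Pr]
    (gsr grt : Ω → ℂ) (S T : Ω → EuclideanSpace ℝ (Fin 3))
    (hnet : Osagin.IsNetwork p Pr gsr grt S T)
    (Pth γA : ℝ) (hPth : 0 < Pth) (hγA : 0 < γA) :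
    (Pth > p.D γA / p.E * p.ηs →
      p.Psi2Converges Pth γA ∧
        Osagin.P6 p Pr gsr grt S T Pth γA = p.psi2 Pth γA) ∧
    (Pth = p.D γA / p.E * p.ηs →
      Tendsto (fun P => p.psi2 P γA) (𝓝[>] Pth) (𝓝 (Osagin.P6 p Pr gsr grt S T Pth γA)) ∧
        p.Psi3Converges Pth γA ∧
        Osagin.P6 p Pr gsr grt S T Pth γA = p.psi3 Pth γA) ∧
    (Pth < p.D γA / p.E * p.ηs →
      p.Psi3Converges Pth γA ∧
        Osagin.P6 p Pr gsr grt S T Pth γA = p.psi3 Pth γA) := by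
  have hP6 := Osagin.P6_eq_integral hnet hPth hγA
  have h3 : Pth ≤ p.D γA / p.E * p.ηs →
      Osagin.P6 p Pr gsr grt S T Pth γA = p.psi3 Pth γA := fun h => by
    rw [hP6, Osagin.Params.psi3_eq_integral hPth hγA, max_eq_right]
    exact not_lt.1 fun h' => h.not_gt (Osagin.Params.lt_iff_PED_pos.2 h')
  refine ⟨fun h => ?_, fun h => ⟨?_, Osagin.Params.psi3Converges hPth hγA, h3 h.le⟩,
    fun h => ⟨Osagin.Params.psi3Converges hPth hγA, h3 h.le⟩⟩
  · have hPED := Osagin.Params.lt_iff_PED_pos.1 h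
    refine ⟨Osagin.Params.psi2Converges hPth hγA hPED, ?_⟩
    rw [hP6, Osagin.Params.psi2_eq_integral hPth hγA hPED, max_eq_left hPED.le]
  · have hPED : p.PED Pth γA = 0 := by
      have hE := p.E_pos
      have hη := p.ηs_pos
      rw [h, Osagin.Params.PED]
      field_simp
      ring
    -- At the threshold P₆ is the integral over all t > 0, and to its right Ψ̄₂ is the integral over
    -- t > 𝒫, so the limit is the continuity of the triple integral. Ψ̄₂ is not evaluated at the
    -- threshold itself.
    rw [h3 h.le, Osagin.Params.psi3_eq_integral hPth hγA]
    refine (Osagin.Params.tendsto_integral_tripleIntegrand hPth hγA hPED).congr' ?_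
    filter_upwards [self_mem_nhdsWithin] with P hP
    have hP : Pth < P := hP
    exact (Osagin.Params.psi2_eq_integral (hPth.trans hP) hγA
      (Osagin.Params.lt_iff_PED_pos.1 (h ▸ hP))).symm
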